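/- Let $\mathbf k$ be a field. All collections are indexed by $n\ge 1$; $E(n)$ is a representation of $\Sigma_n$, and finite type means that every $E(n)$ is finite dimensional. **Definitions.** A quadratic operad $\mathcal P=\langle E;R\rangle=\mathcal F(E)/(R)$ is one presented by an (ungraded) collection $E=E(2)$ concentrated in arity $2$ and relations $R\subset\mathcal F(E)(3)$; its Koszul dual is $\mathcal P^!=\langle E^*\otimes\mathrm{sgn};R^\perp\rangle$. A right $\mathcal P$-module $M$ is quadratic if $M=\langle X;G\rangle_{\mathcal P}=(X\circ\mathcal P)/(G)$ with $X=X(1)$ concentrated in arity $1$ and $G\subset (X\circ\mathcal P)(2)$; its Koszul dual is the right $\mathcal P^!$-module $M^!=\langle X^*;G^\perp\rangle_{\mathcal P^!}$. The suspension of a collection $E$ is $(\mathbf sE)(n)=\mathrm{sgn}\otimes\uparrow^{n-1}E(n)$. If $\mathcal P$ is an operad and $M$ a right $\mathcal P$-module, both of finite type, the suspensions $\mathbf s\mathcal P$, $\mathbf sM$ are again an operad and a right module over it, and their duals are a cooperad $\mathcal Q=(\mathbf s\mathcal P)^*$ and a comodule $N=(\mathbf sM)^*$ over it. The cobar constructions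 are $$\Omega(\mathcal Q)=(\mathcal F(\downarrow\mathcal Q),\partial),\qquad \Omega(N,\mathcal Q)=(N\circ\mathcal F(\downarrow\mathcal Q),\partial),$$ where $\mathcal F(\downarrow\mathcal Q)$ is the free operad on the arity $\ge 2$ part of the desuspension of $\mathcal Q$ and $\partial$, of degree $-1$, is the differential induced by the cooperad and comodule structures. A quadratic operad $\mathcal P$ of finite type is Koszul if the canonical map $\pi:\Omega((\mathbf s\mathcal P)^*)\to(\mathcal P^!,0)$, induced by the projection of $\downarrow(\mathbf s\mathcal P)^*$ onto its arity $2$ part $E^*\otimes\mathrm{sgn}=\mathcal P^!(2)$, is a homology isomorphism. A quadratic module $M$ of finite type over a quadratic operad $\mathcal P$ of finite type is Koszul if the canonical map $\pi:\Omega((\mathbf sM)^*,(\mathbf s\mathcal P)^*)\to(M^!,0)$, induced by the projection of $(\mathbf sM)^*$ onto $(\mathbf sM)^*(1)=X^*=M^!(1)$, is a homology isomorphism. For $p\in\mathbb Z$ and $n\ge1$ let $F_p(n)=\big((\mathbf sM)^*_{\le p+1}\circ\mathcal F(\downarrow(\mathbf s\mathcal P)^*)\big)(n)$, where $N_{\le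 p+1}$ is the part of $N$ of arities $\le p+1$. This is an increasing filtration of $\Omega((\mathbf sM)^*,(\mathbf s\mathcal P)^*)(n)$ by subcomplexes. Let $(E^r_{pq}(n),d^r)$, $d^r:E^r_{pq}(n)\to E^r_{p-r,q+r-1}(n)$, be its spectral sequence. **Proposition.** Let $\mathcal P$ be an ungraded quadratic operad of finite type which is Koszul, and let $M$ be an ungraded right $\mathcal P$-module of finite type. Then for every $n\ge1$: * $E^1_{pq}(n)=0$ for all $q\neq0$ (in particular for $q\ge1$); * there is a canonical isomorphism $E^1_{p0}(n)\cong\big((\mathbf sM)^*(p+1)\circ\mathcal P^!\big)(n)$ for every $p\ge0$; it sends the class of an element $\nu(t_0,\dots,t_p)$, where $\nu\in(\mathbf sM)^*(p+1)$ and the $t_i$ are composites of elements of $(\downarrow(\mathbf s\mathcal P)^*)(2)=E^*\otimes\mathrm{sgn}$, to the element of the same name; * the spectral sequence is concentrated in the row $q=0$ from the term $E^1$ on, and $d^r=0$ for all $r\ge2$. If moreover $M$ is quadratic, then $M$ is Koszul if and only if, for every $n\ge1$, the complex $$0\longleftarrow E^1_{00}(n)\xleftarrow{\;d^1\;}E^1_{10}(n)\xleftarrow{\;d^1\;}E^1_{20}(n)\longleftarrow\cdots$$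 is acyclic in positive degrees, i.e. exact at $E^1_{p0}(n)$ for all $p\ge1$. -/

import Mathlib

open scoped BigOperators

universe u v

noncomputable section

namespace KoszulModules

/-! ## Relabelling bijections -/

/-- Input labels of a two-step composite, sequential case. -/
def seqEquiv {I J : Type} (K : Type) (i : I) (j : J) :
    {x : {a : I // a ≠ i} ⊕ J // x ≠ Sum.inr j} ⊕ K ≃
      {a : I // a ≠ i} ⊕ ({b : J // b ≠ j} ⊕ K) where
  toFun
    | .inl ⟨.inl a, _⟩ => .inl a
    | .inl ⟨.inr b, h⟩ => .inr (.inl ⟨b, fun e => h (by rw [e])⟩)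
    | .inr c => .inr (.inr c)
  invFun
    | .inl a => .inl ⟨.inl a, by simp⟩
    | .inr (.inl b) => .inl ⟨.inr b.1, fun e => b.2 (Sum.inr.inj e)⟩
    | .inr (.inr c) => .inr c
  left_inv := by rintro (⟨a | b, h⟩ | c) <;> rfl
  right_inv := by rintro (a | b | c) <;> rfl

/-- Input labels of a two-step composite, parallel case. -/
def parEquiv {I : Type} (J K : Type) (i i' : I) (hi : i' ≠ i) :
    {x : {a : I // a ≠ i} ⊕ J // x ≠ Sum.inl ⟨i', hi⟩} ⊕ K ≃
      {x : {a : I // a ≠ i'} ⊕ K // x ≠ Sum.inl ⟨i, hi.symm⟩} ⊕ J where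
  toFun
    | .inl ⟨.inl a, h⟩ => .inl ⟨.inl ⟨a.1, fun e => h (congrArg Sum.inl (Subtype.ext e))⟩,
        fun e => a.2 (congrArg Subtype.val (Sum.inl.inj e))⟩
    | .inl ⟨.inr b, _⟩ => .inr b
    | .inr c => .inl ⟨.inr c, by simp⟩
  invFun
    | .inl ⟨.inl a, h⟩ => .inl ⟨.inl ⟨a.1, fun e => h (congrArg Sum.inl (Subtype.ext e))⟩,
        fun e => a.2 (congrArg Subtype.val (Sum.inl.inj e))⟩
    | .inl ⟨.inr c, _⟩ => .inr c
    | .inr b => .inl ⟨.inr b, by simp⟩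
  left_inv := by rintro (⟨a | b, h⟩ | c) <;> rfl
  right_inv := by rintro (⟨a | b, h⟩ | c) <;> rfl

/-- The complement of a point, relabelled. -/
def neEquiv {I I' : Type} (σ : I ≃ I') (i : I) : {a : I // a ≠ i} ≃ {a : I' // a ≠ σ i} :=
  σ.subtypeEquiv fun _ => (σ.injective.ne_iff).symm

open Classical in
/-- Plugging a one-element set at `i`. -/
def unitEquiv {I : Type} (i : I) : {a : I // a ≠ i} ⊕ Unit ≃ I where
  toFun := Sum.elim Subtype.val (fun _ => i)
  invFun a := if h : a = i then .inr () else .inl ⟨a, h⟩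
  left_inv := by
    rintro (⟨a, h⟩ | ⟨⟩)
    · simp [h]
    · simp
  right_inv := by
    intro a
    by_cases h : a = i <;> simp [h]

/-- Plugging a set into the unique element of a one-element set. -/
def plugEquiv {I : Type} [Subsingleton I] (i : I) (J : Type) : {a : I // a ≠ i} ⊕ J ≃ J :=
  haveI : IsEmpty {a : I // a ≠ i} := ⟨fun a => a.2 (Subsingleton.elim _ _)⟩
  Equiv.emptySum _ _

/-- The planar numbering of the inputs after plugging something with `b` inputs into the
input `i` of something with `a + 1` inputs. -/
def planarEquiv (a b : ℕ) (i : Fin (a + 1)) : {j : Fin (a + 1) // j ≠ i} ⊕ Fin b ≃ Fin (a + b) where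
  toFun
    | .inl j => if h : j.1.1 < i.1 then ⟨j.1.1, by omega⟩
        else ⟨j.1.1 - 1 + b, by
          have h1 := j.1.2
          have h2 : j.1.1 ≠ i.1 := fun e => j.2 (Fin.ext e)
          omega⟩
    | .inr x => ⟨i.1 + x.1, by omega⟩
  invFun s :=
    if h : s.1 < i.1 then .inl ⟨⟨s.1, by omega⟩, fun e => by
      have := congrArg Fin.val e; simp only at this; omega⟩
    else if h' : s.1 < i.1 + b then .inr ⟨s.1 - i.1, by omega⟩
    else .inl ⟨⟨s.1 - b + 1, by omega⟩, fun e => by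
      have := congrArg Fin.val e; simp only at this; omega⟩
  left_inv := by
    rintro (⟨⟨j, hj⟩, h⟩ | ⟨x, hx⟩)
    · have h2 : j ≠ i.1 := fun e => h (Fin.ext e)
      by_cases h1 : j < i.1
      · simp [h1]
      · have h3 : ¬ (j - 1 + b < i.1) := by omega
        have h4 : ¬ (j - 1 + b < i.1 + b) := by omega
        have h5 : j - 1 + 1 = j := by omega
        simp [h1, h3, h4, h5]
    · have h1 : i.1 + x - i.1 = x := by omega
      simp [hx]
  right_inv := by
    rintro ⟨s, hs⟩
    by_cases h1 : s < i.1
    · simp [h1]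
    · by_cases h2 : s < i.1 + b
      · have : i.1 + (s - i.1) = s := by omega
        simp [h1, h2, this]
      · have h3 : ¬ (s - b + 1 < i.1) := by omega
        have h4 : s - b + b = s := by omega
        simp [h1, h2, h3, h4]

/-! ## Collections, operads, right modules (ungraded, over a field) -/

/-- A collection `{E(n)}_{n ≥ 1}` of representations of the symmetric groups, in coordinate-free
form: a functor on finite sets and bijections, with value `0` on the empty set.  The space
`E(n)` is `obj (Fin n)`; the right action of `σ` is `map σ.symm`. -/
structure Collection (k : Type u) [Field k] where
  obj : (I : Type) → [Finite I] → Type v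
  [addCommGroup : ∀ (I : Type) [Finite I], AddCommGroup (obj I)]
  [module : ∀ (I : Type) [Finite I], Module k (obj I)]
  map : ∀ {I J : Type} [Finite I] [Finite J], (I ≃ J) → obj I →ₗ[k] obj J
  map_refl : ∀ {I : Type} [Finite I] (x : obj I), map (Equiv.refl I) x = x
  map_trans : ∀ {I J K : Type} [Finite I] [Finite J] [Finite K] (e : I ≃ J) (f : J ≃ K)
    (x : obj I), map (e.trans f) x = map f (map e x)
  subsingleton_of_isEmpty : ∀ (I : Type) [Finite I] [IsEmpty I], Subsingleton (obj I)

attribute [instance] Collection.addCommGroup Collection.module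

/-- A symmetric operad of `k`-vector spaces, given by its unit and its `comp` maps `∘ᵢ`
(composition into one input). -/
structure Operad (k : Type u) [Field k] extends Collection.{u, v} k where
  one : obj Unit
  circ : ∀ {I J : Type} [Finite I] [Finite J] (i : I),
    obj I →ₗ[k] obj J →ₗ[k] obj ({a : I // a ≠ i} ⊕ J)
  circ_map : ∀ {I J I' J' : Type} [Finite I] [Finite J] [Finite I'] [Finite J'] (i : I)
    (σ : I ≃ I') (τ : J ≃ J') (p : obj I) (q : obj J),
    circ (σ i) (map σ p) (map τ q) =
      map (Equiv.sumCongr (neEquiv σ i) τ) (circ i p q)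
  circ_seq : ∀ {I J K : Type} [Finite I] [Finite J] [Finite K] (i : I) (j : J)
    (p : obj I) (q : obj J) (r : obj K),
    map (seqEquiv K i j) (circ (Sum.inr j) (circ i p q) r) = circ i p (circ j q r)
  circ_par : ∀ {I J K : Type} [Finite I] [Finite J] [Finite K] (i i' : I) (hi : i' ≠ i)
    (p : obj I) (q : obj J) (r : obj K),
    map (parEquiv J K i i' hi) (circ (Sum.inl ⟨i', hi⟩) (circ i p q) r) =
      circ (Sum.inl ⟨i, hi.symm⟩) (circ i' p r) q
  circ_one : ∀ {I : Type} [Finite I] (i : I) (p : obj I), map (unitEquiv i) (circ i p one) = p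
  one_circ : ∀ {J : Type} [Finite J] (q : obj J), map (plugEquiv () J) (circ () one q) = q

/-- A right module over the operad `P`, given by its `comp` maps. -/
structure RightModule {k : Type u} [Field k] (P : Operad.{u, v} k) extends
    Collection.{u, v} k where
  act : ∀ {I J : Type} [Finite I] [Finite J] (i : I),
    obj I →ₗ[k] P.obj J →ₗ[k] obj ({a : I // a ≠ i} ⊕ J)
  act_map : ∀ {I J I' J' : Type} [Finite I] [Finite J] [Finite I'] [Finite J'] (i : I)
    (σ : I ≃ I') (τ : J ≃ J') (x : obj I) (q : P.obj J),
    act (σ i) (map σ x) (P.map τ q) =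
      map (Equiv.sumCongr (neEquiv σ i) τ) (act i x q)
  act_seq : ∀ {I J K : Type} [Finite I] [Finite J] [Finite K] (i : I) (j : J)
    (x : obj I) (q : P.obj J) (r : P.obj K),
    map (seqEquiv K i j) (act (Sum.inr j) (act i x q) r) = act i x (P.circ j q r)
  act_par : ∀ {I J K : Type} [Finite I] [Finite J] [Finite K] (i i' : I) (hi : i' ≠ i)
    (x : obj I) (q : P.obj J) (r : P.obj K),
    map (parEquiv J K i i' hi) (act (Sum.inl ⟨i', hi⟩) (act i x q) r) =
      act (Sum.inl ⟨i, hi.symm⟩) (act i' x r) q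
  act_one : ∀ {I : Type} [Finite I] (i : I) (x : obj I), map (unitEquiv i) (act i x P.one) = x

variable {k : Type u} [Field k]

/-- `p ∘ᵢ q` with its inputs numbered in the planar order. -/
def Operad.pcirc (P : Operad.{u, v} k) {a b : ℕ} (i : Fin (a + 1)) (p : P.obj (Fin (a + 1)))
    (q : P.obj (Fin b)) : P.obj (Fin (a + b)) :=
  P.map (planarEquiv a b i) (P.circ i p q)

/-- `x ∘ᵢ q` with its inputs numbered in the planar order. -/
def RightModule.pact {P : Operad.{u, v} k} (M : RightModule P) {a b : ℕ} (i : Fin (a + 1))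
    (x : M.obj (Fin (a + 1))) (q : P.obj (Fin b)) : M.obj (Fin (a + b)) :=
  M.map (planarEquiv a b i) (M.act i x q)

/-- Finite type: every component is finite dimensional. -/
def Collection.FiniteType (C : Collection.{u, v} k) : Prop :=
  ∀ (I : Type) [Finite I], FiniteDimensional k (C.obj I)

/-! ## Binary trees, quadratic operads and quadratic modules

Label sets are finite subsets `A` of `ℕ`; the `n`-th piece of a collection is the piece labelled
by `{0, …, n-1}`. -/

/-- Planar binary trees with vertices decorated by elements of `E` and labelled leaves. -/
inductive BTree (E : Type v) : Type v
  | leaf (x : ℕ) : BTree E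
  | node (e : E) (l r : BTree E) : BTree E

namespace BTree

/-- The set of leaves. -/
def Leaf {E : Type v} : BTree E → Type
  | leaf _ => Unit
  | node _ l r => l.Leaf ⊕ r.Leaf

/-- The label of a leaf. -/
def label {E : Type v} : (t : BTree E) → t.Leaf → ℕ
  | leaf x => fun _ => x
  | node _ l r => Sum.elim l.label r.label

/-- The leaves are labelled bijectively by `A`. -/
def Linear {E : Type v} (A : Finset ℕ) (t : BTree E) : Prop :=
  Function.Injective t.label ∧ Set.range t.label = (A : Set ℕ)

/-- The leaves of all trees of a finite family together are labelled bijectively by `A`. -/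
def FamilyLinear {E : Type v} {n : ℕ} (A : Finset ℕ) (c : Fin n → BTree E) : Prop :=
  Function.Injective (fun x : (Σ i, (c i).Leaf) => (c x.1).label x.2) ∧
    Set.range (fun x : (Σ i, (c i).Leaf) => (c x.1).label x.2) = (A : Set ℕ)

instance instFiniteLeaf {E : Type v} : (t : BTree E) → Finite t.Leaf
  | leaf _ => inferInstanceAs (Finite Unit)
  | node _ l r =>
    haveI := instFiniteLeaf l
    haveI := instFiniteLeaf r
    inferInstanceAs (Finite (l.Leaf ⊕ r.Leaf))

/-- The labelling of a linear tree as a bijection onto `A`. -/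
def labelEquiv {E : Type v} {A : Finset ℕ} (t : BTree E) (h : t.Linear A) : t.Leaf ≃ A :=
  (Equiv.ofInjective t.label h.1).trans (Equiv.setCongr h.2)

end BTree

/-- A space of binary generators `E = E(2)` with the action `τ` of the transposition, and a set
`R` of formal combinations of the elements `(e, f, σ)`, where `(e, f, σ)` stands for the element
`e(f(x_{σ 0}, x_{σ 1}), x_{σ 2})` of `F(E)(3)`; these elements span `F(E)(3)`. -/
structure QuadData (k : Type u) [Field k] where
  E : Type v
  [addCommGroup : AddCommGroup E]
  [module : Module k E]
  τ : E →ₗ[k] E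
  R : Set ((E × E × Equiv.Perm (Fin 3)) →₀ k)

attribute [instance] QuadData.addCommGroup QuadData.module

/-- The defining relations among decorated planar trees: multilinearity and equivariance (these
define the free operad `F(E)`), and the operadic ideal generated by `R`. -/
inductive QuadData.Rel (D : QuadData.{u, v} k) : (BTree D.E →₀ k) → Prop
  | add (e e' : D.E) (l r : BTree D.E) :
      D.Rel (.single (.node (e + e') l r) 1 - .single (.node e l r) 1 - .single (.node e' l r) 1)
  | smul (a : k) (e : D.E) (l r : BTree D.E) :
      D.Rel (.single (.node (a • e) l r) 1 - .single (.node e l r) a)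
  | swap (e : D.E) (l r : BTree D.E) :
      D.Rel (.single (.node (D.τ e) r l) 1 - .single (.node e l r) 1)
  | rel (ρ : (D.E × D.E × Equiv.Perm (Fin 3)) →₀ k) (hρ : ρ ∈ D.R) (g : Fin 3 → BTree D.E) :
      D.Rel (ρ.mapDomain fun x =>
        .node x.1 (.node x.2.1 (g (x.2.2 0)) (g (x.2.2 1))) (g (x.2.2 2)))
  | left (e : D.E) (r : BTree D.E) (x : BTree D.E →₀ k) (hx : D.Rel x) :
      D.Rel (x.mapDomain fun t => .node e t r)
  | right (e : D.E) (l : BTree D.E) (x : BTree D.E →₀ k) (hx : D.Rel x) :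
      D.Rel (x.mapDomain fun t => .node e l t)

/-- Formal combinations of decorated trees labelled bijectively by `A`. -/
abbrev QuadData.Raw (D : QuadData.{u, v} k) (A : Finset ℕ) : Type (max u v) :=
  {t : BTree D.E // t.Linear A} →₀ k

/-- The relations among decorated trees labelled bijectively by `A`. -/
def QuadData.relations (D : QuadData.{u, v} k) (A : Finset ℕ) : Submodule k (D.Raw A) :=
  (Submodule.span k {x | D.Rel x}).comap (Finsupp.lmapDomain k k Subtype.val)

/-- The piece `⟨E; R⟩(A) = (F(E)/(R))(A)` of the quadratic operad `⟨E; R⟩`. -/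
abbrev QuadData.Piece (D : QuadData.{u, v} k) (A : Finset ℕ) : Type (max u v) :=
  D.Raw A ⧸ D.relations A

section Operads

variable (P : Operad.{u, v} k)

/-- The quadratic data of an operad: `E = P(2)` and
`R = ker (F(E)(3) → P(3))`. -/
abbrev Operad.quadData : QuadData.{u, v} k where
  E := P.obj (Fin 2)
  τ := P.map (Equiv.swap 0 1)
  R := {ρ | ρ.sum (fun x c => c • P.map x.2.2 (P.pcirc (a := 1) (b := 2) 0 x.1 x.2.1)) = 0}

theorem fin_two_eq (j : {j : Fin 2 // j ≠ 0}) : j = ⟨1, one_ne_zero⟩ :=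
  Subtype.ext (Fin.eq_one_of_ne_zero _ j.2)

/-- Inputs of the composite at a binary vertex. -/
def nodeEquiv (L R : Type) :
    {x : {j : Fin 2 // j ≠ 0} ⊕ L // x ≠ Sum.inl ⟨1, one_ne_zero⟩} ⊕ R ≃ L ⊕ R where
  toFun
    | .inl ⟨.inl j, h⟩ => (h (congrArg Sum.inl (fin_two_eq j))).elim
    | .inl ⟨.inr a, _⟩ => .inl a
    | .inr b => .inr b
  invFun
    | .inl a => .inl ⟨.inr a, by simp⟩
    | .inr b => .inr b
  left_inv := by
    rintro (⟨j | a, h⟩ | b)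
    · exact (h (congrArg Sum.inl (fin_two_eq j))).elim
    · rfl
    · rfl
  right_inv := by rintro (a | b) <;> rfl

/-- The operadic composite of a tree decorated by elements of `P(2)`. -/
def Operad.eval (P : Operad.{u, v} k) : (t : BTree (P.obj (Fin 2))) → P.obj t.Leaf
  | .leaf _ => P.one
  | .node e l r =>
    P.map (nodeEquiv l.Leaf r.Leaf)
      (P.circ (Sum.inl ⟨1, one_ne_zero⟩) (P.circ 0 e (P.eval l)) (P.eval r))

/-- The map `F(P(2))(A) → P(A)`, on formal combinations of trees. -/
def Operad.evalMap (A : Finset ℕ) : P.quadData.Raw A →ₗ[k] P.obj A :=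
  Finsupp.linearCombination k fun t => P.map (BTree.labelEquiv t.1 t.2) (P.eval t.1)

/-- `P` is quadratic: `P = ⟨E; R⟩` with `E` concentrated in arity `2` and
`R ⊆ F(E)(3)`.  Necessarily `E = P(2)` and (the `Σ₃`-span of) `R` is the kernel of
`F(E)(3) → P(3)`. -/
def Operad.IsQuadratic : Prop :=
  ∀ A : Finset ℕ, A.Nonempty →
    Function.Surjective (P.evalMap A) ∧ LinearMap.ker (P.evalMap A) = P.quadData.relations A

/-- The pairing `F(E^∨)(3) ⊗ F(E)(3) → k`, `E^∨ = E^* ⊗ sgn`, on the spanning elements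
`φ(ψ(x_{σ' 0}, x_{σ' 1}), x_{σ' 2})` and `e(f(x_{σ 0}, x_{σ 1}), x_{σ 2})`.  It vanishes unless
the underlying trees agree, and it is `Σ₃`-equivariant up to the signature. -/
def QuadData.pairing (D : QuadData.{u, v} k)
    (x : Module.Dual k D.E × Module.Dual k D.E × Equiv.Perm (Fin 3))
    (y : D.E × D.E × Equiv.Perm (Fin 3)) : k :=
  (Equiv.Perm.sign x.2.2 : ℤ) * x.1 y.1 *
    ((if y.2.2 = x.2.2 then x.2.1 y.2.1 else 0) +
      (if y.2.2 = x.2.2 * Equiv.swap 0 1 then x.2.1 (D.τ y.2.1) else 0))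

/-- The Koszul dual quadratic data `(E^* ⊗ sgn, R^⊥)`. -/
abbrev QuadData.dual (D : QuadData.{u, v} k) : QuadData.{u, max u v} k where
  E := Module.Dual k D.E
  τ := -D.τ.dualMap
  R := {ρ' | ∀ ρ ∈ D.R, (ρ'.sum fun x c => ρ.sum fun y d => c * d * D.pairing x y) = 0}

/-- The quadratic data of the Koszul dual operad `P^!`; its piece at `A` is
`P.dualData.Piece A = P^!(A)`. -/
abbrev Operad.dualData : QuadData.{u, max u v} k := P.quadData.dual

end Operads

/-- The relations of the right `⟨E; R⟩`-module `⟨X; G⟩ = (X ∘ ⟨E; R⟩)/(G)` with `X` concentrated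
in arity `1`, among the formal symbols `x(t)`.  A pair `(x, e)` in an element of `G` stands for
`x(e) ∈ (X ∘ ⟨E; R⟩)(2) = X ⊗ E`. -/
inductive QuadData.ModRel (D : QuadData.{u, v} k) {X : Type v} [AddCommGroup X] [Module k X]
    (G : Set ((X × D.E) →₀ k)) : ((X × BTree D.E) →₀ k) → Prop
  | add (x x' : X) (t : BTree D.E) :
      D.ModRel G (.single (x + x', t) 1 - .single (x, t) 1 - .single (x', t) 1)
  | smul (a : k) (x : X) (t : BTree D.E) :
      D.ModRel G (.single (a • x, t) 1 - .single (x, t) a)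
  | tree (x : X) (y : BTree D.E →₀ k) (hy : D.Rel y) :
      D.ModRel G (y.mapDomain fun t => (x, t))
  | rel (g : (X × D.E) →₀ k) (hg : g ∈ G) (l r : BTree D.E) :
      D.ModRel G (g.mapDomain fun z => (z.1, .node z.2 l r))

/-- Formal combinations of symbols `x(t)`, `t` labelled bijectively by `A`. -/
abbrev QuadData.ModRaw (D : QuadData.{u, v} k) (X : Type v) (A : Finset ℕ) : Type (max u v) :=
  {z : X × BTree D.E // z.2.Linear A} →₀ k

/-- The relations among the symbols `x(t)`, `t` labelled bijectively by `A`. -/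
def QuadData.modRelations (D : QuadData.{u, v} k) {X : Type v} [AddCommGroup X] [Module k X]
    (G : Set ((X × D.E) →₀ k)) (A : Finset ℕ) : Submodule k (D.ModRaw X A) :=
  (Submodule.span k {x | D.ModRel G x}).comap (Finsupp.lmapDomain k k Subtype.val)

/-- The piece at `A` of the quadratic module `⟨X; G⟩` over `⟨E; R⟩`. -/
abbrev QuadData.ModPiece (D : QuadData.{u, v} k) {X : Type v} [AddCommGroup X] [Module k X]
    (G : Set ((X × D.E) →₀ k)) (A : Finset ℕ) : Type (max u v) :=
  D.ModRaw X A ⧸ D.modRelations G A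

section Modules

variable {P : Operad.{u, v} k} (M : RightModule P)

/-- The kernel `G` of `M(1) ⊗ P(2) → M(2)`. -/
def RightModule.quadRel : Set ((M.obj (Fin 1) × P.quadData.E) →₀ k) :=
  {g | g.sum (fun z c => c • M.pact (a := 0) (b := 2) 0 z.1 z.2) = 0}

/-- The map `(M(1) ∘ F(P(2)))(A) → M(A)`, on formal combinations of symbols `x(t)`. -/
def RightModule.evalMap (A : Finset ℕ) : P.quadData.ModRaw (M.obj (Fin 1)) A →ₗ[k] M.obj A :=
  Finsupp.linearCombination k fun z =>
    M.map ((plugEquiv (0 : Fin 1) z.1.2.Leaf).trans (BTree.labelEquiv z.1.2 z.2))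
      (M.act 0 z.1.1 (P.eval z.1.2))

/-- The module `M` over the (quadratic) operad `P` is quadratic: `M = (X ∘ P)/(G)` with `X`
concentrated in arity `1` and `G ⊆ (X ∘ P)(2)`.  Necessarily `X = M(1)` and (the `Σ₂`-span of)
`G` is the kernel of `(X ∘ P)(2) → M(2)`. -/
def RightModule.IsQuadratic : Prop :=
  ∀ A : Finset ℕ, A.Nonempty →
    Function.Surjective (M.evalMap A) ∧
      LinearMap.ker (M.evalMap A) = P.quadData.modRelations M.quadRel A

/-- The annihilator `G^⊥` of `G` in `(X^* ∘ E^∨)(2) = X^* ⊗ E^*`. -/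
def RightModule.dualRel :
    Set ((Module.Dual k (M.obj (Fin 1)) × P.dualData.E) →₀ k) :=
  {g' | ∀ g ∈ M.quadRel, (g'.sum fun x c => g.sum fun y d => c * d * (x.1 y.1 * x.2 y.2)) = 0}

/-- The piece `M^!(A)` of the Koszul dual module `M^! = ⟨X^*; G^⊥⟩` over `P^!`. -/
abbrev RightModule.DualPiece (A : Finset ℕ) : Type (max u v) :=
  P.dualData.ModPiece M.dualRel A

end Modules

/-! ## The free right `P^!`-module on `(sM)^*(l+1)` -/

/-- The sign by which a permutation `σ` of objects of degrees `d i` acts, the Koszul sign being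
multiplied by the signature of `σ`. -/
def permSign {n : ℕ} (σ : Equiv.Perm (Fin n)) (d : Fin n → ℕ) : ℤ :=
  ∏ i, ∏ j, if i < j ∧ σ j < σ i then (-1) ^ (1 + d i * d j) else 1

section Composite

variable (D : QuadData.{u, v} k) {l : ℕ} {N : Type v} [AddCommGroup N] [Module k N]

/-- Formal symbols `ν(t₀, …, t_l)`. -/
abbrev QuadData.Sym (D : QuadData.{u, v} k) (l : ℕ) (N : Type v) : Type v :=
  N × (Fin (l + 1) → BTree D.E)

/-- The relations of the free right `⟨E; R⟩`-module on a space `N` placed in arity `l + 1`, with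
action `α` of the symmetric group. -/
inductive QuadData.SymRel (D : QuadData.{u, v} k) {l : ℕ} {N : Type v} [AddCommGroup N]
    [Module k N] (α : Equiv.Perm (Fin (l + 1)) → N → N) : (D.Sym l N →₀ k) → Prop
  | add (ν ν' : N) (c : Fin (l + 1) → BTree D.E) :
      D.SymRel α (.single (ν + ν', c) 1 - .single (ν, c) 1 - .single (ν', c) 1)
  | smul (a : k) (ν : N) (c : Fin (l + 1) → BTree D.E) :
      D.SymRel α (.single (a • ν, c) 1 - .single (ν, c) a)
  | perm (σ : Equiv.Perm (Fin (l + 1))) (ν : N) (c : Fin (l + 1) → BTree D.E) :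
      D.SymRel α (.single (α σ ν, c ∘ σ.symm) 1 - .single (ν, c) 1)
  | tree (ν : N) (c : Fin (l + 1) → BTree D.E) (i : Fin (l + 1)) (y : BTree D.E →₀ k)
      (hy : D.Rel y) : D.SymRel α (y.mapDomain fun t => (ν, Function.update c i t))

/-- The piece at `A` of the free right `⟨E; R⟩`-module `N ∘ ⟨E; R⟩`, `N` in arity `l + 1`. -/
abbrev QuadData.Composite (α : Equiv.Perm (Fin (l + 1)) → N → N) (A : Finset ℕ) :
    Type (max u v) :=
  ({z : D.Sym l N // BTree.FamilyLinear A z.2} →₀ k) ⧸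
    (Submodule.span k {x | D.SymRel α x}).comap (Finsupp.lmapDomain k k Subtype.val)

variable {P : Operad.{u, v} k} (M : RightModule P)

/-- The action of the symmetric group on `(sM)^*(l + 1) = M(l + 1)^* ⊗ sgn` (which is placed in
degree `l`). -/
def RightModule.susDualAct (l : ℕ) (σ : Equiv.Perm (Fin (l + 1)))
    (ν : Module.Dual k (M.obj (Fin (l + 1)))) : Module.Dual k (M.obj (Fin (l + 1))) :=
  (Equiv.Perm.sign σ : ℤ) • (ν ∘ₗ M.map σ.symm)

/-- Formal symbols `ν(t₀, …, t_l)` with `ν ∈ (sM)^*(l + 1)` and `tᵢ` trees decorated by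
`E^∨ = P^!(2)`. -/
abbrev RightModule.DualSym (l : ℕ) : Type (max u v) :=
  P.dualData.Sym l (Module.Dual k (M.obj (Fin (l + 1))))

/-- `((sM)^*(l + 1) ∘ P^!)(A)`. -/
abbrev RightModule.SusDualComp (l : ℕ) (A : Finset ℕ) : Type (max u v) :=
  P.dualData.Composite (M.susDualAct l) A

/-- The class of `ν(t₀, …, t_l)` in `((sM)^*(l + 1) ∘ P^!)(A)`. -/
def RightModule.susDualMk (l : ℕ) (A : Finset ℕ) (z : {z : M.DualSym l // BTree.FamilyLinear A z.2}) :
    M.SusDualComp l A :=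
  Submodule.Quotient.mk (Finsupp.single z 1)

end Composite

/-! ## The cobar constructions

Let `P` and `M` be of finite type.  The space `F(↓(sP)^*)(A)` is the direct sum, over the trees `T`
with leaves labelled by `A` and all vertices at least binary, of the tensor products of the
spaces `↓(sP)^*(k_v) = P(k_v)^* ⊗ sgn`, in degree `k_v - 2`, over the vertices `v` of `T`.  A tensor
product of duals of finite dimensional spaces is the space of multilinear functions.  So an
element of `F(↓(sP)^*)(A)` is the same as a function on planar trees decorated by elements of
`P`, which is multilinear in the decorations and equivariant (with the Koszul sign, and the
signature coming from the factors `sgn`) with respect to permutations of the inputs of the vertices.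
The cooperad structure of `(sP)^*` being the transpose of the operad structure of `sP`, the cobar
differential is the transpose of the signed sum of all contractions of one edge. The
same applies to `(sM)^* ∘ F(↓(sP)^*)`, with one additional root vertex decorated by
an element of `M(l + 1)`, dual to `(sM)^*(l + 1)` in degree `l`, `l ≥ 0`. -/

section Trees

variable (P : Operad.{u, v} k)

/-- Planar trees with labelled leaves; a vertex with `n + 2` inputs is decorated by an element
of `P(n + 2)`. -/
inductive PTree (P : Operad.{u, v} k) : Type v
  | leaf (x : ℕ) : PTree P
  | node (n : ℕ) (p : P.obj (Fin (n + 2))) (c : Fin (n + 2) → PTree P) : PTree P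

variable {P}

namespace PTree

/-- The set of leaves. -/
def Leaf : PTree P → Type
  | leaf _ => Unit
  | node _ _ c => Σ i, (c i).Leaf

/-- The label of a leaf. -/
def label : (t : PTree P) → t.Leaf → ℕ
  | leaf x => fun _ => x
  | node _ _ c => fun x => (c x.1).label x.2

/-- The degree: the sum of `k_v - 2` over all vertices `v`, `k_v` being the number of inputs. -/
def deg : PTree P → ℕ
  | leaf _ => 0
  | node n _ c => n + ∑ i, (c i).deg

/-- The leaves are labelled bijectively by `A`. -/
def Linear (A : Finset ℕ) (t : PTree P) : Prop :=
  Function.Injective t.label ∧ Set.range t.label = (A : Set ℕ)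

/-- Replace the `i`-th child by the family of trees `d`, in the planar order. -/
def splice {a b : ℕ} (c : Fin (a + 1) → PTree P) (i : Fin (a + 1)) (d : Fin b → PTree P) :
    Fin (a + b) → PTree P :=
  fun s => Sum.elim (fun j => c j.1) d ((planarEquiv a b i).symm s)

/-- The total degree of the children to the left of the `i`-th one. -/
def leftDeg {a : ℕ} (c : Fin a → PTree P) (i : Fin a) : ℕ :=
  ∑ j ∈ Finset.univ.filter (· < i), (c j).deg

/-- Contraction of the edge from the root vertex `p` with `n + 2` inputs to its
`i`-th child, if this child is a vertex.  For a child `p'` with `q + 2` inputs, the sign is the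
product of `(-1)^{(n+1-i)(q+1)}` from the composition in `sP` (`n + 1 - i` inputs lie to the right
of `i`), `(-1)^n` from the desuspension `↓`, and the Koszul sign for moving the
generator of degree `q` across the children to the left of the `i`-th one. -/
def contract (n : ℕ) (p : P.obj (Fin (n + 2))) (c : Fin (n + 2) → PTree P) (i : Fin (n + 2)) :
    PTree P → (PTree P →₀ k)
  | leaf _ => 0
  | node q p' d =>
    Finsupp.single (node (n + 1 + q) (P.pcirc (a := n + 1) (b := q + 2) i p p')
        (splice (a := n + 1) (b := q + 2) c i d))
      ((-1) ^ (n + (n + 1 - i.1) * (q + 1) + q * leftDeg c i))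

/-- The signed sum of all contractions of one internal edge. -/
def delta : PTree P → (PTree P →₀ k)
  | leaf _ => 0
  | node n p c => ∑ i, (contract n p c i (c i) +
      (-1 : k) ^ (n + leftDeg c i) •
        (delta (c i)).mapDomain fun t => node n p (Function.update c i t))

/-- Multilinearity and equivariance relations among decorated trees. -/
inductive Rel : (PTree P →₀ k) → Prop
  | add (n : ℕ) (p p' : P.obj (Fin (n + 2))) (c : Fin (n + 2) → PTree P) :
      Rel (.single (node n (p + p') c) 1 - .single (node n p c) 1 - .single (node n p' c) 1)
  | smul (n : ℕ) (a : k) (p : P.obj (Fin (n + 2))) (c : Fin (n + 2) → PTree P) :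
      Rel (.single (node n (a • p) c) 1 - .single (node n p c) a)
  | perm (n : ℕ) (σ : Equiv.Perm (Fin (n + 2))) (p : P.obj (Fin (n + 2)))
      (c : Fin (n + 2) → PTree P) :
      Rel (.single (node n (P.map σ p) (c ∘ σ.symm)) 1 -
        .single (node n p c) ((permSign σ fun i => (c i).deg : ℤ) : k))
  | child (n : ℕ) (p : P.obj (Fin (n + 2))) (c : Fin (n + 2) → PTree P) (i : Fin (n + 2))
      (x : PTree P →₀ k) (hx : Rel x) :
      Rel (x.mapDomain fun t => node n p (Function.update c i t))

end PTree

variable (P)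

/-- `Ω((sP)^*)(A)` in degree `d`. -/
def Operad.cobar (A : Finset ℕ) (d : ℤ) : Submodule k (Module.Dual k (PTree P →₀ k)) where
  carrier := {f | (∀ x, PTree.Rel x → f x = 0) ∧
    ∀ t : PTree P, ¬ (t.Linear A ∧ (t.deg : ℤ) = d) → f (Finsupp.single t 1) = 0}
  add_mem' := fun hf hg => ⟨fun x hx => by simp [hf.1 x hx, hg.1 x hx],
    fun t ht => by simp [hf.2 t ht, hg.2 t ht]⟩
  zero_mem' := by simp
  smul_mem' := fun a f hf => ⟨fun x hx => by simp [hf.1 x hx], fun t ht => by simp [hf.2 t ht]⟩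

/-- The cobar differential of `Ω((sP)^*)`. -/
def Operad.cobarD : Module.Dual k (PTree P →₀ k) →ₗ[k] Module.Dual k (PTree P →₀ k) :=
  (Finsupp.linearCombination k PTree.delta).dualMap

variable {P}

/-- Evaluation of a tree decorated by `E^∨ = P(2)^* ⊗ sgn`, regarded as an element of
`F(↓(sP)^*)`, on a tree decorated by `P`. -/
def btreePair : BTree (Module.Dual k (P.obj (Fin 2))) → PTree P → k
  | .leaf x, .leaf y => if x = y then 1 else 0
  | .node φ l r, .node 0 p c =>
    φ p * btreePair l (c 0) * btreePair r (c 1) -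
      φ (P.map (Equiv.swap 0 1) p) * btreePair l (c 1) * btreePair r (c 0)
  | _, _ => 0

/-- The element of `F(↓(sP)^*)` given by a tree decorated by `E^∨ = ↓(sP)^*(2)`. -/
def btreeElt (t : BTree (Module.Dual k (P.obj (Fin 2)))) : Module.Dual k (PTree P →₀ k) :=
  Finsupp.linearCombination k (btreePair t)

end Trees

section Rakes

variable {P : Operad.{u, v} k} (M : RightModule P)

/-- A family of trees grafted to a root decorated by an element of `M(l + 1)`. -/
abbrev RightModule.Rake : Type v :=
  Σ l : ℕ, M.obj (Fin (l + 1)) × (Fin (l + 1) → PTree P)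

variable {M}

namespace RightModule.Rake

/-- All leaves together are labelled bijectively by `A`. -/
def Linear (A : Finset ℕ) (t : M.Rake) : Prop :=
  Function.Injective (fun x : (Σ i, (t.2.2 i).Leaf) => (t.2.2 x.1).label x.2) ∧
    Set.range (fun x : (Σ i, (t.2.2 i).Leaf) => (t.2.2 x.1).label x.2) = (A : Set ℕ)

/-- The degree; the root with `l + 1` inputs has degree `l`. -/
def deg (t : M.Rake) : ℕ := t.1 + ∑ i, (t.2.2 i).deg

/-- Contraction of the edge from the root to its `i`-th child. -/
def contract (l : ℕ) (m : M.obj (Fin (l + 1))) (c : Fin (l + 1) → PTree P) (i : Fin (l + 1)) :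
    PTree P → (M.Rake →₀ k)
  | .leaf _ => 0
  | .node q p d =>
    Finsupp.single (⟨l + q + 1, M.pact (a := l) (b := q + 2) i m p,
        PTree.splice (a := l) (b := q + 2) c i d⟩ : M.Rake)
      ((-1) ^ (l + (l - i.1) * (q + 1) + q * PTree.leftDeg c i))

/-- The signed sum of all contractions of one edge. -/
def delta (t : M.Rake) : M.Rake →₀ k :=
  ∑ i, (contract t.1 t.2.1 t.2.2 i (t.2.2 i) +
    (-1 : k) ^ (t.1 + PTree.leftDeg t.2.2 i) •
      (PTree.delta (t.2.2 i)).mapDomain fun s =>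
        (⟨t.1, t.2.1, Function.update t.2.2 i s⟩ : M.Rake))

/-- Multilinearity and equivariance relations. -/
inductive Rel : (M.Rake →₀ k) → Prop
  | add (l : ℕ) (m m' : M.obj (Fin (l + 1))) (c : Fin (l + 1) → PTree P) :
      Rel (.single ⟨l, m + m', c⟩ 1 - .single ⟨l, m, c⟩ 1 - .single ⟨l, m', c⟩ 1)
  | smul (l : ℕ) (a : k) (m : M.obj (Fin (l + 1))) (c : Fin (l + 1) → PTree P) :
      Rel (.single ⟨l, a • m, c⟩ 1 - .single ⟨l, m, c⟩ a)
  | perm (l : ℕ) (σ : Equiv.Perm (Fin (l + 1))) (m : M.obj (Fin (l + 1)))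
      (c : Fin (l + 1) → PTree P) :
      Rel (.single ⟨l, M.map σ m, c ∘ σ.symm⟩ 1 -
        .single ⟨l, m, c⟩ ((permSign σ fun i => (c i).deg : ℤ) : k))
  | child (l : ℕ) (m : M.obj (Fin (l + 1))) (c : Fin (l + 1) → PTree P) (i : Fin (l + 1))
      (x : PTree P →₀ k) (hx : PTree.Rel x) :
      Rel (x.mapDomain fun s => ⟨l, m, Function.update c i s⟩)

end RightModule.Rake

end Rakes

/-! ## Spectral sequence of a filtered complex -/

/-- Graded pieces `C d`, filtration `F p` and differential `D` of a would-be filtered chain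
complex, inside an ambient vector space `W`. -/
structure FilteredData (k : Type u) [Field k] (W : Type v) [AddCommGroup W] [Module k W] where
  C : ℤ → Submodule k W
  F : ℤ → Submodule k W
  D : W →ₗ[k] W

namespace FilteredData

variable {W : Type v} [AddCommGroup W] [Module k W] (X : FilteredData k W)

/-- `(C, D)` is a chain complex (with `D` of degree `-1`) and the `F p` form an increasing
filtration of it by subcomplexes. -/
structure IsFilteredComplex : Prop where
  D_mem : ∀ d, ∀ x ∈ X.C d, X.D x ∈ X.C (d - 1)
  D_D : ∀ d, ∀ x ∈ X.C d, X.D (X.D x) = 0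
  mono : Monotone X.F
  D_filt : ∀ d p, ∀ x ∈ X.C d, x ∈ X.F p → X.D x ∈ X.F p

/-- `Z^r_{pq} = {x ∈ F_p C_{p+q} : D x ∈ F_{p-r}}`. -/
def Z (r p q : ℤ) : Submodule k W := X.C (p + q) ⊓ X.F p ⊓ (X.F (p - r)).comap X.D

/-- `Z^{r-1}_{p-1,q+1} + D Z^{r-1}_{p+r-1,q-r+2}`. -/
def B (r p q : ℤ) : Submodule k W :=
  X.Z (r - 1) (p - 1) (q + 1) ⊔ (X.Z (r - 1) (p + r - 1) (q - r + 2)).map X.D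

/-- The term `E^r_{pq}`, `r ≥ 1`, of the spectral sequence of the filtered complex. -/
abbrev E (r p q : ℤ) : Type v := X.Z r p q ⧸ (X.B r p q).comap (X.Z r p q).subtype

/-- The class in `E^r_{pq}` of an element of `Z^r_{pq}`. -/
def cls (r p q : ℤ) (x : W) (hx : x ∈ X.Z r p q) : X.E r p q :=
  Submodule.Quotient.mk ⟨x, hx⟩

variable {X}

theorem IsFilteredComplex.D_mem_Z (h : X.IsFilteredComplex) {r p q p' q' : ℤ} (hp : p' = p - r)
    (hq : q' = q + r - 1) {x : W} (hx : x ∈ X.Z r p q) : X.D x ∈ X.Z r p' q' := by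
  obtain ⟨⟨h1, h2⟩, h3⟩ := hx
  refine ⟨⟨?_, ?_⟩, ?_⟩
  · have := h.D_mem _ _ h1
    rwa [show p' + q' = p + q - 1 by omega]
  · rw [hp]; exact h3
  · show X.D (X.D x) ∈ X.F (p' - r)
    rw [h.D_D _ _ h1]
    exact zero_mem _

theorem IsFilteredComplex.D_mem_B (h : X.IsFilteredComplex) {r p q p' q' : ℤ} (hp : p' = p - r)
    (hq : q' = q + r - 1) {x : W} (hx : x ∈ X.B r p q) : X.D x ∈ X.B r p' q' := by
  obtain ⟨y, hy, z, ⟨w, hw, rfl⟩, rfl⟩ := Submodule.mem_sup.1 hx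
  rw [map_add, h.D_D _ _ hw.1.1, add_zero]
  refine Submodule.mem_sup_right ⟨y, ?_, rfl⟩
  rwa [show p' + r - 1 = p - 1 by omega, show q' - r + 2 = q + 1 by omega]

/-- The differential `d^r : E^r_{pq} → E^r_{p-r,q+r-1}`, induced by `D`. -/
def IsFilteredComplex.d (h : X.IsFilteredComplex) {r p q p' q' : ℤ} (hp : p' = p - r)
    (hq : q' = q + r - 1) : X.E r p q →ₗ[k] X.E r p' q' :=
  Submodule.mapQ _ _ (X.D.restrict fun _ hx => h.D_mem_Z hp hq hx)
    fun _ hx => h.D_mem_B hp hq hx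

end FilteredData

/-- Let `(C, D)` be a chain complex in nonnegative degrees, and let elements `elt i` of `C 0` and
`cls i` of `V` be given.  This says that the map `π : C → V` with `π (elt i) = cls i`, zero in
positive degrees, is a well defined map to `V` (placed in degree `0`, with zero differential)
which induces an isomorphism in homology. -/
def IsHomologyIso {W : Type*} [AddCommGroup W] [Module k W] (C : ℤ → Submodule k W)
    (D : W →ₗ[k] W) {V : Type*} [AddCommGroup V] [Module k V] {ι : Type*} (elt : ι → W)
    (cls : ι → V) : Prop :=
  (∃ π : C 0 →ₗ[k] V,
    (∀ i, ∃ hi : elt i ∈ C 0, π ⟨elt i, hi⟩ = cls i) ∧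
    Function.Surjective π ∧
    ∀ x : C 0, π x = 0 ↔ ∃ y ∈ C 1, D y = x) ∧
  ∀ d : ℤ, 0 < d → ∀ x ∈ C d, D x = 0 → ∃ y ∈ C (d + 1), D y = x

/-- The operad `P` (assumed quadratic and of finite type) is Koszul: for all finite label sets
`A ≠ ∅` the canonical map `π : Ω((sP)^*)(A) → P^!(A)`, which is the identity of
`↓(sP)^*(2) = E^∨ = P^!(2)` on generators of arity `2` and zero on generators of higher arity, is a
homology isomorphism. -/
def Operad.IsKoszul (P : Operad.{u, v} k) : Prop :=
  ∀ A : Finset ℕ, A.Nonempty →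
    IsHomologyIso (P.cobar A) P.cobarD
      (fun t : {t : BTree P.dualData.E // t.Linear A} => btreeElt t.1)
      (fun t => (Submodule.Quotient.mk (Finsupp.single t 1) : P.dualData.Piece A))

section ModuleCobar

variable {P : Operad.{u, v} k} (M : RightModule P)

/-- `Ω((sM)^*, (sP)^*)(A)` in degree `d`. -/
def RightModule.cobarC (A : Finset ℕ) (d : ℤ) : Submodule k (Module.Dual k (M.Rake →₀ k)) where
  carrier := {f | (∀ x, RightModule.Rake.Rel x → f x = 0) ∧
    ∀ t : M.Rake, ¬ (t.Linear A ∧ (t.deg : ℤ) = d) → f (Finsupp.single t 1) = 0}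
  add_mem' := fun hf hg => ⟨fun x hx => by simp [hf.1 x hx, hg.1 x hx],
    fun t ht => by simp [hf.2 t ht, hg.2 t ht]⟩
  zero_mem' := by simp
  smul_mem' := fun a f hf => ⟨fun x hx => by simp [hf.1 x hx], fun t ht => by simp [hf.2 t ht]⟩

/-- Functions supported on trees whose root has at most `p + 1` inputs. -/
def RightModule.cobarF (p : ℤ) : Submodule k (Module.Dual k (M.Rake →₀ k)) where
  carrier := {f | ∀ t : M.Rake, p < (t.1 : ℤ) → f (Finsupp.single t 1) = 0}
  add_mem' := fun hf hg t ht => by simp [hf t ht, hg t ht]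
  zero_mem' := by simp
  smul_mem' := fun a f hf t ht => by simp [hf t ht]

/-- The cobar construction `Ω((sM)^*, (sP)^*)(A)` with its differential and the
filtration `F_p = (sM)^*_{≤ p+1} ∘ F(↓(sP)^*)`. -/
def RightModule.cobar (A : Finset ℕ) : FilteredData k (Module.Dual k (M.Rake →₀ k)) where
  C := M.cobarC A
  F := M.cobarF
  D := (Finsupp.linearCombination k RightModule.Rake.delta).dualMap

/-- Evaluation of the symbol `ν(t₀, …, t_l)`, `ν ∈ (sM)^*(l + 1)`, regarded as an element of
`(sM)^* ∘ F(↓(sP)^*)`, on a family of trees grafted to a root. -/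
def RightModule.symPair {l : ℕ} (z : M.DualSym l) : M.Rake → k
  | ⟨l', x⟩ =>
    if h : l' = l then
      ∑ σ : Equiv.Perm (Fin (l + 1)), ((Equiv.Perm.sign σ : ℤ) : k) *
        z.1 (M.map σ (h ▸ x : M.obj (Fin (l + 1)) × (Fin (l + 1) → PTree P)).1) *
          ∏ i, btreePair (z.2 (σ i))
            ((h ▸ x : M.obj (Fin (l + 1)) × (Fin (l + 1) → PTree P)).2 i)
    else 0

/-- The element of `(sM)^* ∘ F(↓(sP)^*)` given by the symbol `ν(t₀, …, t_l)`. -/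
def RightModule.symElt {l : ℕ} (z : M.DualSym l) : Module.Dual k (M.Rake →₀ k) :=
  Finsupp.linearCombination k (M.symPair z)

/-- The module `M` (assumed quadratic, over a quadratic operad `P`, both of finite type) is
Koszul: for all finite label sets `A ≠ ∅` the canonical map
`π : Ω((sM)^*, (sP)^*)(A) → M^!(A)`, which is the identity of `(sM)^*(1) = X^* = M^!(1)` and zero on
`(sM)^*(l)`, `l ≥ 2`, and extends `Ω((sP)^*) → P^!`, is a homology isomorphism. -/
def RightModule.IsKoszul : Prop :=
  ∀ A : Finset ℕ, A.Nonempty →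
    IsHomologyIso (M.cobar A).C (M.cobar A).D
      (fun z : {z : Module.Dual k (M.obj (Fin 1)) × BTree P.dualData.E // z.2.Linear A} =>
        M.symElt (l := 0) (z.1.1, fun _ => z.1.2))
      (fun z => (Submodule.Quotient.mk (Finsupp.single z 1) : M.DualPiece A))

end ModuleCobar

end KoszulModules

end

open scoped BigOperators

noncomputable section

namespace KoszulModules

variable {k : Type u} [Field k]

/-! ## Koszul signs of renumberings -/

theorem neg_one_pow_congr_zmod {R : Type*} [Ring R] {a b : ℕ} (h : (a : ZMod 2) = b) :
    (-1 : R) ^ a = (-1) ^ b := by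
  rw [ZMod.natCast_eq_natCast_iff] at h
  rw [neg_one_pow_eq_pow_mod_two, h, ← neg_one_pow_eq_pow_mod_two]

/-- The sign for passing from the order `e` to the order `e'` of objects of degrees `d`, the
Koszul sign being multiplied by the signature. -/
def orderSign {I : Type} [Fintype I] (e e' d : I → ℕ) : ℤ :=
  ∏ x, ∏ y, if e x < e y ∧ e' y < e' x then (-1) ^ (1 + d x * d y) else 1

theorem permSign_eq_orderSign {n : ℕ} (σ : Equiv.Perm (Fin n)) (d : Fin n → ℕ) :
    permSign σ d = orderSign (fun i : Fin n => (i : ℕ)) (fun i : Fin n => (σ i : ℕ)) d := rfl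

theorem orderSign_comp_equiv {I J : Type} [Fintype I] [Fintype J] (f : I ≃ J) (e e' d : J → ℕ) :
    orderSign (e ∘ f) (e' ∘ f) (d ∘ f) = orderSign e e' d := by
  unfold orderSign
  rw [← Equiv.prod_comp f]
  refine Finset.prod_congr rfl fun x _ => ?_
  rw [← Equiv.prod_comp f]
  rfl

theorem permSign_symm_trans {I : Type} [Fintype I] {n : ℕ} (e e' : I ≃ Fin n) (d : I → ℕ) :
    permSign (e.symm.trans e') (d ∘ e.symm) =
      orderSign (fun x => (e x : ℕ)) (fun x => (e' x : ℕ)) d := by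
  rw [permSign_eq_orderSign, ← orderSign_comp_equiv e]
  congr 1 <;> ext x <;> simp

theorem orderSign_self {I : Type} [Fintype I] (e d : I → ℕ) : orderSign e e d = 1 :=
  Finset.prod_eq_one fun x _ => Finset.prod_eq_one fun y _ => if_neg fun h => by omega

/-- The sign when a block `J` of objects is moved as a whole across the objects `A`. -/
theorem orderSign_block {A J : Type} [Fintype A] [Fintype J] (e e' d : A → ℕ) (f f' D : J → ℕ)
    (p p' : A → Prop) [DecidablePred p] [DecidablePred p']
    (h : ∀ a s, e a < f s ↔ p a) (h₁ : ∀ a s, f s < e a ↔ ¬ p a)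
    (h' : ∀ a s, e' a < f' s ↔ p' a) (h₁' : ∀ a s, f' s < e' a ↔ ¬ p' a) :
    orderSign (Sum.elim e f) (Sum.elim e' f') (Sum.elim d D) =
      orderSign e e' d * orderSign f f' D *
        (-1) ^ (Fintype.card J * ((∑ a, if p a then 1 else 0) + ∑ a, if p' a then 1 else 0) +
          (∑ s, D s) * ((∑ a, if p a then d a else 0) + ∑ a, if p' a then d a else 0)) := by
  have key : ∀ a s, (if e a < f s ∧ f' s < e' a then (-1 : ℤ) ^ (1 + d a * D s) else 1) *
      (if f s < e a ∧ e' a < f' s then (-1 : ℤ) ^ (1 + D s * d a) else 1) =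
      (-1) ^ (((if p a then 1 else 0) + (if p' a then 1 else 0)) +
        D s * ((if p a then d a else 0) + (if p' a then d a else 0))) := by
    intro a s
    by_cases ha : p a <;> by_cases ha' : p' a <;> simp only [h, h₁, h', h₁', ha, ha'] <;>
      simp [mul_comm (d a), ← two_mul, pow_add, pow_mul, mul_left_comm (D s) 2]
  have cross : (∏ a, ∏ s, if e a < f s ∧ f' s < e' a then (-1 : ℤ) ^ (1 + d a * D s) else 1) *
      (∏ s, ∏ a, if f s < e a ∧ e' a < f' s then (-1 : ℤ) ^ (1 + D s * d a) else 1) =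
      (-1) ^ (Fintype.card J * ((∑ a, if p a then 1 else 0) + ∑ a, if p' a then 1 else 0) +
          (∑ s, D s) * ((∑ a, if p a then d a else 0) + ∑ a, if p' a then d a else 0)) := by
    rw [Finset.prod_comm, ← Finset.prod_mul_distrib]
    simp_rw [← Finset.prod_mul_distrib, key, Finset.prod_pow_eq_pow_sum, Finset.sum_add_distrib,
      ← Finset.mul_sum, Finset.sum_add_distrib, ← Finset.sum_mul]
    simp [Finset.card_univ, mul_add]
  rw [← cross]
  unfold orderSign
  simp only [Fintype.prod_sum_type, Sum.elim_inl, Sum.elim_inr, Finset.prod_mul_distrib]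
  ring_nf

/-- The total degree of the objects before `x` in the order `e`. -/
def degBefore {I : Type} [Fintype I] (e d : I → ℕ) (x : I) : ℕ :=
  ∑ y, if e y < e x then d y else 0

theorem degBefore_eq_sum_ne {I : Type} [Fintype I] [DecidableEq I] (e d : I → ℕ) (x : I) :
    degBefore e d x = ∑ y : {y // y ≠ x}, if e y < e x then d y else 0 := by
  unfold degBefore
  rw [← Equiv.sum_comp (unitEquiv x), Fintype.sum_sum_type]
  simp [unitEquiv]

theorem degBefore_one {I : Type} [Fintype I] {n : ℕ} (e : I ≃ Fin n) (x : I) :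
    degBefore (fun y => (e y : ℕ)) (fun _ => 1) x = e x := by
  unfold degBefore
  rw [← Equiv.sum_comp e.symm]
  simp only [Equiv.apply_symm_apply, Fin.val_fin_lt, Finset.sum_boole]
  have : (Finset.univ.filter fun i => i < e x) = Finset.Iio (e x) := by ext; simp
  rw [this]; simp

theorem degBefore_update {I : Type} [Fintype I] [DecidableEq I] (e d : I → ℕ) (x y : I) (a : ℕ) :
    degBefore e (Function.update d y a) x + (if e y < e x then d y else 0) =
      degBefore e d x + (if e y < e x then a else 0) := by
  unfold degBefore
  rw [← Finset.add_sum_erase _ _ (Finset.mem_univ y), ← Finset.add_sum_erase Finset.univ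
    (fun z => if e z < e x then d z else 0) (Finset.mem_univ y)]
  have : ∑ z ∈ Finset.univ.erase y, (if e z < e x then Function.update d y a z else 0) =
      ∑ z ∈ Finset.univ.erase y, (if e z < e x then d z else 0) :=
    Finset.sum_congr rfl fun z hz => by rw [Function.update_of_ne (Finset.ne_of_mem_erase hz)]
  rw [this, Function.update_self]
  ring

/-- Splitting off the object `x`. -/
theorem orderSign_split {I : Type} [Fintype I] [DecidableEq I] {n : ℕ} (e e' : I ≃ Fin n)
    (d : I → ℕ) (x : I) :
    orderSign (fun y => (e y : ℕ)) (fun y => (e' y : ℕ)) d =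
      orderSign (fun y : {y // y ≠ x} => (e y : ℕ)) (fun y => (e' y : ℕ)) (fun y => d y) *
        (-1) ^ ((e x + e' x : ℕ) + d x * (degBefore (fun y => (e y : ℕ)) d x +
          degBefore (fun y => (e' y : ℕ)) d x)) := by
  have h0 : ∀ e : I ≃ Fin n, ∀ a : {y // y ≠ x}, (e a : ℕ) ≠ e x := fun e a h =>
    a.2 (e.injective (Fin.ext h))
  have := orderSign_block (fun y : {y // y ≠ x} => (e y : ℕ)) (fun y => (e' y : ℕ))
    (fun y => d y) (fun _ : Unit => (e x : ℕ)) (fun _ => (e' x : ℕ)) (fun _ => d x)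
    (fun a => (e a : ℕ) < e x) (fun a => (e' a : ℕ) < e' x) (fun _ _ => Iff.rfl)
    (fun a _ => by have := h0 e a; omega) (fun _ _ => Iff.rfl)
    (fun a _ => by have := h0 e' a; omega)
  rw [← orderSign_comp_equiv (unitEquiv x), degBefore_eq_sum_ne, degBefore_eq_sum_ne]
  have h1 := degBefore_one e x
  have h2 := degBefore_one e' x
  rw [degBefore_eq_sum_ne] at h1 h2
  rw [h1, h2] at this
  simp only [Fintype.card_unit, one_mul, Finset.univ_unique, Finset.sum_singleton] at this
  have h3 : orderSign (fun _ : Unit => (e x : ℕ)) (fun _ => (e' x : ℕ)) (fun _ => d x) = 1 := by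
    simp [orderSign]
  rw [h3, mul_one] at this
  rw [← this]
  congr 1 <;> ext (y | y) <;> rfl

/-- Renumbering before and after a change of parity of the degree of one object. -/
theorem orderSign_update {I : Type} [Fintype I] [DecidableEq I] {n : ℕ} (e e' : I ≃ Fin n)
    (d : I → ℕ) (x : I) (a : ℕ) (ha : Odd (a + d x)) :
    orderSign (fun y => (e y : ℕ)) (fun y => (e' y : ℕ)) (Function.update d x a) *
        (-1) ^ degBefore (fun y => (e' y : ℕ)) d x =
      orderSign (fun y => (e y : ℕ)) (fun y => (e' y : ℕ)) d *
        (-1) ^ degBefore (fun y => (e y : ℕ)) d x := by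
  have h : ∀ e : I ≃ Fin n, degBefore (fun y => (e y : ℕ)) (Function.update d x a) x =
      degBefore (fun y => (e y : ℕ)) d x := fun e => by
    have := degBefore_update (fun y => (e y : ℕ)) d x x a
    simpa using this
  rw [orderSign_split e e' _ x, orderSign_split e e' d x, h, h]
  have h2 : (fun y : {y // y ≠ x} => Function.update d x a y) = fun y : {y // y ≠ x} => d y :=
    funext fun y => Function.update_of_ne y.2 _ _
  rw [h2, mul_assoc, mul_assoc, ← pow_add, ← pow_add]
  congr 1
  apply neg_one_pow_congr_zmod
  have ha' : (a : ZMod 2) + d x = 1 := by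
    have := (ZMod.natCast_eq_one_iff_odd (n := a + d x)).2 ha
    exact_mod_cast this
  rw [Function.update_self]
  push_cast
  generalize (a : ZMod 2) = a, (d x : ZMod 2) = b, (((e x : ℕ)) : ZMod 2) = c,
    (((e' x : ℕ)) : ZMod 2) = c',
    ((degBefore (fun y => (e y : ℕ)) d x : ℕ) : ZMod 2) = g,
    ((degBefore (fun y => (e' y : ℕ)) d x : ℕ) : ZMod 2) = g' at *
  decide +revert

/-- The numbering of the inputs of a composite: something with inputs `J`, numbered by `τ`, is
plugged into the input `x` of something with inputs `I`, numbered by `e`. -/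
def plugNumbering {I J : Type} {l q : ℕ} (e : I ≃ Fin (l + 1)) (x : I) (τ : J ≃ Fin (q + 2)) :
    {y : I // y ≠ x} ⊕ J ≃ Fin (l + q + 1 + 1) :=
  (Equiv.sumCongr (neEquiv e x) τ).trans (planarEquiv l (q + 2) (e x))

theorem plugNumbering_inr {I J : Type} {l q : ℕ} (e : I ≃ Fin (l + 1)) (x : I) (τ : J ≃ Fin (q + 2))
    (s : J) : (plugNumbering e x τ (.inr s) : ℕ) = e x + τ s := rfl

theorem plugNumbering_inl {I J : Type} {l q : ℕ} (e : I ≃ Fin (l + 1)) (x : I) (τ : J ≃ Fin (q + 2))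
    (y : {y : I // y ≠ x}) : (plugNumbering e x τ (.inl y) : ℕ) =
      if (e y : ℕ) < e x then (e y : ℕ) else e y - 1 + (q + 2) := by
  simp only [plugNumbering, planarEquiv, neEquiv, Equiv.trans_apply, Equiv.sumCongr_apply,
    Sum.map_inl, Equiv.coe_fn_mk, Equiv.subtypeEquiv_apply]
  split_ifs <;> rfl

theorem numbering_ne {I : Type} {n : ℕ} (e : I ≃ Fin n) {x y : I} (h : y ≠ x) :
    (e y : ℕ) ≠ e x := fun h' => h (e.injective (Fin.ext h'))

theorem orderSign_plugNumbering {I J : Type} [Fintype I] [DecidableEq I] [Fintype J] {l q : ℕ}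
    (e e' : I ≃ Fin (l + 1)) (x : I) (τ τ' : J ≃ Fin (q + 2)) (d : I → ℕ) (D : J → ℕ)
    (hd : d x = q + ∑ s, D s) :
    orderSign (fun y => (plugNumbering e x τ y : ℕ)) (fun y => (plugNumbering e' x τ' y : ℕ))
        (Sum.elim (fun y => d y) D) *
        (-1) ^ ((l - e' x) * (q + 1) + q * degBefore (fun y => (e' y : ℕ)) d x) =
      orderSign (fun y => (e y : ℕ)) (fun y => (e' y : ℕ)) d *
        orderSign (fun y => (τ y : ℕ)) (fun y => (τ' y : ℕ)) D *
        (-1) ^ ((l - e x) * (q + 1) + q * degBefore (fun y => (e y : ℕ)) d x) := by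
  have hlt : ∀ (e : I ≃ Fin (l + 1)) (τ : J ≃ Fin (q + 2)) (a : {y // y ≠ x}) (s : J),
      (plugNumbering e x τ (.inl a) : ℕ) < plugNumbering e x τ (.inr s) ↔ (e a : ℕ) < e x := by
    intro e τ a s
    have := numbering_ne e a.2
    have := (τ s).2
    rw [plugNumbering_inl, plugNumbering_inr]
    split_ifs <;> omega
  have hgt : ∀ (e : I ≃ Fin (l + 1)) (τ : J ≃ Fin (q + 2)) (a : {y // y ≠ x}) (s : J),
      (plugNumbering e x τ (.inr s) : ℕ) < plugNumbering e x τ (.inl a) ↔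
        ¬ (e a : ℕ) < e x := by
    intro e τ a s
    have := numbering_ne e a.2
    have := (τ s).2
    rw [plugNumbering_inl, plugNumbering_inr]
    split_ifs <;> omega
  have hb := orderSign_block (fun y => (plugNumbering e x τ (.inl y) : ℕ))
    (fun y => (plugNumbering e' x τ' (.inl y) : ℕ)) (fun y => d y)
    (fun y => (plugNumbering e x τ (.inr y) : ℕ)) (fun y => (plugNumbering e' x τ' (.inr y) : ℕ))
    D _ _ (hlt e τ) (hgt e τ) (hlt e' τ') (hgt e' τ')
  have hA : orderSign (fun y : {y // y ≠ x} => (plugNumbering e x τ (.inl y) : ℕ))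
      (fun y => (plugNumbering e' x τ' (.inl y) : ℕ)) (fun y => d y) =
      orderSign (fun y : {y // y ≠ x} => (e y : ℕ)) (fun y => (e' y : ℕ)) (fun y => d y) := by
    have h : ∀ (e : I ≃ Fin (l + 1)) (τ : J ≃ Fin (q + 2)) (a b : {y // y ≠ x}),
        (plugNumbering e x τ (.inl a) : ℕ) < plugNumbering e x τ (.inl b) ↔ (e a : ℕ) < e b := by
      intro e τ a b
      have := numbering_ne e a.2
      have := numbering_ne e b.2
      rw [plugNumbering_inl, plugNumbering_inl]
      split_ifs <;> omega
    unfold orderSign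
    simp only [h]
  have hJ : orderSign (fun y => (plugNumbering e x τ (.inr y) : ℕ))
      (fun y => (plugNumbering e' x τ' (.inr y) : ℕ)) D =
      orderSign (fun y => (τ y : ℕ)) (fun y => (τ' y : ℕ)) D := by
    unfold orderSign
    simp only [plugNumbering_inr, add_lt_add_iff_left]
  have h1 := degBefore_one e x
  have h2 := degBefore_one e' x
  rw [degBefore_eq_sum_ne] at h1 h2
  have hsplit : (fun y => (plugNumbering e x τ y : ℕ)) =
      Sum.elim (fun y => (plugNumbering e x τ (.inl y) : ℕ))
        (fun y => (plugNumbering e x τ (.inr y) : ℕ)) := by ext (y | y) <;> rfl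
  have hsplit' : (fun y => (plugNumbering e' x τ' y : ℕ)) =
      Sum.elim (fun y => (plugNumbering e' x τ' (.inl y) : ℕ))
        (fun y => (plugNumbering e' x τ' (.inr y) : ℕ)) := by ext (y | y) <;> rfl
  rw [hsplit, hsplit', hb, hA, hJ, orderSign_split e e' d x, h1, h2,
    ← degBefore_eq_sum_ne (fun y => (e y : ℕ)), ← degBefore_eq_sum_ne (fun y => (e' y : ℕ)), hd,
    Fintype.card_congr τ, Fintype.card_fin]
  have hr : ∀ e : I ≃ Fin (l + 1), ((l - e x : ℕ) : ZMod 2) = l + (e x : ℕ) := fun e => by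
    have := (e x).2
    rw [Nat.cast_sub (by omega), ZMod.neg_eq_self_mod_two _ |> fun h : -((e x : ℕ) : ZMod 2) = _ =>
      (sub_eq_add_neg _ _).trans (by rw [h])]
  have hs : ∀ A B : ℤ, ∀ m n m' n' : ℕ, ((m + n : ℕ) : ZMod 2) = ((m' + n' : ℕ) : ZMod 2) →
      A * B * (-1) ^ m * (-1) ^ n = A * (-1) ^ m' * B * (-1) ^ n' := by
    intro A B m n m' n' h
    have := neg_one_pow_congr_zmod (R := ℤ) h
    rw [pow_add, pow_add] at this
    linear_combination A * B * this
  apply hs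
  push_cast [hr]
  generalize (q : ZMod 2) = a, (l : ZMod 2) = b, (((e x : ℕ)) : ZMod 2) = c,
    (((e' x : ℕ)) : ZMod 2) = c', (∑ s, (D s : ZMod 2)) = i,
    ((degBefore (fun y => (e y : ℕ)) d x : ℕ) : ZMod 2) = g,
    ((degBefore (fun y => (e' y : ℕ)) d x : ℕ) : ZMod 2) = g'
  clear * -
  decide +revert

/-! ## Generalities on formal combinations -/

theorem linearMap_congr_support {α N : Type*} [AddCommGroup N] [Module k N]
    {f g : (α →₀ k) →ₗ[k] N} {z : α →₀ k}
    (h : ∀ s ∈ z.support, f (.single s 1) = g (.single s 1)) : f z = g z := by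
  conv_lhs => rw [← Finsupp.sum_single z]
  conv_rhs => rw [← Finsupp.sum_single z]
  rw [Finsupp.sum, map_sum, map_sum]
  refine Finset.sum_congr rfl fun s hs => ?_
  rw [← mul_one (z s), ← smul_eq_mul, ← Finsupp.smul_single, map_smul, map_smul, h s hs]

theorem sum_ne_comm {I N : Type*} [Fintype I] [DecidableEq I] [AddCommMonoid N]
    (F : I → I → N) : ∑ x, ∑ y : {y // y ≠ x}, F x y = ∑ x, ∑ y : {y // y ≠ x}, F y x := by
  have h : ∀ G : I → I → N, ∑ x, ∑ y : {y // y ≠ x}, G x y =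
      ∑ x, ∑ y, if y ≠ x then G x y else 0 := fun G => by
    refine Finset.sum_congr rfl fun x _ => ?_
    rw [← Finset.sum_filter]
    exact (Finset.sum_subtype _ (by simp) _).symm
  rw [h, h fun x y => F y x, Finset.sum_comm]
  simp only [ne_comm]

theorem sum_ne_eq_zero {I N : Type*} [Fintype I] [DecidableEq I] [AddCommGroup N]
    (F : I → I → N) (h : ∀ x y, y ≠ x → F x y = - F y x) :
    ∑ x, ∑ y : {y // y ≠ x}, F x y = 0 := by
  rw [Finset.sum_sigma']
  refine Finset.sum_involution (fun a _ => ⟨a.2, a.1, a.2.2.symm⟩) ?_ ?_ ?_ ?_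
  · rintro ⟨x, y, hy⟩ _
    simp [h x y hy]
  · rintro ⟨x, y, hy⟩ _ _ h'
    exact hy (congrArg Sigma.fst h')
  · simp
  · simp

theorem sum_eq_add_sum_ne {I N : Type*} [Fintype I] [DecidableEq I] [AddCommMonoid N]
    (F : I → N) (x : I) : ∑ y, F y = F x + ∑ y : {y // y ≠ x}, F y := by
  rw [← Finset.add_sum_erase _ _ (Finset.mem_univ x)]
  congr 1
  exact Finset.sum_subtype _ (by simp) _

/-! ## Labels and degrees -/

section Trees
variable {P : Operad.{u, v} k}

theorem RightModule.act_map_right (M : RightModule P) {I J J' : Type} [Finite I] [Finite J]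
    [Finite J'] (x : I) (τ : J ≃ J') (m : M.obj I) (p : P.obj J) : M.act x m (P.map τ p) =
      M.map (Equiv.sumCongr (Equiv.refl {y // y ≠ x}) τ) (M.act x m p) := by
  have h := M.act_map x (Equiv.refl I) τ m p
  rw [M.map_refl] at h
  exact h

namespace PTree

/-- The labels of all leaves. -/
def labels : PTree P → Multiset ℕ
  | leaf x => {x}
  | node _ _ c => ∑ i, (c i).labels

/-- The relations among decorated trees. -/
def relSpan (P : Operad.{u, v} k) : Submodule k (PTree P →₀ k) := Submodule.span k {x | Rel x}

/-- The signed sum of all edge contractions, on formal combinations. -/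
def deltaMap (P : Operad.{u, v} k) : (PTree P →₀ k) →ₗ[k] (PTree P →₀ k) :=
  Finsupp.linearCombination k delta

theorem deltaMap_single (t : PTree P) : deltaMap P (.single t 1) = delta t := by
  simp [deltaMap]

/-- A vertex with inputs `J`, numbered by `τ`. -/
def corolla {J : Type} [Finite J] {q : ℕ} (τ : J ≃ Fin (q + 2)) (p : P.obj J)
    (d : J → PTree P) : PTree P := node q (P.map τ p) (d ∘ τ.symm)

theorem labels_corolla {J : Type} [Fintype J] {q : ℕ} (τ : J ≃ Fin (q + 2)) (p : P.obj J)
    (d : J → PTree P) : (corolla τ p d).labels = ∑ j, (d j).labels := by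
  rw [corolla, labels, ← Equiv.sum_comp τ]
  simp

theorem deg_corolla {J : Type} [Fintype J] {q : ℕ} (τ : J ≃ Fin (q + 2)) (p : P.obj J)
    (d : J → PTree P) : (corolla τ p d).deg = q + ∑ j, (d j).deg := by
  rw [corolla, deg, ← Equiv.sum_comp τ]
  simp

end PTree

variable {M : RightModule P}

namespace RightModule.Rake

/-- The labels of all leaves. -/
def labels (t : M.Rake) : Multiset ℕ := ∑ i, (t.2.2 i).labels

/-- A root with inputs `I`, numbered by `e`. -/
def of {I : Type} [Finite I] {l : ℕ} (e : I ≃ Fin (l + 1)) (m : M.obj I) (c : I → PTree P) :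
    M.Rake := ⟨l, M.map e m, c ∘ e.symm⟩

theorem of_refl {l : ℕ} (m : M.obj (Fin (l + 1))) (c : Fin (l + 1) → PTree P) :
    of (Equiv.refl _) m c = (⟨l, m, c⟩ : M.Rake) := by
  unfold of
  rw [M.map_refl]
  rfl

theorem labels_of {I : Type} [Fintype I] {l : ℕ} (e : I ≃ Fin (l + 1)) (m : M.obj I)
    (c : I → PTree P) : (of e m c).labels = ∑ x, (c x).labels := by
  rw [of, labels, ← Equiv.sum_comp e]
  simp

theorem deg_of {I : Type} [Fintype I] {l : ℕ} (e : I ≃ Fin (l + 1)) (m : M.obj I)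
    (c : I → PTree P) : (of e m c).deg = l + ∑ x, (c x).deg := by
  rw [of, deg, ← Equiv.sum_comp e]
  simp

theorem of_congr {I I' : Type} [Finite I] [Finite I'] {l l' : ℕ} (f : I ≃ I')
    (e : I ≃ Fin (l + 1)) (e' : I' ≃ Fin (l' + 1)) (h : ∀ x, (e' (f x) : ℕ) = e x)
    {m : M.obj I} {m' : M.obj I'} (hm : M.map f m = m') {c : I → PTree P} {c' : I' → PTree P}
    (hc : ∀ x, c' (f x) = c x) : of e m c = of e' m' c' := by
  obtain rfl : l = l' := by
    have := Fintype.card_congr ((e.symm.trans f).trans e')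
    simpa using this
  obtain rfl : e = f.trans e' := Equiv.ext fun x => Fin.ext (h x).symm
  subst hm
  unfold of
  rw [M.map_trans]
  congr 2
  ext x
  simp [← hc]

/-- The relations among rakes. -/
def relSpan (M : RightModule P) : Submodule k (M.Rake →₀ k) := Submodule.span k {x | Rel x}

/-- The class of a formal combination of rakes modulo the relations. -/
abbrev cl (M : RightModule P) : (M.Rake →₀ k) →ₗ[k] (M.Rake →₀ k) ⧸ relSpan M := (relSpan M).mkQ

theorem cl_eq_zero_of_rel {x : M.Rake →₀ k} (h : Rel x) : cl M x = 0 := by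
  rw [Submodule.mkQ_apply, Submodule.Quotient.mk_eq_zero]
  exact Submodule.subset_span h

theorem cl_add {I : Type} [Finite I] {l : ℕ} (e : I ≃ Fin (l + 1)) (m m' : M.obj I)
    (c : I → PTree P) : cl M (.single (of e (m + m') c) 1) =
      cl M (.single (of e m c) 1) + cl M (.single (of e m' c) 1) := by
  have := cl_eq_zero_of_rel (Rel.add l (M.map e m) (M.map e m') (c ∘ e.symm))
  rw [map_sub, map_sub, ← map_add (M.map e)] at this
  exact sub_eq_iff_eq_add'.1 (sub_eq_zero.1 this)

theorem cl_smul {I : Type} [Finite I] {l : ℕ} (e : I ≃ Fin (l + 1)) (a : k) (m : M.obj I)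
    (c : I → PTree P) : cl M (.single (of e (a • m) c) 1) =
      a • cl M (.single (of e m c) 1) := by
  have := cl_eq_zero_of_rel (Rel.smul l a (M.map e m) (c ∘ e.symm))
  rw [map_sub, ← map_smul (M.map e)] at this
  rw [← map_smul, Finsupp.smul_single, smul_eq_mul, mul_one]
  exact sub_eq_zero.1 this

theorem cl_perm {I : Type} [Fintype I] {l : ℕ} (e e' : I ≃ Fin (l + 1)) (m : M.obj I)
    (c : I → PTree P) : cl M (.single (of e' m c) 1) =
      ((orderSign (fun x => (e x : ℕ)) (fun x => (e' x : ℕ)) (fun x => (c x).deg) : ℤ) : k) •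
        cl M (.single (of e m c) 1) := by
  have := cl_eq_zero_of_rel (Rel.perm l (e.symm.trans e') (M.map e m) (c ∘ e.symm))
  have h : of e' m c = (⟨l, M.map (e.symm.trans e') (M.map e m),
      (c ∘ e.symm) ∘ (e.symm.trans e').symm⟩ : M.Rake) := by
    unfold of
    rw [← M.map_trans, ← Equiv.trans_assoc, Equiv.self_trans_symm, Equiv.refl_trans]
    congr 2
    ext1; simp
  rw [h, ← permSign_symm_trans e e' (fun x => (c x).deg), ← map_smul, Finsupp.smul_single,
    smul_eq_mul, mul_one]
  rw [map_sub] at this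
  exact sub_eq_zero.1 this

/-- Insertion of a formal combination of trees as the child `x`. -/
def ins {I : Type} [Finite I] [DecidableEq I] {l : ℕ} (e : I ≃ Fin (l + 1)) (m : M.obj I)
    (c : I → PTree P) (x : I) : (PTree P →₀ k) →ₗ[k] (M.Rake →₀ k) :=
  Finsupp.lmapDomain k k fun s => of e m (Function.update c x s)

theorem ins_single {I : Type} [Finite I] [DecidableEq I] {l : ℕ} (e : I ≃ Fin (l + 1))
    (m : M.obj I) (c : I → PTree P) (x : I) (s : PTree P) (a : k) :
    ins e m c x (.single s a) = .single (of e m (Function.update c x s)) a :=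
  Finsupp.mapDomain_single

theorem mk_update_comp_symm {I : Type} [Finite I] [DecidableEq I] {l : ℕ} (e : I ≃ Fin (l + 1))
    (m : M.obj I) (c : I → PTree P) (x : I) (s : PTree P) :
    (⟨l, M.map e m, Function.update (c ∘ e.symm) (e x) s⟩ : M.Rake) =
      of e m (Function.update c x s) := by
  unfold of
  congr 2
  ext1 y
  by_cases h : y = e x
  · subst h; simp
  · rw [Function.update_of_ne h, Function.comp_apply, Function.comp_apply,
      Function.update_of_ne]
    rwa [Ne, Equiv.symm_apply_eq]

theorem cl_ins {I : Type} [Finite I] [DecidableEq I] {l : ℕ} (e : I ≃ Fin (l + 1)) (m : M.obj I)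
    (c : I → PTree P) (x : I) {z : PTree P →₀ k} (hz : z ∈ PTree.relSpan P) :
    cl M (ins e m c x z) = 0 := by
  have : PTree.relSpan P ≤ LinearMap.ker (cl M ∘ₗ ins e m c x) := by
    refine Submodule.span_le.2 fun z hz => ?_
    have := cl_eq_zero_of_rel (Rel.child l (M.map e m) (c ∘ e.symm) (e x) z hz)
    show cl M (ins e m c x z) = 0
    rw [← this]
    exact congrArg (cl M) (congrArg (Finsupp.mapDomain · z)
      (funext fun s => (mk_update_comp_symm e m c x s).symm))
  exact this hz

/-- Contraction of the edge from the root to its child `x`. -/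
def contractAt {I : Type} [Fintype I] [DecidableEq I] {l : ℕ} (e : I ≃ Fin (l + 1))
    (m : M.obj I) (c : I → PTree P) (x : I) : PTree P → (M.Rake →₀ k)
  | .leaf _ => 0
  | .node q p d => .single (of (plugNumbering e x (Equiv.refl (Fin (q + 2))))
      (M.act x m p) (Sum.elim (fun y => c y) d))
      ((-1) ^ (l + (l - e x) * (q + 1) +
        q * degBefore (fun y => (e y : ℕ)) (fun y => (c y).deg) x))

theorem contractAt_corolla {I J : Type} [Fintype I] [DecidableEq I] [Finite J] {l q : ℕ}
    (e : I ≃ Fin (l + 1))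
    (m : M.obj I) (c : I → PTree P) (x : I) (τ : J ≃ Fin (q + 2)) (p : P.obj J)
    (d : J → PTree P) : contractAt e m c x (.corolla τ p d) =
      .single (of (plugNumbering e x τ)
      (M.act x m p) (Sum.elim (fun y => c y) d))
      ((-1) ^ (l + (l - e x) * (q + 1) +
        q * degBefore (fun y => (e y : ℕ)) (fun y => (c y).deg) x)) := by
  rw [PTree.corolla, contractAt]
  congr 1
  refine of_congr (Equiv.sumCongr (Equiv.refl _) τ.symm) _ _ ?_ ?_ ?_
  · rintro (y | y)
    · rfl
    · simp [plugNumbering_inr]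
  · rw [M.act_map_right, ← M.map_trans]
    convert M.map_refl _
    ext (y | y) <;> simp
  · rintro (y | y) <;> rfl

theorem leftDeg_comp_symm {I : Type} [Fintype I] {n : ℕ} (e : I ≃ Fin n) (c : I → PTree P)
    (x : I) : PTree.leftDeg (c ∘ e.symm) (e x) =
      degBefore (fun y => (e y : ℕ)) (fun y => (c y).deg) x := by
  rw [PTree.leftDeg, Finset.sum_filter, degBefore, ← Equiv.sum_comp e]
  simp only [Equiv.symm_apply_apply, Function.comp_apply, Fin.val_fin_lt]

theorem contract_comp_symm {I : Type} [Fintype I] [DecidableEq I] {l : ℕ} (e : I ≃ Fin (l + 1))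
    (m : M.obj I) (c : I → PTree P) (x : I) (t : PTree P) :
    contract l (M.map e m) (c ∘ e.symm) (e x) t = contractAt e m c x t := by
  cases t with
  | leaf y => rfl
  | node q p d =>
    rw [contract, contractAt, leftDeg_comp_symm]
    congr 1
    unfold RightModule.pact
    have h := M.act_map x e (Equiv.refl (Fin (q + 2))) m p
    rw [P.map_refl] at h
    rw [h]
    unfold of PTree.splice plugNumbering
    rw [M.map_trans]
    congr 2
    ext1 s
    simp only [Function.comp_apply, Equiv.symm_trans_apply]
    rcases (planarEquiv l (q + 2) (e x)).symm s with y | y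
    · simp [neEquiv]
    · simp

/-- The signed sum of all edge contractions, on formal combinations. -/
def deltaMap (M : RightModule P) : (M.Rake →₀ k) →ₗ[k] (M.Rake →₀ k) :=
  Finsupp.linearCombination k delta

/-- The signed sum of all contractions of an edge at the root. -/
def rootDelta (M : RightModule P) : (M.Rake →₀ k) →ₗ[k] (M.Rake →₀ k) :=
  Finsupp.linearCombination k fun t => ∑ i, contract t.1 t.2.1 t.2.2 i (t.2.2 i)

/-- The signed sum over all children of the results of applying the operator `u` of odd degree to
this child; the term of a child with labels `B` has weight `w B`. -/
def childSum (M : RightModule P) (w : Multiset ℕ → k) (u : (PTree P →₀ k) →ₗ[k] (PTree P →₀ k)) :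
    (M.Rake →₀ k) →ₗ[k] (M.Rake →₀ k) :=
  Finsupp.linearCombination k fun t => ∑ i,
    (w (t.2.2 i).labels * (-1 : k) ^ (t.1 + PTree.leftDeg t.2.2 i)) •
      (u (.single (t.2.2 i) 1)).mapDomain fun s =>
        (⟨t.1, t.2.1, Function.update t.2.2 i s⟩ : M.Rake)

theorem deltaMap_eq (M : RightModule P) :
    deltaMap M = rootDelta M + childSum M (fun _ => 1) (PTree.deltaMap P) := by
  ext1 t
  ext1
  simp [deltaMap, rootDelta, childSum, delta, PTree.deltaMap, Finset.sum_add_distrib]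

theorem rootDelta_of {I : Type} [Fintype I] [DecidableEq I] {l : ℕ} (e : I ≃ Fin (l + 1))
    (m : M.obj I) (c : I → PTree P) : rootDelta M (.single (of e m c) 1) =
      ∑ x, contractAt e m c x (c x) := by
  rw [rootDelta, Finsupp.linearCombination_single, one_smul]
  refine (Equiv.sum_comp e _).symm.trans (Finset.sum_congr rfl fun x _ => ?_)
  simp only [of, Function.comp_apply, Equiv.symm_apply_apply, contract_comp_symm]

theorem childSum_of {I : Type} [Fintype I] [DecidableEq I] {l : ℕ} (e : I ≃ Fin (l + 1))
    (m : M.obj I) (c : I → PTree P) (w : Multiset ℕ → k)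
    (u : (PTree P →₀ k) →ₗ[k] (PTree P →₀ k)) : childSum M w u (.single (of e m c) 1) =
      ∑ x, (w (c x).labels * (-1 : k) ^ (l + degBefore (fun y => (e y : ℕ))
        (fun y => (c y).deg) x)) • ins e m c x (u (.single (c x) 1)) := by
  rw [childSum, Finsupp.linearCombination_single, one_smul]
  refine (Equiv.sum_comp e _).symm.trans (Finset.sum_congr rfl fun x _ => ?_)
  simp only [of, Function.comp_apply, Equiv.symm_apply_apply, leftDeg_comp_symm]
  exact congrArg (_ • ·) (congrArg (Finsupp.mapDomain · _)
    (funext fun s => mk_update_comp_symm e m c x s))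

end RightModule.Rake
end Trees

section
variable {P : Operad.{u, v} k}

namespace PTree

/-- An operator on trees which preserves the labels and changes the degree by an odd number. -/
def OddOp (u : (PTree P →₀ k) →ₗ[k] (PTree P →₀ k)) : Prop :=
  ∀ t, ∀ s ∈ (u (.single t 1)).support, s.labels = t.labels ∧ Odd (s.deg + t.deg)

theorem labels_node_update {n : ℕ} (p : P.obj (Fin (n + 2))) (c : Fin (n + 2) → PTree P)
    (i : Fin (n + 2)) (t : PTree P) :
    (node n p (Function.update c i t)).labels = t.labels + ∑ j : {j // j ≠ i}, (c j).labels := by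
  rw [labels, sum_eq_add_sum_ne _ i, Function.update_self]
  congr 1
  exact Finset.sum_congr rfl fun j _ => by rw [Function.update_of_ne j.2]

theorem deg_node_update {n : ℕ} (p : P.obj (Fin (n + 2))) (c : Fin (n + 2) → PTree P)
    (i : Fin (n + 2)) (t : PTree P) :
    (node n p (Function.update c i t)).deg = t.deg + (n + ∑ j : {j // j ≠ i}, (c j).deg) := by
  rw [deg, sum_eq_add_sum_ne _ i, Function.update_self, add_left_comm]
  congr 2
  exact Finset.sum_congr rfl fun j _ => by rw [Function.update_of_ne j.2]

theorem Rel.homogeneous {x : PTree P →₀ k} (h : Rel x) :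
    ∃ (B : Multiset ℕ) (g : ℕ), ∀ t ∈ x.support, t.labels = B ∧ t.deg = g := by
  classical
  induction h with
  | add n p p' c =>
    refine ⟨∑ i, (c i).labels, n + ∑ i, (c i).deg, fun t ht => ?_⟩
    have := Finsupp.support_sub ht
    rcases Finset.mem_union.1 this with h | h
    · rcases Finset.mem_union.1 (Finsupp.support_sub h) with h | h <;>
        rw [Finset.mem_singleton.1 (Finsupp.support_single_subset h)] <;> exact ⟨rfl, rfl⟩
    · rw [Finset.mem_singleton.1 (Finsupp.support_single_subset h)]; exact ⟨rfl, rfl⟩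
  | smul n a p c =>
    refine ⟨∑ i, (c i).labels, n + ∑ i, (c i).deg, fun t ht => ?_⟩
    rcases Finset.mem_union.1 (Finsupp.support_sub ht) with h | h <;>
      rw [Finset.mem_singleton.1 (Finsupp.support_single_subset h)] <;> exact ⟨rfl, rfl⟩
  | perm n σ p c =>
    refine ⟨∑ i, (c i).labels, n + ∑ i, (c i).deg, fun t ht => ?_⟩
    rcases Finset.mem_union.1 (Finsupp.support_sub ht) with h | h <;>
      rw [Finset.mem_singleton.1 (Finsupp.support_single_subset h)]
    · exact ⟨labels_corolla σ p c, deg_corolla σ p c⟩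
    · exact ⟨rfl, rfl⟩
  | child n p c i x _ ih =>
    obtain ⟨B, g, ih⟩ := ih
    refine ⟨B + ∑ j : {j // j ≠ i}, (c j).labels, g + (n + ∑ j : {j // j ≠ i}, (c j).deg),
      fun t ht => ?_⟩
    obtain ⟨s, hs, rfl⟩ := Finset.mem_image.1 (Finsupp.mapDomain_support ht)
    rw [labels_node_update, deg_node_update, (ih s hs).1, (ih s hs).2]
    exact ⟨rfl, rfl⟩

end PTree

namespace RightModule.Rake
variable {M : RightModule P}
variable {I : Type} [Fintype I] [DecidableEq I] {l : ℕ}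

theorem cl_single_eq_smul (t : M.Rake) (a : k) : cl M (.single t a) = a • cl M (.single t 1) := by
  rw [← map_smul, Finsupp.smul_single, smul_eq_mul, mul_one]

/-! ### The relations are preserved by contractions at the root -/

theorem cl_contractAt_add (e : I ≃ Fin (l + 1)) (m m' : M.obj I) (c : I → PTree P) (x : I)
    (t : PTree P) : cl M (contractAt e (m + m') c x t) =
      cl M (contractAt e m c x t) + cl M (contractAt e m' c x t) := by
  cases t with
  | leaf y => simp [contractAt]
  | node q p d =>
    simp only [contractAt]
    rw [cl_single_eq_smul, cl_single_eq_smul _ (_ ^ _), cl_single_eq_smul (of _ (M.act x m' p) _),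
      map_add, LinearMap.add_apply, cl_add, smul_add]

theorem cl_contractAt_smul (e : I ≃ Fin (l + 1)) (a : k) (m : M.obj I) (c : I → PTree P) (x : I)
    (t : PTree P) : cl M (contractAt e (a • m) c x t) = a • cl M (contractAt e m c x t) := by
  cases t with
  | leaf y => simp [contractAt]
  | node q p d =>
    simp only [contractAt]
    rw [cl_single_eq_smul, cl_single_eq_smul _ (_ ^ _), map_smul, LinearMap.smul_apply, cl_smul,
      smul_comm]

theorem cl_contractAt_perm (e e' : I ≃ Fin (l + 1)) (m : M.obj I) (c : I → PTree P) (x : I) :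
    cl M (contractAt e' m c x (c x)) =
      ((orderSign (fun x => (e x : ℕ)) (fun x => (e' x : ℕ)) (fun x => (c x).deg) : ℤ) : k) •
        cl M (contractAt e m c x (c x)) := by
  cases h : c x with
  | leaf y => simp [contractAt]
  | node q p d =>
    have key := orderSign_plugNumbering e e' x (Equiv.refl (Fin (q + 2))) (Equiv.refl _)
      (fun y => (c y).deg) (fun s => (d s).deg) (by rw [h]; rfl)
    have hd : (fun y => (Sum.elim (fun y : {y // y ≠ x} => c y) d y).deg) =
      Sum.elim (fun y : {y // y ≠ x} => (c y).deg) (fun s => (d s).deg) := by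
      ext (y | y) <;> rfl
    simp only [contractAt]
    rw [cl_single_eq_smul, cl_single_eq_smul _ (_ ^ _),
      cl_perm (plugNumbering e x (Equiv.refl (Fin (q + 2)))), hd, smul_smul, smul_smul]
    congr 1
    rw [orderSign_self, mul_one] at key
    have key' := congrArg (Int.cast : ℤ → k) key
    push_cast at key'
    have hl : ∀ a b : ℕ, (-1 : k) ^ (l + a + b) = (-1) ^ l * (-1) ^ (a + b) := fun a b => by
      rw [add_assoc, pow_add]
    rw [hl, hl]
    linear_combination (-1) ^ l * key'

/-- Contraction of the edge from the root to its child `x`, on formal combinations. -/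
def contractMap (e : I ≃ Fin (l + 1)) (m : M.obj I) (c : I → PTree P) (x : I) :
    (PTree P →₀ k) →ₗ[k] (M.Rake →₀ k) := Finsupp.linearCombination k (contractAt e m c x)

theorem contractMap_single (e : I ≃ Fin (l + 1)) (m : M.obj I) (c : I → PTree P) (x : I)
    (t : PTree P) : contractMap e m c x (.single t 1) = contractAt e m c x t := by
  simp [contractMap]

theorem degBefore_update_self (e : I → ℕ) (c : I → PTree P) (x : I) (s : PTree P) :
    degBefore e (fun y => (Function.update c x s y).deg) x =
      degBefore e (fun y => (c y).deg) x := by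
  refine Finset.sum_congr rfl fun y _ => ?_
  by_cases h : y = x
  · subst h; simp
  · simp only [Function.update_of_ne h]

theorem contractAt_update_self (e : I ≃ Fin (l + 1)) (m : M.obj I) (c : I → PTree P) (x : I)
    (s t : PTree P) : contractAt e m (Function.update c x s) x t = contractAt e m c x t := by
  cases t with
  | leaf y => rfl
  | node q p d =>
    rw [contractAt, contractAt, degBefore_update_self]
    congr 3
    ext1 y
    exact Function.update_of_ne y.2 _ _

omit [Fintype I] in
theorem elim_update_inr {J : Type} [DecidableEq J] {x : I} (c : I → PTree P) (d : J → PTree P)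
    (j : J) (t : PTree P) : Sum.elim (fun y : {y // y ≠ x} => c y) (Function.update d j t) =
      Function.update (Sum.elim (fun y : {y // y ≠ x} => c y) d) (.inr j) t := by
  ext1 (y | y)
  · simp
  · by_cases h : y = j
    · subst h; simp
    · simp [h]

omit [Fintype I] in
theorem elim_update_inl {J : Type} [DecidableEq J] {x y : I} (h : y ≠ x) (c : I → PTree P)
    (d : J → PTree P) (t : PTree P) :
    Sum.elim (fun z : {z // z ≠ x} => Function.update c y t z) d =
      Function.update (Sum.elim (fun z : {z // z ≠ x} => c z) d) (.inl ⟨y, h⟩) t := by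
  ext1 (z | z)
  · by_cases hz : z.1 = y
    · have : z = ⟨y, h⟩ := Subtype.ext hz
      subst this; simp
    · have : z ≠ ⟨y, h⟩ := fun h => hz (congrArg Subtype.val h)
      simp [hz, this]
  · simp

theorem cl_contractMap (e : I ≃ Fin (l + 1)) (m : M.obj I) (c : I → PTree P) (x : I)
    {z : PTree P →₀ k} (hz : z ∈ PTree.relSpan P) : cl M (contractMap e m c x z) = 0 := by
  have : PTree.relSpan P ≤ LinearMap.ker (cl M ∘ₗ contractMap e m c x) := by
    refine Submodule.span_le.2 fun z hz => ?_
    show cl M (contractMap e m c x z) = 0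
    have sm : ∀ (t : PTree P) (a : k), contractMap (M := M) e m c x (.single t a) =
        a • contractAt e m c x t := fun t a => by simp [contractMap]
    cases hz with
    | add n p p' d =>
      simp only [map_sub, sm, one_smul, contractAt]
      rw [cl_single_eq_smul, cl_single_eq_smul _ (_ ^ _),
        cl_single_eq_smul (of _ (M.act x m p') _), map_add, cl_add]
      module
    | smul n a p d =>
      rw [map_sub, sm, sm, one_smul, map_sub, map_smul]
      simp only [contractAt]
      rw [cl_single_eq_smul, cl_single_eq_smul _ (_ ^ _), map_smul, cl_smul]
      module
    | perm n σ p d =>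
      have hd : (fun y => (Sum.elim (fun y : {y // y ≠ x} => c y) d y).deg) =
        Sum.elim (fun y : {y // y ≠ x} => (c y).deg) (fun s => (d s).deg) := by
        ext (y | y) <;> rfl
      rw [map_sub, sm, sm, one_smul, map_sub, map_smul]
      change cl M (contractAt e m c x (.corolla σ p d)) - _ = 0
      rw [contractAt_corolla]
      simp only [contractAt]
      have key := orderSign_plugNumbering e e x (Equiv.refl (Fin (n + 2))) σ
        (Function.update (fun y => (c y).deg) x (n + ∑ s, (d s).deg)) (fun s => (d s).deg)
        (by simp)
      rw [orderSign_self, one_mul] at key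
      have h0 : (fun y : {y // y ≠ x} =>
          Function.update (fun y => (c y).deg) x (n + ∑ s, (d s).deg) y) =
          fun y : {y // y ≠ x} => (c y).deg := by
        ext y; rw [Function.update_of_ne y.2]
      rw [h0] at key
      have key' := mul_right_cancel₀ (pow_ne_zero _ (by norm_num)) key
      rw [cl_single_eq_smul, cl_single_eq_smul _ (_ ^ _),
        cl_perm (plugNumbering e x (Equiv.refl (Fin (n + 2)))), hd, key',
        permSign_eq_orderSign]
      simp only [Equiv.refl_apply]
      module
    | child n p d j z hz =>
      rw [← Finsupp.lmapDomain_apply k k]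
      have : contractMap (M := M) e m c x ∘ₗ Finsupp.lmapDomain k k
          (fun t => PTree.node n p (Function.update d j t)) =
          ((-1 : k) ^ (l + (l - e x) * (n + 1) +
            n * degBefore (fun y => (e y : ℕ)) (fun y => (c y).deg) x)) •
          ins (plugNumbering e x (Equiv.refl (Fin (n + 2)))) (M.act x m p)
            (Sum.elim (fun y => c y) d) (.inr j) := by
        ext1 t
        ext1
        simp only [LinearMap.comp_apply, Finsupp.lsingle_apply, Finsupp.lmapDomain_apply,
          Finsupp.mapDomain_single, LinearMap.smul_apply, contractMap_single, ins_single,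
          contractAt, elim_update_inr, Finsupp.smul_single, smul_eq_mul, mul_one]
      have h2 := LinearMap.congr_fun this z
      rw [LinearMap.comp_apply] at h2
      rw [h2, LinearMap.smul_apply, map_smul, cl_ins _ _ _ _ (Submodule.subset_span hz), smul_zero]
  exact this hz

theorem degBefore_update_congr (e : I → ℕ) (c : I → PTree P) (x y : I) {s t : PTree P}
    (h : s.deg = t.deg) : degBefore e (fun z => (Function.update c x s z).deg) y =
      degBefore e (fun z => (Function.update c x t z).deg) y := by
  refine Finset.sum_congr rfl fun z _ => ?_
  by_cases hz : z = x
  · subst hz; simp [h]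
  · simp only [Function.update_of_ne hz]

theorem cl_rootDelta {z : M.Rake →₀ k} (hz : z ∈ relSpan M) : cl M (rootDelta M z) = 0 := by
  have : relSpan M ≤ LinearMap.ker (cl M ∘ₗ rootDelta M) := by
    refine Submodule.span_le.2 fun z hz => ?_
    show cl M (rootDelta M z) = 0
    have sm : ∀ (t : M.Rake) (a : k), rootDelta M (.single t a) =
        a • rootDelta M (.single t 1) := fun t a => by simp [rootDelta]
    cases hz with
    | add l m m' c =>
      simp only [← of_refl, map_sub, rootDelta_of, map_sum, cl_contractAt_add,
        Finset.sum_add_distrib]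
      abel
    | smul l a m c =>
      rw [map_sub, sm _ a]
      simp only [← of_refl, map_sub, rootDelta_of, map_sum, cl_contractAt_smul, map_smul,
        Finset.smul_sum, sub_self]
    | perm l σ m c =>
      rw [map_sub, sm _ ((permSign σ fun i => (c i).deg : ℤ) : k), map_sub, map_smul, ← of_refl m]
      change cl M (rootDelta M (.single (of σ m c) 1)) - _ = 0
      rw [rootDelta_of, rootDelta_of, map_sum, map_sum, sub_eq_zero, Finset.smul_sum]
      exact Finset.sum_congr rfl fun x _ => cl_contractAt_perm (Equiv.refl _) σ m c x
    | child l m c i z hz =>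
      obtain ⟨B, g, hB⟩ := hz.homogeneous
      have hz' : z ∈ PTree.relSpan P := Submodule.subset_span hz
      simp only [← of_refl]
      change cl M (rootDelta M (ins (Equiv.refl _) m c i z)) = 0
      set e := Equiv.refl (Fin (l + 1))
      by_cases h0 : z.support.Nonempty
      swap
      · rw [Finset.not_nonempty_iff_eq_empty, Finsupp.support_eq_empty] at h0
        simp [h0]
      obtain ⟨t₀, ht₀⟩ := h0
      have : rootDelta M (ins e m c i z) = contractMap e m c i z +
          ∑ y : {y // y ≠ i}, Finsupp.linearCombination k
            (fun s => contractAt (M := M) e m (Function.update c i s) y (c y)) z := by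
        have h2 : rootDelta M ∘ₗ ins e m c i = contractMap e m c i +
          ∑ y : {y // y ≠ i}, Finsupp.linearCombination k
            (fun s => contractAt (M := M) e m (Function.update c i s) y (c y)) := by
          ext1 s
          ext1
          simp only [LinearMap.comp_apply, Finsupp.lsingle_apply, ins_single, rootDelta_of,
            LinearMap.add_apply, contractMap_single, LinearMap.sum_apply,
            Finsupp.linearCombination_single, one_smul]
          rw [sum_eq_add_sum_ne _ i, Function.update_self, contractAt_update_self]
          congr 1
          exact Finset.sum_congr rfl fun y _ => by rw [Function.update_of_ne y.2]
        have h3 := LinearMap.congr_fun h2 z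
        rwa [LinearMap.add_apply, LinearMap.sum_apply] at h3
      rw [this, map_add, cl_contractMap _ _ _ _ hz', zero_add, map_sum]
      refine Finset.sum_eq_zero fun y _ => ?_
      cases hy : c y with
      | leaf => simp [contractAt, Finsupp.linearCombination_apply]
      | node q p d =>
        have : Finsupp.linearCombination k
            (fun s => contractAt (M := M) e m (Function.update c i s) y (.node q p d)) z =
            (((-1 : k) ^ (l + (l - e y) * (q + 1) +
            q * degBefore (fun y => (e y : ℕ)) (fun z => (Function.update c i t₀ z).deg) y)) •
          ins (plugNumbering e y.1 (Equiv.refl (Fin (q + 2)))) (M.act y.1 m p)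
            (Sum.elim (fun y => c y) d) (.inl ⟨i, y.2.symm⟩)) z := by
          refine linearMap_congr_support fun s hs => ?_
          rw [Finsupp.linearCombination_single, one_smul, contractAt, LinearMap.smul_apply,
            ins_single, elim_update_inl y.2.symm, degBefore_update_congr _ _ _ _
              ((hB s hs).2.trans (hB t₀ ht₀).2.symm), Finsupp.smul_single, smul_eq_mul, mul_one]
        rw [this, LinearMap.smul_apply, map_smul, cl_ins _ _ _ _ hz', smul_zero]
  exact this hz

/-! ### The relations are preserved by operators on the children -/

theorem cl_ins_add (e : I ≃ Fin (l + 1)) (m m' : M.obj I) (c : I → PTree P) (x : I)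
    (z : PTree P →₀ k) : cl M (ins e (m + m') c x z) =
      cl M (ins e m c x z) + cl M (ins e m' c x z) := by
  have : cl M ∘ₗ ins e (m + m') c x = cl M ∘ₗ ins e m c x + cl M ∘ₗ ins e m' c x := by
    ext1 s
    ext1
    simp only [LinearMap.comp_apply, Finsupp.lsingle_apply, ins_single, LinearMap.add_apply,
      cl_add]
  exact LinearMap.congr_fun this z

theorem cl_ins_smul (e : I ≃ Fin (l + 1)) (a : k) (m : M.obj I) (c : I → PTree P) (x : I)
    (z : PTree P →₀ k) : cl M (ins e (a • m) c x z) = a • cl M (ins e m c x z) := by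
  have : cl M ∘ₗ ins e (a • m) c x = a • (cl M ∘ₗ ins e m c x) := by
    ext1 s
    ext1
    simp only [LinearMap.comp_apply, Finsupp.lsingle_apply, ins_single, LinearMap.smul_apply,
      cl_smul]
  exact LinearMap.congr_fun this z

theorem ins_update_self (e : I ≃ Fin (l + 1)) (m : M.obj I) (c : I → PTree P) (x : I)
    (t : PTree P) : ins e m (Function.update c x t) x = ins e m c x := by
  unfold ins
  simp only [Function.update_idem]

section
variable (w : Multiset ℕ → k) (u : (PTree P →₀ k) →ₗ[k] (PTree P →₀ k))

theorem cl_childSum_add (l : ℕ) (m m' : M.obj (Fin (l + 1))) (c : Fin (l + 1) → PTree P) :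
    cl M (childSum M w u (.single ⟨l, m + m', c⟩ 1 - .single ⟨l, m, c⟩ 1 -
      .single ⟨l, m', c⟩ 1)) = 0 := by
  simp only [← of_refl, map_sub, childSum_of, map_sum, map_smul, cl_ins_add, smul_add,
    Finset.sum_add_distrib]
  abel

theorem cl_childSum_smul (l : ℕ) (a : k) (m : M.obj (Fin (l + 1))) (c : Fin (l + 1) → PTree P) :
    cl M (childSum M w u (.single ⟨l, a • m, c⟩ 1 - .single ⟨l, m, c⟩ a)) = 0 := by
  have sm : ∀ (t : M.Rake) (a : k), childSum M w u (.single t a) =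
      a • childSum M w u (.single t 1) := fun t a => by simp [childSum]
  rw [map_sub, sm _ a]
  simp only [← of_refl, map_sub, childSum_of, map_sum, cl_ins_smul, map_smul,
    Finset.smul_sum, smul_comm a, sub_self]

variable {u}

theorem cl_childSum_perm (hu : PTree.OddOp u) (l : ℕ) (σ : Equiv.Perm (Fin (l + 1)))
    (m : M.obj (Fin (l + 1))) (c : Fin (l + 1) → PTree P) :
    cl M (childSum M w u (.single ⟨l, M.map σ m, c ∘ σ.symm⟩ 1 -
      .single ⟨l, m, c⟩ ((permSign σ fun i => (c i).deg : ℤ) : k))) = 0 := by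
  have sm : ∀ (t : M.Rake) (a : k), childSum M w u (.single t a) =
      a • childSum M w u (.single t 1) := fun t a => by simp [childSum]
  rw [map_sub, sm _ ((permSign σ fun i => (c i).deg : ℤ) : k), map_sub, map_smul, ← of_refl m]
  change cl M (childSum M w u (.single (of σ m c) 1)) - _ = 0
  rw [childSum_of, childSum_of, map_sum, map_sum, sub_eq_zero, Finset.smul_sum]
  refine Finset.sum_congr rfl fun x _ => ?_
  rw [map_smul, map_smul]
  generalize hz : u (.single (c x) 1) = z
  have hs : ∀ s ∈ z.support, Odd (s.deg + (c x).deg) := fun s hs => by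
    rw [← hz] at hs; exact (hu _ s hs).2
  refine linearMap_congr_support (f := (_ : k) • (cl M ∘ₗ ins σ m c x))
    (g := (_ : k) • (_ : k) • (cl M ∘ₗ ins (Equiv.refl _) m c x)) fun s hz => ?_
  simp only [LinearMap.comp_apply, LinearMap.smul_apply, ins_single]
  rw [cl_perm (Equiv.refl _), smul_smul, smul_smul]
  congr 1
  have key := orderSign_update (Equiv.refl _) σ (fun y => (c y).deg) x s.deg (hs s hz)
  have h0 : (fun y => (Function.update c x s y).deg) =
      Function.update (fun y => (c y).deg) x s.deg := by
    ext y
    by_cases h : y = x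
    · subst h; simp
    · simp [h]
  rw [h0]
  have key' := congrArg (Int.cast : ℤ → k) key
  push_cast at key'
  rw [permSign_eq_orderSign, pow_add, pow_add]
  simp only [Equiv.refl_apply] at key' ⊢
  linear_combination w (c x).labels * (-1) ^ l * key'

theorem cl_childSum_child (l : ℕ) (m : M.obj (Fin (l + 1)))
    (c : Fin (l + 1) → PTree P) (i : Fin (l + 1)) {z : PTree P →₀ k} (hz : PTree.Rel z)
    (hS : u z ∈ PTree.relSpan P) :
    cl M (childSum M w u (z.mapDomain fun s => ⟨l, m, Function.update c i s⟩)) = 0 := by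
  obtain ⟨B, g, hB⟩ := hz.homogeneous
  have hz' : z ∈ PTree.relSpan P := Submodule.subset_span hz
  simp only [← of_refl]
  change cl M (childSum M w u (ins (Equiv.refl _) m c i z)) = 0
  set e := Equiv.refl (Fin (l + 1))
  by_cases h0 : z.support.Nonempty
  swap
  · rw [Finset.not_nonempty_iff_eq_empty, Finsupp.support_eq_empty] at h0
    simp [h0]
  obtain ⟨t₀, ht₀⟩ := h0
  set C : Fin (l + 1) → k := fun y => w (Function.update c i t₀ y).labels * (-1 : k) ^ (l +
    degBefore (fun y => (e y : ℕ)) (fun z => (Function.update c i t₀ z).deg) y) with hC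
  have : childSum M w u (ins e m c i z) = C i • ins e m c i (u z) +
      ∑ y : {y // y ≠ i}, C y • (u (.single (c y) 1)).sum fun s' a => a •
        ins e m (Function.update c y s') i z := by
    have h2 : childSum M w u (ins e m c i z) = (C i • ins e m c i ∘ₗ u +
      ∑ y : {y // y ≠ i}, C y • (u (.single (c y) 1)).sum fun s' a => a •
        ins e m (Function.update c y s') i) z := by
      rw [← LinearMap.comp_apply]
      refine linearMap_congr_support fun s hs => ?_
      have hsd := (hB s hs).2.trans (hB t₀ ht₀).2.symm
      have hsl := (hB s hs).1.trans (hB t₀ ht₀).1.symm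
      simp only [LinearMap.comp_apply, ins_single, childSum_of,
        LinearMap.add_apply, LinearMap.sum_apply, LinearMap.smul_apply]
      rw [sum_eq_add_sum_ne _ i, Function.update_self, ins_update_self]
      simp only [hC, degBefore_update_congr _ _ _ _ hsd, Function.update_self, hsl]
      congr 1
      refine Finset.sum_congr rfl fun y _ => ?_
      rw [Function.update_of_ne y.2, Function.update_of_ne y.2]
      congr 1
      conv_lhs => rw [← Finsupp.sum_single (u (.single (c y) 1))]
      rw [Finsupp.sum, Finsupp.sum, map_sum, LinearMap.sum_apply]
      refine Finset.sum_congr rfl fun s' _ => ?_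
      rw [LinearMap.smul_apply, ins_single, ins_single, Finsupp.smul_single, smul_eq_mul,
        mul_one, Function.update_comm y.2]
    rw [h2]
    simp only [Finsupp.sum, LinearMap.add_apply, LinearMap.smul_apply, LinearMap.comp_apply,
      LinearMap.sum_apply]
  rw [this, map_add, map_smul, cl_ins _ _ _ _ (hS), smul_zero, zero_add, map_sum]
  refine Finset.sum_eq_zero fun y _ => ?_
  rw [map_smul, Finsupp.sum, map_sum, Finset.sum_eq_zero, smul_zero]
  intro s' _
  rw [map_smul, cl_ins _ _ _ _ hz', smul_zero]

theorem cl_childSum (hu : PTree.OddOp u) (hS : ∀ z, PTree.Rel z → u z ∈ PTree.relSpan P)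
    {z : M.Rake →₀ k} (hz : z ∈ relSpan M) : cl M (childSum M w u z) = 0 := by
  have : relSpan M ≤ LinearMap.ker (cl M ∘ₗ childSum M w u) := by
    refine Submodule.span_le.2 fun z hz => ?_
    cases hz with
    | add l m m' c => exact cl_childSum_add w u l m m' c
    | smul l a m c => exact cl_childSum_smul w u l a m c
    | perm l σ m c => exact cl_childSum_perm w hu l σ m c
    | child l m c i z hz => exact cl_childSum_child w l m c i hz (hS z hz)
  exact this hz

end

end RightModule.Rake
end

section
variable {P : Operad.{u, v} k}

namespace RightModule.Rake
variable {M : RightModule P}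
variable {I : Type} [Fintype I] [DecidableEq I] {l : ℕ}

/-! ### Composites of operators on the children -/

/-- Insertion of formal combinations of trees as the children `x` and `y`. -/
def insTwo (e : I ≃ Fin (l + 1)) (m : M.obj I) (c : I → PTree P) (x y : I) :
    (PTree P →₀ k) →ₗ[k] (PTree P →₀ k) →ₗ[k] (M.Rake →₀ k) :=
  Finsupp.linearCombination k fun s => ins e m (Function.update c x s) y

theorem insTwo_comm (e : I ≃ Fin (l + 1)) (m : M.obj I) (c : I → PTree P) {x y : I} (h : y ≠ x)
    (z z' : PTree P →₀ k) : insTwo e m c x y z z' = insTwo e m c y x z' z := by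
  have : insTwo e m c x y = (insTwo e m c y x).flip := by
    ext1 s
    ext1
    ext1 s'
    ext1
    simp only [insTwo, LinearMap.comp_apply, Finsupp.lsingle_apply, LinearMap.flip_apply,
      Finsupp.linearCombination_single, one_smul, ins_single, Function.update_comm h]
  rw [this]
  rfl

theorem degBefore_update_parity (e : I → ℕ) (c : I → PTree P) {x y : I} {s : PTree P}
    (h : Odd (s.deg + (c x).deg)) :
    (-1 : k) ^ degBefore e (fun z => (Function.update c x s z).deg) y =
      (-1) ^ (degBefore e (fun z => (c z).deg) y + if e x < e y then 1 else 0) := by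
  apply neg_one_pow_congr_zmod
  have h1 := degBefore_update e (fun z => (c z).deg) y x s.deg
  have h0 : (fun z => (Function.update c x s z).deg) =
      Function.update (fun z => (c z).deg) x s.deg := by
    ext z
    by_cases h : z = x
    · subst h; simp
    · simp [h]
  rw [h0]
  have h2 := (ZMod.natCast_eq_one_iff_odd).2 h
  have h3 := congrArg (Nat.cast : ℕ → ZMod 2) h1
  push_cast at h2 h3 ⊢
  split_ifs at h3 ⊢
  · generalize (degBefore e (Function.update (fun z => (c z).deg) x s.deg) y : ZMod 2) = a,
      (degBefore e (fun z => (c z).deg) y : ZMod 2) = b, (s.deg : ZMod 2) = a',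
      ((c x).deg : ZMod 2) = b' at *
    clear * - h2 h3
    decide +revert
  · simpa using h3

theorem childSum_ins_of_odd (e : I ≃ Fin (l + 1)) (m : M.obj I) (c : I → PTree P) (x : I)
    (w : Multiset ℕ → k) (u : (PTree P →₀ k) →ₗ[k] (PTree P →₀ k)) {z : PTree P →₀ k}
    (hz : ∀ s ∈ z.support, s.labels = (c x).labels ∧ Odd (s.deg + (c x).deg)) :
    childSum M w u (ins e m c x z) =
      (w (c x).labels * (-1 : k) ^ (l + degBefore (fun y => (e y : ℕ)) (fun y => (c y).deg) x)) •
        ins e m c x (u z) +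
      ∑ y : {y // y ≠ x}, (w (c y).labels * (-1 : k) ^ (l + (degBefore (fun y => (e y : ℕ))
        (fun y => (c y).deg) y + if (e x : ℕ) < e y then 1 else 0))) •
          insTwo e m c x y z (u (.single (c y) 1)) := by
  have : childSum M w u (ins e m c x z) =
      ((w (c x).labels * (-1 : k) ^ (l + degBefore (fun y => (e y : ℕ)) (fun y => (c y).deg) x)) •
        ins e m c x ∘ₗ u +
      ∑ y : {y // y ≠ x}, (w (c y).labels * (-1 : k) ^ (l + (degBefore (fun y => (e y : ℕ))
        (fun y => (c y).deg) y + if (e x : ℕ) < e y then 1 else 0))) •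
          (insTwo e m c x y).flip (u (.single (c y) 1))) z := by
    rw [← LinearMap.comp_apply]
    refine linearMap_congr_support fun s hs => ?_
    obtain ⟨h1, h2⟩ := hz s hs
    simp only [LinearMap.comp_apply, LinearMap.add_apply, LinearMap.sum_apply,
      LinearMap.smul_apply, LinearMap.flip_apply, ins_single, childSum_of]
    rw [sum_eq_add_sum_ne _ x]
    congr 1
    · rw [Function.update_self, h1, ins_update_self, degBefore_update_self]
    · refine Finset.sum_congr rfl fun y _ => ?_
      rw [Function.update_of_ne y.2, pow_add, degBefore_update_parity _ _ h2, ← pow_add]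
      simp [insTwo]
  rw [this]
  simp only [LinearMap.comp_apply, LinearMap.add_apply, LinearMap.sum_apply,
      LinearMap.smul_apply, LinearMap.flip_apply]

/-- The part of the composite of two operators where they act on different children. -/
def offDiagonal (e : I ≃ Fin (l + 1)) (m : M.obj I) (c : I → PTree P)
    (w w' : Multiset ℕ → k) (u u' : (PTree P →₀ k) →ₗ[k] (PTree P →₀ k)) (x y : I) :
    M.Rake →₀ k :=
  (w (c x).labels * w' (c y).labels * (-1 : k) ^
    (degBefore (fun y => (e y : ℕ)) (fun y => (c y).deg) x +
      (degBefore (fun y => (e y : ℕ)) (fun y => (c y).deg) y + if (e x : ℕ) < e y then 1 else 0))) •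
        insTwo e m c x y (u (.single (c x) 1)) (u' (.single (c y) 1))

theorem offDiagonal_comm (e : I ≃ Fin (l + 1)) (m : M.obj I) (c : I → PTree P)
    (w w' : Multiset ℕ → k) (u u' : (PTree P →₀ k) →ₗ[k] (PTree P →₀ k)) (x y : I) (h : y ≠ x) :
    offDiagonal e m c w w' u u' x y = - offDiagonal e m c w' w u' u y x := by
  unfold offDiagonal
  rw [insTwo_comm e m c h, ← neg_smul]
  congr 1
  have := numbering_ne e h
  rcases lt_or_gt_of_ne this with h | h
  · rw [if_neg (by omega), if_pos h]; ring
  · rw [if_pos h, if_neg (by omega)]; ring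

theorem childSum_childSum (e : I ≃ Fin (l + 1)) (m : M.obj I) (c : I → PTree P)
    (w w' : Multiset ℕ → k) {u u' : (PTree P →₀ k) →ₗ[k] (PTree P →₀ k)} (hu : PTree.OddOp u) :
    childSum M w' u' (childSum M w u (.single (of e m c) 1)) =
      ∑ x, (w (c x).labels * w' (c x).labels) • ins e m c x (u' (u (.single (c x) 1))) +
      ∑ x, ∑ y : {y // y ≠ x}, offDiagonal e m c w w' u u' x y := by
  rw [childSum_of, map_sum, ← Finset.sum_add_distrib]
  refine Finset.sum_congr rfl fun x _ => ?_
  have hs : ∀ a : ℕ, (-1 : k) ^ a * (-1) ^ a = 1 := fun a => by rw [← mul_pow]; simp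
  rw [map_smul, childSum_ins_of_odd e m c x w' u' (hu _), smul_add, smul_smul, Finset.smul_sum]
  congr 1
  · congr 1
    linear_combination w (c x).labels * w' (c x).labels * hs (l + degBefore _ _ x)
  · refine Finset.sum_congr rfl fun y _ => ?_
    rw [smul_smul, offDiagonal]
    congr 1
    rw [pow_add _ l, pow_add _ l, pow_add _ (degBefore _ _ x)]
    linear_combination w (c x).labels * w' (c y).labels * (-1) ^ (degBefore _ _ x) *
      (-1) ^ (degBefore (fun y => (e y : ℕ)) (fun y => (c y).deg) y +
        if (e x : ℕ) < e y then 1 else 0) * hs l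

theorem childSum_anticomm (e : I ≃ Fin (l + 1)) (m : M.obj I) (c : I → PTree P)
    (w w' : Multiset ℕ → k) {u u' : (PTree P →₀ k) →ₗ[k] (PTree P →₀ k)} (hu : PTree.OddOp u)
    (hu' : PTree.OddOp u') :
    childSum M w' u' (childSum M w u (.single (of e m c) 1)) +
      childSum M w u (childSum M w' u' (.single (of e m c) 1)) =
      ∑ x, (w (c x).labels * w' (c x).labels) • ins e m c x
        ((u' ∘ₗ u + u ∘ₗ u') (.single (c x) 1)) := by
  rw [childSum_childSum e m c w w' hu, childSum_childSum e m c w' w hu']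
  have : ∑ x, ∑ y : {y // y ≠ x}, offDiagonal e m c w w' u u' x y = -
      ∑ x, ∑ y : {y // y ≠ x}, offDiagonal e m c w' w u' u x y := by
    rw [sum_ne_comm, ← Finset.sum_neg_distrib]
    refine Finset.sum_congr rfl fun x _ => ?_
    rw [← Finset.sum_neg_distrib]
    exact Finset.sum_congr rfl fun y _ => offDiagonal_comm _ _ _ _ _ _ _ _ _ y.2.symm
  rw [this]
  simp only [LinearMap.add_apply, LinearMap.comp_apply, map_add, smul_add,
    Finset.sum_add_distrib, mul_comm (w' _)]
  abel

theorem childSum_sq (e : I ≃ Fin (l + 1)) (m : M.obj I) (c : I → PTree P)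
    (w : Multiset ℕ → k) {u : (PTree P →₀ k) →ₗ[k] (PTree P →₀ k)} (hu : PTree.OddOp u) :
    childSum M w u (childSum M w u (.single (of e m c) 1)) =
      ∑ x, (w (c x).labels * w (c x).labels) • ins e m c x (u (u (.single (c x) 1))) := by
  rw [childSum_childSum e m c w w hu, sum_ne_eq_zero, add_zero]
  exact offDiagonal_comm _ _ _ _ _ _ _

end RightModule.Rake
end

section
variable {P : Operad.{u, v} k}

theorem natCast_sub_zmod_two {a n : ℕ} (h : a ≤ n) : ((n - a : ℕ) : ZMod 2) = n + a := by
  rw [Nat.cast_sub h, sub_eq_add_neg, ZMod.neg_eq_self_mod_two]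

theorem neg_one_pow_eq_neg_of_zmod {R : Type*} [Ring R] {a b : ℕ} (h : (a : ZMod 2) = b + 1) :
    (-1 : R) ^ a = -(-1) ^ b := by
  rw [neg_one_pow_congr_zmod (R := R) (b := b + 1) (by simpa using h), pow_succ, mul_neg_one]

theorem planarEquiv_inr {a b : ℕ} (i : Fin (a + 1)) (s : Fin b) :
    (planarEquiv a b i (.inr s) : ℕ) = i + s := rfl

theorem planarEquiv_inl {a b : ℕ} (i : Fin (a + 1)) (j : {j // j ≠ i}) :
    (planarEquiv a b i (.inl j) : ℕ) = if (j : ℕ) < i then (j : ℕ) else j - 1 + b := by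
  simp only [planarEquiv, Equiv.coe_fn_mk]
  split_ifs <;> rfl

namespace RightModule.Rake
variable {M : RightModule P}
variable {I : Type} [Fintype I] [DecidableEq I] {l : ℕ}

theorem rootDelta_ins (e : I ≃ Fin (l + 1)) (m : M.obj I) (c : I → PTree P) (x : I)
    (z : PTree P →₀ k) : rootDelta M (ins e m c x z) = contractMap e m c x z +
      ∑ y : {y // y ≠ x}, Finsupp.linearCombination k
        (fun s => contractAt (M := M) e m (Function.update c x s) y (c y)) z := by
  have h2 : rootDelta M ∘ₗ ins e m c x = contractMap e m c x +
    ∑ y : {y // y ≠ x}, Finsupp.linearCombination k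
      (fun s => contractAt (M := M) e m (Function.update c x s) y (c y)) := by
    ext1 s
    ext1
    simp only [LinearMap.comp_apply, Finsupp.lsingle_apply, ins_single, rootDelta_of,
      LinearMap.add_apply, contractMap_single, LinearMap.sum_apply,
      Finsupp.linearCombination_single, one_smul]
    rw [sum_eq_add_sum_ne _ x, Function.update_self, contractAt_update_self]
    congr 1
    exact Finset.sum_congr rfl fun y _ => by rw [Function.update_of_ne y.2]
  have h3 := LinearMap.congr_fun h2 z
  rwa [LinearMap.add_apply, LinearMap.sum_apply] at h3

/-! ### The square of the differential -/

section Plug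

variable {q : ℕ} (e : I ≃ Fin (l + 1)) (c : I → PTree P) (x : I)
  (d : Fin (q + 2) → PTree P)

/-- The exponent of the sign of a contraction. -/
def contractExp (l q a L : ℕ) : ℕ := l + (l - a) * (q + 1) + q * L

theorem contractExp_cast {l a : ℕ} (q L : ℕ) (h : a ≤ l) :
    (contractExp l q a L : ZMod 2) = l + (l + a) * (q + 1) + q * L := by
  unfold contractExp
  push_cast [natCast_sub_zmod_two h]
  ring

theorem contractAt_node (m : M.obj I) (p : P.obj (Fin (q + 2))) :
    contractAt e m c x (.node q p d) = (-1 : k) ^ contractExp l q (e x)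
      (degBefore (fun y => (e y : ℕ)) (fun y => (c y).deg) x) •
      .single (of (plugNumbering e x (Equiv.refl (Fin (q + 2)))) (M.act x m p)
        (Sum.elim (fun y => c y) d)) 1 := by
  rw [contractAt, Finsupp.smul_single, smul_eq_mul, mul_one]
  rfl

theorem degBefore_plug_inr (b : Fin (q + 2)) :
    degBefore (fun z => (plugNumbering e x (Equiv.refl (Fin (q + 2))) z : ℕ))
      (fun z => (Sum.elim (fun y : {y // y ≠ x} => c y) d z).deg) (.inr b) =
      degBefore (fun y => (e y : ℕ)) (fun y => (c y).deg) x + PTree.leftDeg d b := by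
  rw [degBefore_eq_sum_ne (fun y => (e y : ℕ)), PTree.leftDeg, Finset.sum_filter, degBefore,
    Fintype.sum_sum_type]
  congr 1
  · refine Finset.sum_congr rfl fun y _ => ?_
    have := numbering_ne e y.2
    have := b.2
    simp only [plugNumbering_inl, plugNumbering_inr, Equiv.refl_apply, Sum.elim_inl]
    congr 1
    rw [eq_iff_iff]
    split_ifs <;> omega
  · refine Finset.sum_congr rfl fun y _ => ?_
    simp only [plugNumbering_inr, Equiv.refl_apply, Sum.elim_inr, add_lt_add_iff_left,
      Fin.val_fin_lt]

theorem degBefore_plug_inl {p : P.obj (Fin (q + 2))} (hx : c x = .node q p d)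
    (y : {y // y ≠ x}) :
    degBefore (fun z => (plugNumbering e x (Equiv.refl (Fin (q + 2))) z : ℕ))
      (fun z => (Sum.elim (fun y : {y // y ≠ x} => c y) d z).deg) (.inl y) +
      (if (e x : ℕ) < e y then q else 0) =
      degBefore (fun y => (e y : ℕ)) (fun y => (c y).deg) y := by
  unfold degBefore
  rw [sum_eq_add_sum_ne (fun z => if (e z : ℕ) < e y then (c z).deg else 0) x, hx,
    Fintype.sum_sum_type, PTree.deg]
  have h1 : ∀ z : {z // z ≠ x}, (plugNumbering e x (Equiv.refl (Fin (q + 2))) (.inl z) : ℕ) <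
      plugNumbering e x (Equiv.refl (Fin (q + 2))) (.inl y) ↔ (e z : ℕ) < e y := fun z => by
    have := numbering_ne e y.2
    have := numbering_ne e z.2
    rw [plugNumbering_inl, plugNumbering_inl]
    split_ifs <;> omega
  have h2 : ∀ z : Fin (q + 2), (plugNumbering e x (Equiv.refl (Fin (q + 2))) (.inr z) : ℕ) <
      plugNumbering e x (Equiv.refl (Fin (q + 2))) (.inl y) ↔ (e x : ℕ) < e y := fun z => by
    have := numbering_ne e y.2
    have := z.2
    rw [plugNumbering_inl, plugNumbering_inr, Equiv.refl_apply]
    split_ifs <;> omega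
  simp only [h1, h2, Sum.elim_inl, Sum.elim_inr]
  split_ifs <;> simp [add_comm, add_assoc]

end Plug

/-- Contraction of two edges at the root, in parallel. -/
theorem contract_parallel (e : I ≃ Fin (l + 1)) (m : M.obj I) (c : I → PTree P) {x y : I}
    (hy : y ≠ x) {q q' : ℕ} {p : P.obj (Fin (q + 2))} {p' : P.obj (Fin (q' + 2))}
    {d : Fin (q + 2) → PTree P} {d' : Fin (q' + 2) → PTree P} (hcx : c x = .node q p d)
    (hcy : c y = .node q' p' d') :
    (-1 : k) ^ contractExp l q (e x) (degBefore (fun y => (e y : ℕ)) (fun y => (c y).deg) x) •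
      contractAt (plugNumbering e x (Equiv.refl (Fin (q + 2)))) (M.act x m p)
        (Sum.elim (fun y => c y) d) (.inl ⟨y, hy⟩) (.node q' p' d') =
    - ((-1 : k) ^ contractExp l q' (e y)
        (degBefore (fun y => (e y : ℕ)) (fun y => (c y).deg) y) •
      contractAt (plugNumbering e y (Equiv.refl (Fin (q' + 2)))) (M.act y m p')
        (Sum.elim (fun y => c y) d') (.inl ⟨x, hy.symm⟩) (.node q p d)) := by
  rw [contractAt_node, contractAt_node, smul_smul, smul_smul, ← neg_smul]
  have hex := (e x).2
  have hey := (e y).2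
  have hne := numbering_ne e hy
  have hof : of (plugNumbering (plugNumbering e x (Equiv.refl (Fin (q + 2)))) (.inl ⟨y, hy⟩)
      (Equiv.refl (Fin (q' + 2)))) (M.act (.inl ⟨y, hy⟩) (M.act x m p) p')
        (Sum.elim (fun z => (Sum.elim (fun y : {y // y ≠ x} => c y) d) z) d') =
      of (plugNumbering (plugNumbering e y (Equiv.refl (Fin (q' + 2)))) (.inl ⟨x, hy.symm⟩)
      (Equiv.refl (Fin (q + 2)))) (M.act (.inl ⟨x, hy.symm⟩) (M.act y m p') p)
        (Sum.elim (fun z => (Sum.elim (fun y_1 : {z // z ≠ y} => c y_1) d') z) d) := by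
    refine of_congr (parEquiv (Fin (q + 2)) (Fin (q' + 2)) x y hy) _ _ ?_
      (M.act_par x y hy m p p') ?_
    · rintro (⟨⟨z, hzx⟩ | s, h⟩ | s)
      · have hzy : z ≠ y := fun h' => h (by subst h'; rfl)
        have h1 := numbering_ne e hzx
        have h2 := numbering_ne e hzy
        simp only [parEquiv, Equiv.coe_fn_mk, plugNumbering_inl]
        split_ifs <;> omega
      · have h1 := s.2
        simp only [parEquiv, Equiv.coe_fn_mk, plugNumbering_inl, plugNumbering_inr,
          Equiv.refl_apply]
        split_ifs <;> omega
      · have h1 := s.2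
        simp only [parEquiv, Equiv.coe_fn_mk, plugNumbering_inl, plugNumbering_inr,
          Equiv.refl_apply]
        split_ifs <;> omega
    · rintro (⟨⟨z, hzx⟩ | s, h⟩ | s) <;> rfl
  rw [hof]
  congr 1
  rw [← pow_add, ← pow_add]
  apply neg_one_pow_eq_neg_of_zmod
  have e1 : (plugNumbering e x (Equiv.refl (Fin (q + 2))) (.inl ⟨y, hy⟩) : ℕ) ≤ l + q + 1 := by
    have := (plugNumbering e x (Equiv.refl (Fin (q + 2))) (.inl ⟨y, hy⟩)).2
    omega
  have e2 : (plugNumbering e y (Equiv.refl (Fin (q' + 2))) (.inl ⟨x, hy.symm⟩) : ℕ) ≤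
      l + q' + 1 := by
    have := (plugNumbering e y (Equiv.refl (Fin (q' + 2))) (.inl ⟨x, hy.symm⟩)).2
    omega
  have d1 := degBefore_plug_inl e c x d hcx ⟨y, hy⟩
  have d2 := degBefore_plug_inl e c y d' hcy ⟨x, hy.symm⟩
  have e3 := plugNumbering_inl e x (Equiv.refl (Fin (q + 2))) ⟨y, hy⟩
  have e4 := plugNumbering_inl e y (Equiv.refl (Fin (q' + 2))) ⟨x, hy.symm⟩
  simp only at d1 d2 e3 e4
  rw [Nat.cast_add, Nat.cast_add, contractExp_cast _ _ (by omega),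
    contractExp_cast _ _ e1, contractExp_cast _ _ (by omega), contractExp_cast _ _ e2,
    ← d1, ← d2]
  set L := degBefore (fun z => (plugNumbering e x (Equiv.refl (Fin (q + 2))) z : ℕ))
      (fun z => (Sum.elim (fun y : {y // y ≠ x} => c y) d z).deg) (.inl ⟨y, hy⟩)
  set L' := degBefore (fun z => (plugNumbering e y (Equiv.refl (Fin (q' + 2))) z : ℕ))
      (fun z => (Sum.elim (fun z : {z // z ≠ y} => c z) d' z).deg) (.inl ⟨x, hy.symm⟩)
  rcases lt_or_gt_of_ne hne with h | h
  · rw [if_pos h] at e3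
    rw [if_neg (show ¬ (e x : ℕ) < e y by omega)] at e4
    rw [if_neg (show ¬ (e x : ℕ) < e y by omega), if_pos h, e3, e4]
    push_cast [natCast_sub_zmod_two (show 1 ≤ (e x : ℕ) by omega)]
    generalize (q : ZMod 2) = a, (q' : ZMod 2) = a', (l : ZMod 2) = b,
      (L : ZMod 2) = g, (L' : ZMod 2) = g', ((e x : ℕ) : ZMod 2) = i,
      ((e y : ℕ) : ZMod 2) = i'
    clear * -
    decide +revert
  · rw [if_neg (show ¬ (e y : ℕ) < e x by omega)] at e3
    rw [if_pos h] at e4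
    rw [if_pos h, if_neg (show ¬ (e y : ℕ) < e x by omega), e3, e4]
    push_cast [natCast_sub_zmod_two (show 1 ≤ (e y : ℕ) by omega)]
    generalize (q : ZMod 2) = a, (q' : ZMod 2) = a', (l : ZMod 2) = b,
      (L : ZMod 2) = g, (L' : ZMod 2) = g', ((e x : ℕ) : ZMod 2) = i,
      ((e y : ℕ) : ZMod 2) = i'
    clear * -
    decide +revert

/-- Contraction of an edge at the root and an adjacent edge. -/
theorem contract_sequential (e : I ≃ Fin (l + 1)) (m : M.obj I) (c : I → PTree P) (x : I)
    {q : ℕ} (p : P.obj (Fin (q + 2)))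
    (d : Fin (q + 2) → PTree P) (b : Fin (q + 2)) (t : PTree P) :
    (-1 : k) ^ (l + degBefore (fun y => (e y : ℕ)) (fun y => (c y).deg) x) •
      contractMap e m c x (PTree.contract q p d b t) =
    - ((-1 : k) ^ contractExp l q (e x)
        (degBefore (fun y => (e y : ℕ)) (fun y => (c y).deg) x) •
      contractAt (plugNumbering e x (Equiv.refl (Fin (q + 2)))) (M.act x m p)
        (Sum.elim (fun y => c y) d) (.inr b) t) := by
  cases t with
  | leaf y => simp [PTree.contract, contractAt]
  | node q' p' d' =>
    have hcor : PTree.contract q p d b (.node q' p' d') =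
        (-1 : k) ^ (q + (q + 1 - b.1) * (q' + 1) + q' * PTree.leftDeg d b) •
        .single (PTree.corolla (q := q + 1 + q') (planarEquiv (q + 1) (q' + 2) b) (P.circ b p p')
          (Sum.elim (fun j => d j.1) d')) 1 := by
      rw [Finsupp.smul_single, smul_eq_mul, mul_one]
      rfl
    rw [hcor, map_smul, contractMap_single, contractAt_corolla, contractAt_node]
    have hof : of (plugNumbering (plugNumbering e x (Equiv.refl (Fin (q + 2)))) (.inr b)
        (Equiv.refl (Fin (q' + 2)))) (M.act (.inr b) (M.act x m p) p')
          (Sum.elim (fun z => (Sum.elim (fun y : {y // y ≠ x} => c y) d) z) d') =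
        of (plugNumbering (q := q + 1 + q') e x (planarEquiv (q + 1) (q' + 2) b))
          (M.act x m (P.circ b p p'))
          (Sum.elim (fun y : {y // y ≠ x} => c y) (Sum.elim (fun j : {j // j ≠ b} => d j.1) d')) := by
      have hb := b.2
      refine of_congr (seqEquiv (Fin (q' + 2)) x b) _ _ ?_ (M.act_seq x b m p p') ?_
      · rintro (⟨⟨z, hzx⟩ | ⟨s, hs⟩, h⟩ | s)
        · have h1 := numbering_ne e hzx
          simp only [seqEquiv, Equiv.coe_fn_mk, plugNumbering_inl, plugNumbering_inr,
            Equiv.refl_apply]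
          split_ifs <;> omega
        · have h1 : s ≠ b.1 := fun h' => h (by subst h'; rfl)
          simp only [seqEquiv, Equiv.coe_fn_mk, plugNumbering_inl, plugNumbering_inr,
            Equiv.refl_apply, planarEquiv_inl]
          by_cases hsb : s < (b : ℕ)
          · simp [hsb]
          · simp only [hsb, add_lt_add_iff_left, if_false]
            omega
        · simp only [seqEquiv, Equiv.coe_fn_mk, plugNumbering_inr,
            Equiv.refl_apply, planarEquiv_inr]
          omega
      · rintro (⟨⟨z, hzx⟩ | ⟨s, hs⟩, h⟩ | s) <;> rfl
    rw [hof, Finsupp.smul_single, Finsupp.smul_single, Finsupp.smul_single, Finsupp.smul_single,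
      ← Finsupp.single_neg]
    congr 1
    simp only [smul_eq_mul, mul_one, ← pow_add]
    apply neg_one_pow_eq_neg_of_zmod
    have e1 : (plugNumbering e x (Equiv.refl (Fin (q + 2))) (.inr b) : ℕ) ≤ l + q + 1 := by
      have := (plugNumbering e x (Equiv.refl (Fin (q + 2))) (.inr b)).2
      omega
    have hex := (e x).2
    rw [Nat.cast_add (contractExp _ _ _ _), contractExp_cast _ _ (by omega),
      contractExp_cast _ _ e1, degBefore_plug_inr, plugNumbering_inr]
    push_cast [natCast_sub_zmod_two (show (e x : ℕ) ≤ l by omega),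
      natCast_sub_zmod_two (show (b : ℕ) ≤ q + 1 by omega), Equiv.refl_apply]
    generalize (q : ZMod 2) = a, (q' : ZMod 2) = a', (l : ZMod 2) = g,
      (degBefore (fun y => (e y : ℕ)) (fun y => (c y).deg) x : ZMod 2) = h,
      ((PTree.leftDeg d b : ℕ) : ZMod 2) = h', ((e x : ℕ) : ZMod 2) = i, ((b : ℕ) : ZMod 2) = j
    clear * -
    decide +revert

end RightModule.Rake
end

section
variable {P : Operad.{u, v} k}

/-- An operad as a right module over itself. -/
abbrev Operad.selfModule (P : Operad.{u, v} k) : RightModule P where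
  toCollection := P.toCollection
  act := P.circ
  act_map := P.circ_map
  act_seq := P.circ_seq
  act_par := P.circ_par
  act_one := P.circ_one

/-- Rakes over the operad itself, with at least two inputs at the root, as trees. -/
def PTree.ofSelfRake (P : Operad.{u, v} k) : (P.selfModule.Rake →₀ k) →ₗ[k] (PTree P →₀ k) :=
  Finsupp.linearCombination k fun
    | ⟨0, _⟩ => 0
    | ⟨n + 1, p, c⟩ => .single (.node n p c) 1

/-- A tree whose root is a vertex, as a rake over the operad itself. -/
def PTree.toSelfRake (n : ℕ) (p : P.obj (Fin (n + 2))) (c : Fin (n + 2) → PTree P) :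
    P.selfModule.Rake := ⟨n + 1, p, c⟩

theorem PTree.ofSelfRake_single (n : ℕ) (p : P.obj (Fin (n + 2))) (c : Fin (n + 2) → PTree P)
    (a : k) : ofSelfRake P (.single (toSelfRake n p c) a) = .single (.node n p c) a := by
  rw [ofSelfRake, Finsupp.linearCombination_single, toSelfRake]
  simp

theorem PTree.delta_node (n : ℕ) (p : P.obj (Fin (n + 2))) (c : Fin (n + 2) → PTree P) :
    delta (node n p c) =
      - ofSelfRake P (RightModule.Rake.deltaMap _ (.single (toSelfRake n p c) 1)) := by
  rw [RightModule.Rake.deltaMap, Finsupp.linearCombination_single, one_smul, toSelfRake,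
    RightModule.Rake.delta, delta, map_sum, ← Finset.sum_neg_distrib]
  refine Finset.sum_congr rfl fun i _ => ?_
  rw [map_add, neg_add]
  congr 1
  · simp only
    cases c i with
    | leaf x => simp [contract, RightModule.Rake.contract]
    | node q p' d =>
      change contract n p c i (.node q p' d) = -(ofSelfRake P (.single (toSelfRake (n + 1 + q)
        (P.pcirc (a := n + 1) (b := q + 2) i p p') (splice (a := n + 1) (b := q + 2) c i d))
        ((-1) ^ (n + 1 + (n + 1 - i.1) * (q + 1) + q * leftDeg c i))))
      rw [contract, ofSelfRake_single, ← Finsupp.single_neg]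
      congr 1
      ring
  · simp only [map_smul]
    rw [← neg_smul]
    congr 1
    · ring
    · rw [← Finsupp.lmapDomain_apply k k, ← Finsupp.lmapDomain_apply k k,
        ← LinearMap.comp_apply]
      congr 1
      ext1 s
      ext1
      simp only [LinearMap.comp_apply, Finsupp.lsingle_apply, Finsupp.lmapDomain_apply,
        Finsupp.mapDomain_single]
      exact (ofSelfRake_single n p (Function.update c i s) 1).symm

namespace RightModule.Rake
variable {M : RightModule P}
variable {I : Type} [Fintype I] [DecidableEq I] {l : ℕ}

/-! ### Labels and degrees in a differential -/

theorem mem_support_contractAt (e : I ≃ Fin (l + 1)) (m : M.obj I) (c : I → PTree P) (x : I)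
    {t : M.Rake} (ht : t ∈ (contractAt e m c x (c x)).support) :
    t.labels = ∑ y, (c y).labels ∧ t.deg = l + ∑ y, (c y).deg + 1 ∧ l ≤ t.1 := by
  cases hx : c x with
  | leaf y => simp [hx, contractAt] at ht
  | node q p d =>
    rw [hx, contractAt] at ht
    rw [Finset.mem_singleton.1 (Finsupp.support_single_subset ht), labels_of, deg_of,
      sum_eq_add_sum_ne _ x, sum_eq_add_sum_ne (fun y => (c y).deg) x, hx, Fintype.sum_sum_type,
      Fintype.sum_sum_type, PTree.labels, PTree.deg]
    refine ⟨add_comm _ _, ?_, ?_⟩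
    · simp only [Sum.elim_inl, Sum.elim_inr]; ring
    · simp only [of]; omega

theorem mem_support_ins (e : I ≃ Fin (l + 1)) (m : M.obj I) (c : I → PTree P) (x : I)
    {z : PTree P →₀ k} {t : M.Rake} (ht : t ∈ (ins e m c x z).support) :
    ∃ s ∈ z.support, t = of e m (Function.update c x s) := by
  classical
  obtain ⟨s, hs, h⟩ := Finset.mem_image.1 (Finsupp.mapDomain_support ht)
  exact ⟨s, hs, h.symm⟩

theorem labels_of_update (e : I ≃ Fin (l + 1)) (m : M.obj I) (c : I → PTree P) (x : I)
    (s : PTree P) : (of e m (Function.update c x s)).labels =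
      s.labels + ∑ y : {y // y ≠ x}, (c y).labels := by
  rw [labels_of, sum_eq_add_sum_ne _ x, Function.update_self]
  congr 1
  exact Finset.sum_congr rfl fun j _ => by rw [Function.update_of_ne j.2]

theorem deg_of_update (e : I ≃ Fin (l + 1)) (m : M.obj I) (c : I → PTree P) (x : I)
    (s : PTree P) : (of e m (Function.update c x s)).deg =
      l + (s.deg + ∑ y : {y // y ≠ x}, (c y).deg) := by
  rw [deg_of, sum_eq_add_sum_ne _ x, Function.update_self]
  congr 2
  exact Finset.sum_congr rfl fun j _ => by rw [Function.update_of_ne j.2]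

theorem mem_support_deltaMap (e : I ≃ Fin (l + 1)) (m : M.obj I) (c : I → PTree P)
    (h : ∀ x, ∀ s ∈ (PTree.delta (c x)).support,
      s.labels = (c x).labels ∧ s.deg = (c x).deg + 1)
    {t : M.Rake} (ht : t ∈ (deltaMap M (.single (of e m c) 1)).support) :
    t.labels = (of e m c).labels ∧ t.deg = (of e m c).deg + 1 ∧ l ≤ t.1 := by
  classical
  rw [deltaMap_eq, LinearMap.add_apply, rootDelta_of, childSum_of, labels_of, deg_of] at *
  rcases Finset.mem_union.1 (Finsupp.support_add ht) with ht | ht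
  · obtain ⟨x, -, hx⟩ := Finset.mem_biUnion.1 (Finsupp.support_finsetSum ht)
    exact mem_support_contractAt e m c x hx
  · obtain ⟨x, -, hx⟩ := Finset.mem_biUnion.1 (Finsupp.support_finsetSum ht)
    obtain ⟨s, hs, rfl⟩ := mem_support_ins e m c x (Finsupp.support_smul hx)
    rw [PTree.deltaMap_single] at hs
    obtain ⟨h1, h2⟩ := h x s hs
    rw [labels_of_update, deg_of_update, h1, h2, sum_eq_add_sum_ne _ x,
      sum_eq_add_sum_ne (fun y => (c y).deg) x]
    exact ⟨rfl, by ring, le_rfl⟩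

/-- The square of the differential vanishes on a rake if it vanishes on all children. -/
theorem deltaMap_deltaMap_of (hodd : PTree.OddOp (PTree.deltaMap P)) (e : I ≃ Fin (l + 1))
    (m : M.obj I) (c : I → PTree P)
    (h : ∀ x, PTree.deltaMap P (PTree.delta (c x)) = 0) :
    deltaMap M (deltaMap M (.single (of e m c) 1)) = 0 := by
  set D := childSum M (fun _ => 1) (PTree.deltaMap P) with hD
  have hDD : D (D (.single (of e m c) 1)) = 0 := by
    rw [hD, childSum_sq e m c _ hodd]
    refine Finset.sum_eq_zero fun x _ => ?_
    rw [PTree.deltaMap_single, h, map_zero, smul_zero]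
  set s : I → k := fun x => (-1) ^ (l + degBefore (fun y => (e y : ℕ)) (fun y => (c y).deg) x)
    with hs
  -- the terms where edges at two different children are involved
  set X : I → I → (M.Rake →₀ k) := fun x y => match c x with
    | .leaf _ => 0
    | .node q p d => if hy : y ≠ x then
      (-1 : k) ^ contractExp l q (e x) (degBefore (fun y => (e y : ℕ)) (fun y => (c y).deg) x) •
      contractAt (plugNumbering e x (Equiv.refl (Fin (q + 2)))) (M.act x m p)
        (Sum.elim (fun y => c y) d) (.inl ⟨y, hy⟩) (c y) else 0 with hX
  set Y : I → I → (M.Rake →₀ k) := fun x y => s y • Finsupp.linearCombination k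
        (fun t => contractAt (M := M) e m (Function.update c y t) x (c x))
        (PTree.delta (c y)) with hY
  have h1 : rootDelta M (D (.single (of e m c) 1)) =
      ∑ x, s x • contractMap e m c x (PTree.delta (c x)) +
        ∑ x, ∑ y : {y // y ≠ x}, Y x y := by
    rw [sum_ne_comm, hD, childSum_of, map_sum, ← Finset.sum_add_distrib]
    refine Finset.sum_congr rfl fun x _ => ?_
    rw [map_smul, PTree.deltaMap_single, rootDelta_ins, smul_add, one_mul, Finset.smul_sum]
  have h2 : ∀ x, rootDelta M (contractAt e m c x (c x)) + D (contractAt e m c x (c x)) =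
      - (s x • contractMap e m c x (PTree.delta (c x))) +
      ∑ y : {y // y ≠ x}, (X x y - Y x y) := by
    intro x
    cases hx : c x with
    | leaf y => simp [hX, hY, hx, contractAt, PTree.delta, Finsupp.linearCombination_apply]
    | node q p d =>
      rw [contractAt_node, map_smul, map_smul, hD, rootDelta_of, childSum_of,
        Fintype.sum_sum_type, Fintype.sum_sum_type, smul_add, smul_add]
      have hXY : ∀ y : {y // y ≠ x}, X x y - Y x y =
          (-1 : k) ^ contractExp l q (e x)
            (degBefore (fun y => (e y : ℕ)) (fun y => (c y).deg) x) •
          (contractAt (plugNumbering e x (Equiv.refl (Fin (q + 2)))) (M.act x m p)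
            (Sum.elim (fun y => c y) d) (.inl y) (c y) +
          (1 * (-1 : k) ^ (l + q + 1 + degBefore
            (fun z => (plugNumbering e x (Equiv.refl (Fin (q + 2))) z : ℕ))
            (fun z => (Sum.elim (fun y : {y // y ≠ x} => c y) d z).deg) (.inl y))) •
          ins (plugNumbering e x (Equiv.refl (Fin (q + 2)))) (M.act x m p)
            (Sum.elim (fun y => c y) d) (.inl y) (PTree.deltaMap P (.single (c y) 1))) := by
        intro y
        rw [smul_add, sub_eq_add_neg]
        congr 1
        · simp only [hX, hx]
          rw [dif_pos y.2]
        · simp only [hY, hs, hx]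
          rw [PTree.deltaMap_single, ← neg_smul, ← LinearMap.smul_apply, ← LinearMap.smul_apply,
            ← LinearMap.smul_apply]
          refine linearMap_congr_support fun t ht => ?_
          have ht2 := (hodd (c y) t (by rwa [PTree.deltaMap_single])).2
          rw [LinearMap.smul_apply, LinearMap.smul_apply, LinearMap.smul_apply, ins_single,
            Finsupp.linearCombination_single, one_smul, contractAt_node,
            elim_update_inl y.2, smul_smul, smul_smul]
          congr 1
          have hpar := degBefore_update_parity (k := k) (fun y => (e y : ℕ)) c (y := x) ht2
          have hexp : ∀ L L' : ℕ, (-1 : k) ^ L = (-1) ^ L' →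
              (-1 : k) ^ contractExp l q (e x) L = (-1) ^ contractExp l q (e x) L' := by
            intro L L' hL
            unfold contractExp
            rw [pow_add, pow_add _ _ (q * L'), mul_comm q L, mul_comm q L', pow_mul _ L,
              pow_mul _ L', hL]
          rw [hexp _ _ hpar, one_mul, neg_mul, ← pow_add, ← pow_add, neg_eq_iff_eq_neg]
          apply neg_one_pow_eq_neg_of_zmod
          have d1 := degBefore_plug_inl e c x d hx y
          have := (e x).2
          rw [Nat.cast_add, Nat.cast_add (contractExp _ _ _ _), contractExp_cast _ _ (by omega),
            contractExp_cast _ _ (by omega), ← d1]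
          rcases lt_or_gt_of_ne (numbering_ne e y.2) with h | h
          · rw [if_neg (show ¬ (e x : ℕ) < e y by omega),
              if_pos (show (e y : ℕ) < e x by omega)]
            push_cast
            generalize (q : ZMod 2) = a, (l : ZMod 2) = b, ((e x : ℕ) : ZMod 2) = i,
              (degBefore (fun y => (e y : ℕ)) (fun y => (c y).deg) x : ZMod 2) = g,
              (degBefore (fun z => (plugNumbering e x (Equiv.refl (Fin (q + 2))) z : ℕ))
                (fun z => (Sum.elim (fun y : {y // y ≠ x} => c y) d z).deg)
                (.inl y) : ZMod 2) = g'
            clear * -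
            decide +revert
          · rw [if_pos (show (e x : ℕ) < e y by omega),
              if_neg (show ¬ (e y : ℕ) < e x by omega)]
            push_cast
            generalize (q : ZMod 2) = a, (l : ZMod 2) = b, ((e x : ℕ) : ZMod 2) = i,
              (degBefore (fun y => (e y : ℕ)) (fun y => (c y).deg) x : ZMod 2) = g,
              (degBefore (fun z => (plugNumbering e x (Equiv.refl (Fin (q + 2))) z : ℕ))
                (fun z => (Sum.elim (fun y : {y // y ≠ x} => c y) d z).deg)
                (.inl y) : ZMod 2) = g'
            clear * -
            decide +revert
      have hseq : - (s x • contractMap e m c x (PTree.delta (.node q p d))) =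
          ∑ b, ((-1 : k) ^ contractExp l q (e x)
            (degBefore (fun y => (e y : ℕ)) (fun y => (c y).deg) x) •
          (contractAt (plugNumbering e x (Equiv.refl (Fin (q + 2)))) (M.act x m p)
            (Sum.elim (fun y => c y) d) (.inr b) (d b) +
          (1 * (-1 : k) ^ (l + q + 1 + degBefore
            (fun z => (plugNumbering e x (Equiv.refl (Fin (q + 2))) z : ℕ))
            (fun z => (Sum.elim (fun y : {y // y ≠ x} => c y) d z).deg) (.inr b))) •
          ins (plugNumbering e x (Equiv.refl (Fin (q + 2)))) (M.act x m p)
            (Sum.elim (fun y => c y) d) (.inr b) (PTree.deltaMap P (.single (d b) 1)))) := by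
        rw [PTree.delta, map_sum, Finset.smul_sum, ← Finset.sum_neg_distrib]
        refine Finset.sum_congr rfl fun b _ => ?_
        rw [map_add, smul_add, smul_add, neg_add, hs, contract_sequential, neg_neg]
        congr 1
        rw [map_smul, smul_smul, smul_smul, ← Finsupp.lmapDomain_apply k k,
          PTree.deltaMap_single, ← LinearMap.comp_apply, ← neg_smul, ← LinearMap.smul_apply,
          ← LinearMap.smul_apply]
        congr 1
        ext1 t
        ext1
        simp only [LinearMap.comp_apply, LinearMap.smul_apply, Finsupp.lsingle_apply,
          Finsupp.lmapDomain_apply, Finsupp.mapDomain_single, contractMap_single, ins_single,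
          contractAt_node, elim_update_inr, smul_smul]
        congr 1
        rw [one_mul, ← pow_add, ← pow_add, neg_mul, ← pow_add, neg_eq_iff_eq_neg]
        apply neg_one_pow_eq_neg_of_zmod
        rw [degBefore_plug_inr]
        push_cast
        generalize (q : ZMod 2) = a, (l : ZMod 2) = b,
          (degBefore (fun y => (e y : ℕ)) (fun y => (c y).deg) x : ZMod 2) = g,
          (PTree.leftDeg d b : ZMod 2) = g', (contractExp l q (e x)
            (degBefore (fun y => (e y : ℕ)) (fun y => (c y).deg) x) : ZMod 2) = i
        clear * -
        decide +revert
      rw [hseq]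
      simp only [hXY, smul_add, Finset.sum_add_distrib, Finset.smul_sum, Sum.elim_inl,
        Sum.elim_inr]
      abel
  have hXX : ∑ x, ∑ y : {y // y ≠ x}, X x y = 0 := by
    refine sum_ne_eq_zero _ fun x y hy => ?_
    simp only [hX]
    cases hcx : c x with
    | leaf a =>
      cases hcy : c y with
      | leaf b => simp
      | node q' p' d' => simp [contractAt]
    | node q p d =>
      cases hcy : c y with
      | leaf b => simp [contractAt]
      | node q' p' d' =>
        simp only [dif_pos hy, dif_pos hy.symm]
        exact contract_parallel e m c hy hcx hcy
  have h3 : rootDelta M (rootDelta M (.single (of e m c) 1)) +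
      D (rootDelta M (.single (of e m c) 1)) =
      - ∑ x, s x • contractMap e m c x (PTree.delta (c x)) -
        ∑ x, ∑ y : {y // y ≠ x}, Y x y := by
    rw [rootDelta_of, map_sum, map_sum, ← Finset.sum_add_distrib, Finset.sum_congr rfl fun x _ =>
      h2 x]
    simp only [Finset.sum_add_distrib, Finset.sum_sub_distrib, hXX, Finset.sum_neg_distrib]
    abel
  rw [deltaMap_eq]
  simp only [LinearMap.add_apply, map_add]
  rw [← hD, hDD, h1, add_zero]
  calc _ = (rootDelta M (rootDelta M (.single (of e m c) 1)) +
      D (rootDelta M (.single (of e m c) 1))) +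
      (∑ x, s x • contractMap e m c x (PTree.delta (c x)) +
        ∑ x, ∑ y : {y // y ≠ x}, Y x y) := by abel
    _ = 0 := by rw [h3]; abel

end RightModule.Rake
end

section
variable {P : Operad.{u, v} k}

/-! ### The differential of trees and rakes -/

theorem PTree.toSelfRake_eq (n : ℕ) (p : P.obj (Fin (n + 2))) (c : Fin (n + 2) → PTree P) :
    toSelfRake n p c = RightModule.Rake.of (Equiv.refl _) p c :=
  (RightModule.Rake.of_refl (M := P.selfModule) p c).symm

theorem PTree.mem_support_delta (t : PTree P) :
    ∀ s ∈ (delta t).support, s.labels = t.labels ∧ s.deg = t.deg + 1 := by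
  classical
  induction t with
  | leaf x => simp [delta]
  | node n p c ih =>
    intro s hs
    rw [delta_node, Finsupp.support_neg, ofSelfRake, Finsupp.linearCombination_apply,
      Finsupp.sum] at hs
    obtain ⟨r, hr, hs⟩ := Finset.mem_biUnion.1 (Finsupp.support_finsetSum hs)
    have hs := Finsupp.support_smul hs
    rw [toSelfRake_eq] at hr
    obtain ⟨h1, h2, h3⟩ := RightModule.Rake.mem_support_deltaMap _ _ c ih hr
    match r, h1, h2, h3, hs with
    | ⟨l + 1, p', c'⟩, h1, h2, _, hs =>
      rw [Finset.mem_singleton.1 (Finsupp.support_single_subset hs)]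
      rw [RightModule.Rake.labels_of] at h1
      rw [RightModule.Rake.deg_of] at h2
      refine ⟨h1, ?_⟩
      have : l + 1 + ∑ i, (c' i).deg = n + 1 + ∑ i, (c i).deg + 1 := h2
      show l + ∑ i, (c' i).deg = n + ∑ i, (c i).deg + 1
      omega

theorem PTree.oddOp_deltaMap : OddOp (deltaMap P) := fun t s hs => by
  rw [deltaMap_single] at hs
  obtain ⟨h1, h2⟩ := mem_support_delta t s hs
  exact ⟨h1, by rw [h2]; exact ⟨t.deg, by ring⟩⟩

theorem PTree.deltaMap_delta (t : PTree P) : deltaMap P (delta t) = 0 := by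
  induction t with
  | leaf x => simp [delta]
  | node n p c ih =>
    have h0 := RightModule.Rake.deltaMap_deltaMap_of (M := P.selfModule) oddOp_deltaMap
      (Equiv.refl _) p c ih
    rw [← toSelfRake_eq] at h0
    have h1 : ∀ r ∈ (RightModule.Rake.deltaMap _ (.single (toSelfRake n p c) 1)).support,
        n + 1 ≤ r.1 := fun r hr => by
      rw [toSelfRake_eq] at hr
      exact (RightModule.Rake.mem_support_deltaMap _ _ c (fun i => mem_support_delta (c i)) hr).2.2
    rw [delta_node, map_neg, neg_eq_zero]
    generalize RightModule.Rake.deltaMap _ (.single (toSelfRake n p c) 1) = z at h0 h1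
    have : (deltaMap P ∘ₗ ofSelfRake P) z =
        (-(ofSelfRake P ∘ₗ RightModule.Rake.deltaMap _)) z := by
      refine linearMap_congr_support fun r hr => ?_
      match r, h1 r hr with
      | ⟨l + 1, p', c'⟩, _ =>
        rw [LinearMap.comp_apply, LinearMap.neg_apply, LinearMap.comp_apply]
        change deltaMap P (ofSelfRake P (.single (toSelfRake l p' c') 1)) = _
        rw [ofSelfRake_single, deltaMap_single, delta_node]
        rfl
    rw [LinearMap.comp_apply] at this
    rw [this, LinearMap.neg_apply, LinearMap.comp_apply, h0, map_zero, neg_zero]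

theorem PTree.ofSelfRake_mem {z : P.selfModule.Rake →₀ k}
    (hz : z ∈ RightModule.Rake.relSpan P.selfModule) : ofSelfRake P z ∈ relSpan P := by
  have : RightModule.Rake.relSpan P.selfModule ≤ (relSpan P).comap (ofSelfRake P) := by
    refine Submodule.span_le.2 fun z hz => ?_
    have h0 : ∀ (x : P.selfModule.obj (Fin 1) × (Fin 1 → PTree P)) (a : k),
        ofSelfRake P (.single ⟨0, x⟩ a) = 0 := fun x a => by simp [ofSelfRake]
    show ofSelfRake P z ∈ relSpan P
    cases hz with
    | add l m m' c =>
      cases l with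
      | zero => simp [h0]
      | succ n =>
        simp only [map_sub]
        change ofSelfRake P (.single (toSelfRake n _ c) 1) -
          ofSelfRake P (.single (toSelfRake n m c) 1) -
          ofSelfRake P (.single (toSelfRake n m' c) 1) ∈ _
        simp only [ofSelfRake_single]
        exact Submodule.subset_span (Rel.add n m m' c)
    | smul l a m c =>
      cases l with
      | zero => simp [h0]
      | succ n =>
        simp only [map_sub]
        change ofSelfRake P (.single (toSelfRake n _ c) 1) -
          ofSelfRake P (.single (toSelfRake n m c) a) ∈ _
        simp only [ofSelfRake_single]
        exact Submodule.subset_span (Rel.smul n a m c)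
    | perm l σ m c =>
      cases l with
      | zero => simp [h0]
      | succ n =>
        simp only [map_sub]
        change ofSelfRake P (.single (toSelfRake n _ (c ∘ σ.symm)) 1) -
          ofSelfRake P (.single (toSelfRake n m c) _) ∈ _
        simp only [ofSelfRake_single]
        exact Submodule.subset_span (Rel.perm n σ m c)
    | child l m c i x hx =>
      cases l with
      | zero =>
        have : ofSelfRake P ∘ₗ Finsupp.lmapDomain k k
            (fun s => (⟨0, m, Function.update c i s⟩ : P.selfModule.Rake)) = 0 := by
          ext1 s
          ext1
          simp [h0]
        have h := LinearMap.congr_fun this x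
        rw [LinearMap.comp_apply, LinearMap.zero_apply] at h
        refine Set.mem_of_eq_of_mem h ?_
        exact zero_mem (relSpan P)
      | succ n =>
        have : ofSelfRake P ∘ₗ Finsupp.lmapDomain k k
            (fun s => (toSelfRake n m (Function.update c i s))) =
            Finsupp.lmapDomain k k fun s => node n m (Function.update c i s) := by
          ext1 s
          ext1
          simp [ofSelfRake_single]
        have h := LinearMap.congr_fun this x
        rw [LinearMap.comp_apply] at h
        refine Set.mem_of_eq_of_mem h ?_
        exact Submodule.subset_span (Rel.child n m c i x hx)
  exact this hz

theorem PTree.deltaMap_rel {x : PTree P →₀ k} (h : Rel x) : deltaMap P x ∈ relSpan P := by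
  have key : ∀ (y : P.selfModule.Rake →₀ k), RightModule.Rake.Rel y →
      RightModule.Rake.cl _ (RightModule.Rake.childSum _ (fun _ => 1) (deltaMap P) y) = 0 →
      ofSelfRake P (RightModule.Rake.deltaMap _ y) ∈ relSpan P := fun y hy hy' => by
    apply ofSelfRake_mem
    rw [← Submodule.Quotient.mk_eq_zero, ← Submodule.mkQ_apply, RightModule.Rake.deltaMap_eq,
      LinearMap.add_apply, map_add, hy', RightModule.Rake.cl_rootDelta (Submodule.subset_span hy),
      zero_add]
  have sm : ∀ n (p : P.obj (Fin (n + 2))) c (a : k), deltaMap P (.single (node n p c) a) =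
      - ofSelfRake P (RightModule.Rake.deltaMap _ (.single (toSelfRake n p c) a)) := by
    intro n p c a
    rw [← mul_one a, ← smul_eq_mul, ← Finsupp.smul_single, map_smul, deltaMap_single, delta_node,
      ← Finsupp.smul_single, map_smul, map_smul, smul_neg]
  have key₁ : ∀ n (p : P.obj (Fin (n + 2))) c n' (p' : P.obj (Fin (n' + 2))) c' (a : k),
      RightModule.Rake.Rel (M := P.selfModule)
        (.single (toSelfRake n p c) 1 - .single (toSelfRake n' p' c') a) →
      RightModule.Rake.cl _ (RightModule.Rake.childSum _ (fun _ => 1) (deltaMap P)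
        (.single (toSelfRake n p c) 1 - .single (toSelfRake n' p' c') a)) = 0 →
      deltaMap P (.single (node n p c) 1 - .single (node n' p' c') a) ∈ relSpan P := by
    intro n p c n' p' c' a h1 h2
    have := key _ h1 h2
    rw [map_sub, map_sub] at this
    rw [map_sub, sm, sm, ← neg_mem_iff]
    convert this using 1
    abel
  induction h with
  | add n p p' c =>
    have h1 := RightModule.Rake.Rel.add (M := P.selfModule) (n + 1) p p' c
    have h2 := RightModule.Rake.cl_childSum_add (M := P.selfModule) (fun _ => 1) (deltaMap P)
      (n + 1) p p' c
    have := key _ h1 h2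
    rw [map_sub, map_sub, map_sub, map_sub] at this
    rw [map_sub, map_sub, sm, sm, sm, ← neg_mem_iff]
    refine Set.mem_of_eq_of_mem ?_ this
    simp only [toSelfRake]
    abel
  | smul n a p c =>
    have h1 := RightModule.Rake.Rel.smul (M := P.selfModule) (n + 1) a p c
    have h2 := RightModule.Rake.cl_childSum_smul (M := P.selfModule) (fun _ => 1) (deltaMap P)
      (n + 1) a p c
    exact key₁ n (a • p) c n p c a h1 h2
  | perm n σ p c =>
    have h1 := RightModule.Rake.Rel.perm (M := P.selfModule) (n + 1) σ p c
    have h2 := RightModule.Rake.cl_childSum_perm (M := P.selfModule) (fun _ => 1)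
      oddOp_deltaMap (n + 1) σ p c
    exact key₁ n (P.map σ p) (c ∘ σ.symm) n p c _ h1 h2
  | child n p c i x hx ih =>
    have h1 := RightModule.Rake.Rel.child (M := P.selfModule) (n + 1) p c i x hx
    have h2 := RightModule.Rake.cl_childSum_child (M := P.selfModule) (fun _ => 1)
      (n + 1) p c i hx ih
    have h3 := key _ h1 h2
    have h4 : -(deltaMap P ∘ₗ Finsupp.lmapDomain k k (fun t => node n p (Function.update c i t))) =
        ofSelfRake P ∘ₗ RightModule.Rake.deltaMap P.selfModule ∘ₗ Finsupp.lmapDomain k k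
          (fun s => toSelfRake n p (Function.update c i s)) := by
      ext1 t
      ext1
      simp only [LinearMap.neg_apply, LinearMap.comp_apply, Finsupp.lsingle_apply,
        Finsupp.lmapDomain_apply, Finsupp.mapDomain_single, sm, neg_neg]
    rw [← neg_mem_iff]
    exact Set.mem_of_eq_of_mem (LinearMap.congr_fun h4 x) h3

theorem PTree.deltaMap_mem {x : PTree P →₀ k} (h : x ∈ relSpan P) : deltaMap P x ∈ relSpan P :=
  (Submodule.span_le.2 fun _ hz => deltaMap_rel hz : relSpan P ≤ (relSpan P).comap (deltaMap P)) h

namespace RightModule.Rake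
variable {M : RightModule P}

theorem cl_deltaMap {x : M.Rake →₀ k} (h : x ∈ relSpan M) : cl M (deltaMap M x) = 0 := by
  rw [deltaMap_eq, LinearMap.add_apply, map_add, cl_rootDelta h,
    cl_childSum _ PTree.oddOp_deltaMap (fun _ => PTree.deltaMap_rel) h, zero_add]

theorem eq_of_refl (t : M.Rake) : t = of (Equiv.refl _) t.2.1 t.2.2 := (of_refl _ _).symm

theorem deltaMap_single (t : M.Rake) : deltaMap M (.single t 1) = delta t := by simp [deltaMap]

theorem mem_support_delta (t : M.Rake) : ∀ s ∈ (delta t).support,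
    s.labels = t.labels ∧ s.deg = t.deg + 1 ∧ t.1 ≤ s.1 := fun s hs => by
  rw [← deltaMap_single, eq_of_refl t] at hs
  have := mem_support_deltaMap _ _ _ (fun i => PTree.mem_support_delta _) hs
  rwa [← eq_of_refl] at this

theorem deltaMap_deltaMap : deltaMap M ∘ₗ deltaMap M = 0 := by
  ext1 t
  ext1
  simp only [LinearMap.comp_apply, Finsupp.lsingle_apply, LinearMap.zero_apply]
  rw [eq_of_refl t]
  exact deltaMap_deltaMap_of PTree.oddOp_deltaMap _ _ _ fun i => PTree.deltaMap_delta _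

end RightModule.Rake

/-! ### Linear labellings -/

theorem injective_and_range_iff {X : Type} [Fintype X] (f : X → ℕ) (A : Finset ℕ) :
    (Function.Injective f ∧ Set.range f = (A : Set ℕ)) ↔
      (Finset.univ.val.map f : Multiset ℕ) = A.val := by
  constructor
  · rintro ⟨h1, h2⟩
    rw [Multiset.Nodup.ext (Finset.univ.nodup.map h1) A.nodup]
    intro a
    rw [Finset.mem_val, ← Finset.mem_coe, ← h2]
    simp
  · intro h
    refine ⟨fun x y hxy => ?_, ?_⟩
    · have h1 : (Finset.univ.val.map f).Nodup := h ▸ A.nodup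
      exact Multiset.inj_on_of_nodup_map h1 x (Finset.mem_univ_val x) y (Finset.mem_univ_val y) hxy
    · ext a
      rw [Finset.mem_coe, ← Finset.mem_val, ← h]
      simp

theorem univ_val_map_sum {X Y : Type} [Fintype X] [Fintype Y] (f : X ⊕ Y → ℕ) :
    Finset.univ.val.map f = Finset.univ.val.map (f ∘ Sum.inl) +
      (Finset.univ.val.map (f ∘ Sum.inr) : Multiset ℕ) := by
  rw [← Finset.univ_disjSum_univ, Finset.val_disjSum, Multiset.disjSum, Multiset.map_add,
    Multiset.map_map, Multiset.map_map]

theorem univ_val_map_sigma {n : ℕ} {X : Fin n → Type} [∀ i, Fintype (X i)]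
    (f : (Σ i, X i) → ℕ) :
    Finset.univ.val.map f = ∑ i, (Finset.univ.val.map fun x => f ⟨i, x⟩ : Multiset ℕ) := by
  rw [← Finset.univ_sigma_univ]
  change Multiset.map f (Multiset.bind Finset.univ.val fun i => Finset.univ.val.map (Sigma.mk i)) = _
  rw [Multiset.map_bind]
  simp only [Multiset.map_map]
  rfl

theorem univ_val_map_congr {X : Type} (i₁ i₂ : Fintype X) (f : X → ℕ) :
    (@Finset.univ X i₁).val.map f = (@Finset.univ X i₂).val.map f := by
  rw [Subsingleton.elim i₁ i₂]

instance PTree.instFiniteLeaf : (t : PTree P) → Finite t.Leaf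
  | .leaf _ => inferInstanceAs (Finite Unit)
  | .node _ _ c =>
    haveI := fun i => instFiniteLeaf (c i)
    inferInstanceAs (Finite (Σ i, (c i).Leaf))

instance PTree.instFintypeLeaf (t : PTree P) : Fintype t.Leaf := Fintype.ofFinite _

theorem PTree.map_label (t : PTree P) : Finset.univ.val.map t.label = t.labels := by
  induction t with
  | leaf x => exact univ_val_map_congr (X := Unit) _ inferInstance _
  | node n p c ih =>
    rw [labels, ← Finset.sum_congr rfl fun i _ => ih i, ← univ_val_map_sigma
      (fun x : (Σ i, (c i).Leaf) => (c x.1).label x.2)]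
    exact univ_val_map_congr (X := Σ i, (c i).Leaf) _ _ _

theorem PTree.linear_iff (t : PTree P) (A : Finset ℕ) : t.Linear A ↔ t.labels = A.val := by
  rw [← map_label, ← injective_and_range_iff]; rfl

theorem RightModule.Rake.linear_iff {M : RightModule P} (t : M.Rake) (A : Finset ℕ) :
    t.Linear A ↔ t.labels = A.val := by
  unfold labels
  simp only [← PTree.map_label]
  rw [← univ_val_map_sigma (fun x : (Σ i, (t.2.2 i).Leaf) => (t.2.2 x.1).label x.2),
    ← injective_and_range_iff]
  rfl

namespace BTree
variable {E : Type v}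

/-- The labels of all leaves. -/
def labels : BTree E → Multiset ℕ
  | leaf x => {x}
  | node _ l r => l.labels + r.labels

instance instFintypeLeaf (t : BTree E) : Fintype t.Leaf := Fintype.ofFinite _

theorem map_label (t : BTree E) : Finset.univ.val.map t.label = t.labels := by
  induction t with
  | leaf x => exact univ_val_map_congr (X := Unit) _ inferInstance _
  | node e l r ihl ihr =>
    rw [labels, ← ihl, ← ihr]
    rw [show Finset.univ.val.map l.label = Finset.univ.val.map
      ((Sum.elim l.label r.label) ∘ Sum.inl) from rfl,
      show Finset.univ.val.map r.label = Finset.univ.val.map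
      ((Sum.elim l.label r.label) ∘ Sum.inr) from rfl, ← univ_val_map_sum]
    exact univ_val_map_congr (X := l.Leaf ⊕ r.Leaf) _ _ _

theorem linear_iff (t : BTree E) (A : Finset ℕ) : t.Linear A ↔ t.labels = A.val := by
  rw [← map_label, ← injective_and_range_iff]; rfl

theorem familyLinear_iff {n : ℕ} (c : Fin n → BTree E) (A : Finset ℕ) :
    FamilyLinear A c ↔ ∑ i, (c i).labels = A.val := by
  simp only [← map_label]
  rw [← univ_val_map_sigma (fun x : (Σ i, (c i).Leaf) => (c x.1).label x.2),
    ← injective_and_range_iff]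
  rfl

end BTree

/-! ### The cobar construction of a module is a filtered complex -/

namespace RightModule
variable {M : RightModule P}

theorem cobar_D_apply (A : Finset ℕ) (f : Module.Dual k (M.Rake →₀ k)) (x : M.Rake →₀ k) :
    (M.cobar A).D f x = f (Rake.deltaMap M x) := rfl

theorem apply_eq_zero_of_support {α : Type*} {f : Module.Dual k (α →₀ k)} {x : α →₀ k}
    (h : ∀ t ∈ x.support, f (.single t 1) = 0) : f x = 0 :=
  linearMap_congr_support (f := f) (g := 0) h

theorem mem_cobarC {A : Finset ℕ} {d : ℤ} {f : Module.Dual k (M.Rake →₀ k)} :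
    f ∈ (M.cobar A).C d ↔ (∀ x ∈ Rake.relSpan M, f x = 0) ∧
      ∀ t : M.Rake, ¬ (t.labels = A.val ∧ (t.deg : ℤ) = d) → f (.single t 1) = 0 := by
  simp only [← Rake.linear_iff]
  refine and_congr_left fun _ => ⟨fun h x hx => ?_, fun h x hx => h x (Submodule.subset_span hx)⟩
  exact (Submodule.span_le.2 h : Rake.relSpan M ≤ LinearMap.ker f) hx

theorem cobar_isFilteredComplex (M : RightModule P) (A : Finset ℕ) :
    (M.cobar A).IsFilteredComplex where
  D_mem d f hf := by
    rw [mem_cobarC] at hf ⊢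
    refine ⟨fun x hx => hf.1 _ ?_, fun t ht => ?_⟩
    · rw [← Submodule.Quotient.mk_eq_zero]
      exact Rake.cl_deltaMap hx
    · rw [cobar_D_apply, Rake.deltaMap_single]
      refine apply_eq_zero_of_support fun s hs => hf.2 s fun h => ht ?_
      obtain ⟨h1, h2, -⟩ := Rake.mem_support_delta t s hs
      refine ⟨h1 ▸ h.1, ?_⟩
      have := h.2
      rw [h2] at this
      push_cast at this
      omega
  D_D d f hf := by
    refine LinearMap.ext fun x => ?_
    rw [cobar_D_apply, cobar_D_apply, ← LinearMap.comp_apply (Rake.deltaMap M),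
      Rake.deltaMap_deltaMap]
    simp
  mono p q hpq f hf t ht := hf t (lt_of_le_of_lt hpq ht)
  D_filt d p f _ hf t ht := by
    rw [cobar_D_apply, Rake.deltaMap_single]
    refine apply_eq_zero_of_support fun s hs => hf s ?_
    have := (Rake.mem_support_delta t s hs).2.2
    omega

end RightModule
end

section
variable {P : Operad.{u, v} k}

/-! ### The Koszul homotopy on trees -/

theorem exists_generalizedInverse {V : Type*} [AddCommGroup V] [Module k V] (f : V →ₗ[k] V) :
    ∃ g : V →ₗ[k] V, f ∘ₗ g ∘ₗ f = f := by
  obtain ⟨g, hg⟩ := f.rangeRestrict.exists_rightInverse_of_surjective f.range_rangeRestrict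
  obtain ⟨g', hg'⟩ := g.exists_extend
  refine ⟨g', LinearMap.ext fun x => ?_⟩
  have h1 : g' (f x) = g (f.rangeRestrict x) := LinearMap.congr_fun hg' (f.rangeRestrict x)
  have h2 := congrArg Subtype.val (LinearMap.congr_fun hg (f.rangeRestrict x))
  rw [LinearMap.comp_apply, LinearMap.comp_apply, h1]
  exact h2

namespace PTree

/-- The component of a formal combination of trees in given labels and degree. -/
def part (B : Multiset ℕ) (g : ℕ) : (PTree P →₀ k) →ₗ[k] (PTree P →₀ k) :=
  open Classical in
  { toFun := Finsupp.filter fun t => t.labels = B ∧ t.deg = g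
    map_add' := fun _ _ => Finsupp.filter_add
    map_smul' := fun _ _ => Finsupp.filter_smul }

theorem part_of_forall {B : Multiset ℕ} {g : ℕ} {x : PTree P →₀ k}
    (h : ∀ t ∈ x.support, t.labels = B ∧ t.deg = g) : part B g x = x := by
  classical
  exact (Finsupp.filter_eq_self_iff _ _).2 fun t ht => h t (Finsupp.mem_support_iff.2 ht)

theorem part_of_forall_not {B : Multiset ℕ} {g : ℕ} {x : PTree P →₀ k}
    (h : ∀ t ∈ x.support, ¬ (t.labels = B ∧ t.deg = g)) : part B g x = 0 := by
  classical
  exact (Finsupp.filter_eq_zero_iff _ _).2 fun t ht => by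
    by_contra hc
    exact h t (Finsupp.mem_support_iff.2 hc) ht

theorem mem_support_part {B : Multiset ℕ} {g : ℕ} {x : PTree P →₀ k} {t : PTree P}
    (h : t ∈ (part B g x).support) : t.labels = B ∧ t.deg = g := by
  classical
  have : t ∈ (Finsupp.filter (fun t : PTree P => t.labels = B ∧ t.deg = g) x).support := by
    convert h
    simp only [part]
    rfl
  rw [Finsupp.support_filter, Finset.mem_filter] at this
  exact this.2

theorem part_mem {B : Multiset ℕ} {g : ℕ} {x : PTree P →₀ k} (hx : x ∈ relSpan P) :
    part B g x ∈ relSpan P := by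
  have : relSpan P ≤ (relSpan P).comap (part B g) := by
    refine Submodule.span_le.2 fun z hz => ?_
    obtain ⟨B', g', h⟩ := Rel.homogeneous hz
    show part B g z ∈ relSpan P
    by_cases hB : B' = B ∧ g' = g
    · rw [part_of_forall (hB.1 ▸ hB.2 ▸ h)]
      exact Submodule.subset_span hz
    · rw [part_of_forall_not fun t ht h' => hB ⟨(h t ht).1 ▸ h'.1, (h t ht).2 ▸ h'.2⟩]
      exact zero_mem _
  exact this hx

theorem deltaMap_part (B : Multiset ℕ) (g : ℕ) (x : PTree P →₀ k) :
    deltaMap P (part B g x) = part B (g + 1) (deltaMap P x) := by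
  have : deltaMap P ∘ₗ part B g = part B (g + 1) ∘ₗ deltaMap P := by
    ext1 t
    ext1
    simp only [LinearMap.comp_apply, Finsupp.lsingle_apply, deltaMap_single]
    by_cases h : t.labels = B ∧ t.deg = g
    · rw [part_of_forall fun s hs => ?_, part_of_forall fun s hs => ?_, deltaMap_single]
      · obtain ⟨h1, h2⟩ := mem_support_delta t s hs
        exact ⟨h1.trans h.1, by rw [h2, h.2]⟩
      · rw [Finset.mem_singleton.1 (Finsupp.support_single_subset hs)]
        exact h
    · rw [part_of_forall_not fun s hs => ?_, part_of_forall_not fun s hs h' => h ?_, map_zero]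
      · obtain ⟨h1, h2⟩ := mem_support_delta t s hs
        exact ⟨h1 ▸ h'.1, by omega⟩
      · rw [Finset.mem_singleton.1 (Finsupp.support_single_subset hs)]
        exact h
  exact LinearMap.congr_fun this x

theorem deltaMap_deltaMap (x : PTree P →₀ k) : deltaMap P (deltaMap P x) = 0 := by
  have : deltaMap P ∘ₗ deltaMap P = 0 := by
    ext1 t
    ext1
    simp only [LinearMap.comp_apply, Finsupp.lsingle_apply, deltaMap_single, deltaMap_delta,
      LinearMap.zero_apply]
  exact LinearMap.congr_fun this x

theorem exists_homotopy (P : Operad.{u, v} k) :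
    ∃ h : (PTree P →₀ k) →ₗ[k] (PTree P →₀ k),
      (∀ t, ∀ s ∈ (h (.single t 1)).support, s.labels = t.labels ∧ s.deg + 1 = t.deg) ∧
      (∀ z ∈ relSpan P, h z ∈ relSpan P) ∧
      ∀ x, deltaMap P (h (deltaMap P x)) - deltaMap P x ∈ relSpan P := by
  set S := relSpan P
  let δ' : ((PTree P →₀ k) ⧸ S) →ₗ[k] ((PTree P →₀ k) ⧸ S) :=
    S.mapQ S (deltaMap P) fun _ => deltaMap_mem
  obtain ⟨h', hh'⟩ := exists_generalizedInverse δ'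
  obtain ⟨s, hs⟩ := S.mkQ.exists_rightInverse_of_surjective S.range_mkQ
  let h₀ : (PTree P →₀ k) →ₗ[k] (PTree P →₀ k) := s ∘ₗ h' ∘ₗ S.mkQ
  have h₀S : ∀ z ∈ S, h₀ z = 0 := fun z hz => by
    simp only [h₀, LinearMap.comp_apply, Submodule.mkQ_apply, (Submodule.Quotient.mk_eq_zero S).2 hz,
      map_zero]
  have h₀δ : ∀ x, deltaMap P (h₀ (deltaMap P x)) - deltaMap P x ∈ S := fun x => by
    rw [← Submodule.Quotient.mk_eq_zero, Submodule.Quotient.mk_sub, sub_eq_zero]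
    have h1 : ∀ y, S.mkQ (deltaMap P y) = δ' (S.mkQ y) := fun y => rfl
    have h2 := LinearMap.congr_fun hh' (S.mkQ x)
    simp only [LinearMap.comp_apply] at h2
    have h3 : S.mkQ (h₀ (deltaMap P x)) = h' (S.mkQ (deltaMap P x)) := LinearMap.congr_fun hs _
    rw [← Submodule.mkQ_apply, ← Submodule.mkQ_apply, h1, h3, h1, h2]
  let h₁ : ℕ → (PTree P →₀ k) → Multiset ℕ → (PTree P →₀ k) := fun g x B =>
    match g with
    | 0 => 0
    | g + 1 => part B g (h₀ x)
  let h : (PTree P →₀ k) →ₗ[k] (PTree P →₀ k) :=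
    Finsupp.linearCombination k fun t => h₁ t.deg (.single t 1) t.labels
  have hh : ∀ t, h (.single t 1) = h₁ t.deg (.single t 1) t.labels := fun t => by simp [h]
  have hpart : ∀ B g x, (∀ t ∈ x.support, t.labels = B ∧ t.deg = g + 1) →
      h x = part B g (h₀ x) := fun B g x hx => by
    refine linearMap_congr_support (f := h) (g := part B g ∘ₗ h₀) fun t ht => ?_
    rw [hh, (hx t ht).1, (hx t ht).2]
    rfl
  have hpart0 : ∀ x, (∀ t ∈ x.support, t.deg = 0) → h x = 0 := fun x hx =>
    linearMap_congr_support (f := h) (g := 0) fun t ht => by rw [hh, hx t ht]; rfl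
  refine ⟨h, fun t x hx => ?_, fun z hz => ?_, fun x => ?_⟩
  · rw [hh] at hx
    cases hg : t.deg with
    | zero => rw [hg] at hx; simp [h₁] at hx
    | succ g =>
      rw [hg] at hx
      obtain ⟨h1, h2⟩ := mem_support_part hx
      exact ⟨h1, by omega⟩
  · have : S ≤ S.comap h := by
      refine Submodule.span_le.2 fun z hz => ?_
      show h z ∈ S
      obtain ⟨B, g, hB⟩ := Rel.homogeneous hz
      cases g with
      | zero => rw [hpart0 z fun t ht => (hB t ht).2]; exact zero_mem _
      | succ g =>
        rw [hpart B g z hB, h₀S z (Submodule.subset_span hz), map_zero]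
        exact zero_mem _
    exact this hz
  · have : S.mkQ ∘ₗ (deltaMap P ∘ₗ h ∘ₗ deltaMap P - deltaMap P) = 0 := by
      ext1 t
      ext1
      refine (Submodule.Quotient.mk_eq_zero S).2 ?_
      show deltaMap P (h (deltaMap P (.single t 1))) - deltaMap P (.single t 1) ∈ S
      have hd : ∀ s ∈ (deltaMap P (.single t 1)).support, s.labels = t.labels ∧
          s.deg = t.deg + 1 := fun s hs => mem_support_delta t s (by rwa [deltaMap_single] at hs)
      rw [hpart _ _ _ hd, deltaMap_part]
      nth_rewrite 2 [← part_of_forall hd]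
      rw [← map_sub]
      exact part_mem (h₀δ _)
    exact (Submodule.Quotient.mk_eq_zero S).1 (LinearMap.congr_fun this x)

theorem _root_.KoszulModules.Operad.mem_cobar {A : Finset ℕ} {d : ℤ}
    {f : Module.Dual k (PTree P →₀ k)} :
    f ∈ P.cobar A d ↔ (∀ x ∈ relSpan P, f x = 0) ∧
      ∀ t : PTree P, ¬ (t.labels = A.val ∧ (t.deg : ℤ) = d) → f (.single t 1) = 0 := by
  simp only [← linear_iff]
  refine and_congr_left fun _ => ⟨fun h x hx => ?_, fun h x hx => h x (Submodule.subset_span hx)⟩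
  exact (Submodule.span_le.2 h : relSpan P ≤ LinearMap.ker f) hx

theorem _root_.KoszulModules.Operad.comp_part_mem_cobar {f : Module.Dual k (PTree P →₀ k)}
    (hf : ∀ x ∈ relSpan P, f x = 0) (A : Finset ℕ) (d : ℕ) :
    f ∘ₗ part A.val d ∈ P.cobar A d := by
  refine Operad.mem_cobar.2 ⟨fun x hx => hf _ (part_mem hx), fun t ht => ?_⟩
  rw [LinearMap.comp_apply, part_of_forall_not, map_zero]
  intro s hs h
  rw [Finset.mem_singleton.1 (Finsupp.support_single_subset hs)] at h
  exact ht ⟨h.1, by exact_mod_cast h.2⟩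

theorem mem_sup_range_of_isKoszul (hK : P.IsKoszul) {A : Finset ℕ} (hA : A.Nonempty) {d : ℕ}
    (hd : 0 < d) {x : PTree P →₀ k} (hx : ∀ t ∈ x.support, t.labels = A.val ∧ t.deg = d)
    (hδ : deltaMap P x ∈ relSpan P) : x ∈ relSpan P ⊔ LinearMap.range (deltaMap P) := by
  by_contra hc
  obtain ⟨f, hf, hf'⟩ := Submodule.exists_le_ker_of_notMem hc
  have hS : ∀ x ∈ relSpan P, f x = 0 := fun y hy => hf' (Submodule.mem_sup_left hy)
  obtain ⟨g, hg, hgf⟩ := (hK A hA).2 d (by exact_mod_cast hd) _ (Operad.comp_part_mem_cobar hS A d)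
    (by
      refine LinearMap.ext fun y => ?_
      show f (part A.val d (deltaMap P y)) = 0
      obtain ⟨d, rfl⟩ := Nat.exists_eq_succ_of_ne_zero hd.ne'
      rw [← deltaMap_part]
      exact hf' (Submodule.mem_sup_right ⟨_, rfl⟩))
  have h1 := LinearMap.congr_fun hgf x
  rw [LinearMap.comp_apply, part_of_forall hx] at h1
  refine hf (h1.symm.trans ?_)
  exact (Operad.mem_cobar.1 hg).1 _ hδ

/-- Combinations of trees of degree zero with given labels which are cycles modulo relations. -/
def cycles (P : Operad.{u, v} k) (B : Multiset ℕ) : Submodule k (PTree P →₀ k) :=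
  Finsupp.supported k k {t | t.labels = B ∧ t.deg = 0} ⊓ (relSpan P).comap (deltaMap P)

theorem labels_ne_zero (t : PTree P) : t.labels ≠ 0 := by
  induction t with
  | leaf x => simp [labels]
  | node n p c ih =>
    intro h
    rw [labels, Finset.sum_eq_zero_iff] at h
    exact ih 0 (h 0 (Finset.mem_univ _))

theorem exists_contraction (hK : P.IsKoszul) :
    ∃ H : (PTree P →₀ k) →ₗ[k] (PTree P →₀ k),
      (∀ t, ∀ s ∈ (H (.single t 1)).support, s.labels = t.labels ∧ s.deg + 1 = t.deg) ∧
      (∀ z ∈ relSpan P, H z ∈ relSpan P) ∧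
      ∀ t : PTree P, t.labels.Nodup →
        Finsupp.single t 1 - (H ∘ₗ deltaMap P + deltaMap P ∘ₗ H) (.single t 1) ∈
          cycles P t.labels ⊔ relSpan P := by
  obtain ⟨h, hdeg, hS, hδ⟩ := exists_homotopy P
  have hsup : ∀ x : PTree P →₀ k, ∀ B g, (∀ t ∈ x.support, t.labels = B ∧ t.deg = g) →
      ∀ t ∈ (h x).support, t.labels = B ∧ t.deg + 1 = g := by
    classical
    intro x B g hx t ht
    rw [← x.sum_single, Finsupp.sum, map_sum] at ht
    obtain ⟨s, hs, ht⟩ := Finset.mem_biUnion.1 (Finsupp.support_finsetSum ht)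
    rw [← mul_one (x s), ← smul_eq_mul, ← Finsupp.smul_single, map_smul] at ht
    obtain ⟨h1, h2⟩ := hdeg s t (Finsupp.support_smul ht)
    obtain ⟨h3, h4⟩ := hx s hs
    exact ⟨h1.trans h3, h2.trans h4⟩
  have hdsup : ∀ t : PTree P, ∀ s ∈ (deltaMap P (.single t 1)).support, s.labels = t.labels ∧
      s.deg = t.deg + 1 := fun t s hs => mem_support_delta t s (by rwa [deltaMap_single] at hs)
  refine ⟨h - h ∘ₗ h ∘ₗ deltaMap P, fun t s hs => ?_, fun z hz => ?_, fun t ht => ?_⟩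
  · classical
    rcases Finset.mem_union.1 (Finsupp.support_sub hs) with hs | hs
    · exact hdeg t s hs
    · have h1 := hsup _ _ _ (hdsup t)
      have h2 := hsup _ t.labels t.deg (fun s hs => ⟨(h1 s hs).1, by
        have := (h1 s hs).2; omega⟩)
      exact h2 s hs
  · exact sub_mem (hS _ hz) (hS _ (hS _ (deltaMap_mem hz)))
  · set x : PTree P →₀ k := .single t 1 - h (deltaMap P (.single t 1)) with hx
    have hxsup : ∀ s ∈ x.support, s.labels = t.labels ∧ s.deg = t.deg := by
      classical
      intro s hs
      rcases Finset.mem_union.1 (Finsupp.support_sub hs) with hs | hs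
      · rw [Finset.mem_singleton.1 (Finsupp.support_single_subset hs)]
        exact ⟨rfl, rfl⟩
      · obtain ⟨h1, h2⟩ := hsup _ _ _ (hdsup t) s hs
        exact ⟨h1, by omega⟩
    have hxδ : deltaMap P x ∈ relSpan P := by
      have := hδ (.single t 1)
      rw [← neg_mem_iff, neg_sub] at this
      rwa [hx, map_sub]
    have he : Finsupp.single t 1 - ((h - h ∘ₗ h ∘ₗ deltaMap P) ∘ₗ deltaMap P +
        deltaMap P ∘ₗ (h - h ∘ₗ h ∘ₗ deltaMap P)) (.single t 1) = x - deltaMap P (h x) := by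
      simp only [LinearMap.add_apply, LinearMap.comp_apply, LinearMap.sub_apply, map_sub,
        deltaMap_deltaMap, map_zero, hx]
      abel
    rw [he]
    rcases Nat.eq_zero_or_pos t.deg with h0 | hpos
    · have : h x = 0 := by
        rw [← Finsupp.support_eq_empty, Finset.eq_empty_iff_forall_notMem]
        intro s hs
        have := (hsup x _ _ hxsup s hs).2
        omega
      rw [this, map_zero, sub_zero]
      refine Submodule.mem_sup_left ⟨fun s hs => ?_, hxδ⟩
      obtain ⟨h1, h2⟩ := hxsup s hs
      exact ⟨h1, h2.trans h0⟩
    · refine Submodule.mem_sup_right ?_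
      have hA : (⟨t.labels, ht⟩ : Finset ℕ).Nonempty := by
        rw [Finset.nonempty_iff_ne_empty]
        exact fun h => t.labels_ne_zero (congrArg Finset.val h)
      obtain ⟨s, hs, _, ⟨y, rfl⟩, hsy⟩ := Submodule.mem_sup.1
        (mem_sup_range_of_isKoszul hK hA hpos hxsup hxδ)
      rw [← hsy, map_add, map_add]
      have h1 := sub_mem hs (deltaMap_mem (hS s hs))
      have h2 := hδ y
      have : s + deltaMap P y - (deltaMap P (h s) + deltaMap P (h (deltaMap P y))) =
        (s - deltaMap P (h s)) - (deltaMap P (h (deltaMap P y)) - deltaMap P y) := by abel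
      rw [this]
      exact sub_mem h1 h2

end PTree
end

section
variable {P : Operad.{u, v} k}

/-! ### Multilinear extension of the grafting of trees -/

theorem multilinearMap_eq_zero_of_span {ι V N : Type*} [Fintype ι] [DecidableEq ι]
    [AddCommGroup V] [Module k V] [AddCommGroup N] [Module k N]
    (g : MultilinearMap k (fun _ : ι => V) N) (T : ι → Set V)
    (h : ∀ t : ι → V, (∀ i, t i ∈ T i) → g t = 0) (x : ι → V)
    (hx : ∀ i, x i ∈ Submodule.span k (T i)) : g x = 0 := by
  have key : ∀ (s : Finset ι) (x : ι → V), (∀ i ∈ s, x i ∈ Submodule.span k (T i)) →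
      (∀ i, i ∉ s → x i ∈ T i) → g x = 0 := by
    intro s
    induction s using Finset.induction_on with
    | empty => exact fun x _ hx => h x fun i => hx i (Finset.notMem_empty i)
    | insert a s ha ih =>
      intro x h1 h2
      have : Submodule.span k (T a) ≤ LinearMap.ker (g.toLinearMap x a) := by
        refine Submodule.span_le.2 fun v hv => ?_
        refine ih (Function.update x a v) (fun i hi => ?_) fun i hi => ?_
        · rw [Function.update_of_ne (fun h : i = a => ha (h ▸ hi))]
          exact h1 i (Finset.mem_insert_of_mem hi)
        · by_cases hia : i = a
          · subst hia; rwa [Function.update_self]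
          · rw [Function.update_of_ne hia]
            exact h2 i fun h => (Finset.mem_insert.1 h).elim hia hi
      have := this (h1 a (Finset.mem_insert_self _ _))
      rwa [LinearMap.mem_ker, MultilinearMap.toLinearMap_apply, Function.update_eq_self] at this
  exact key Finset.univ x (fun i _ => hx i) fun i hi => (hi (Finset.mem_univ i)).elim

theorem span_range_single {T : Type*} :
    Submodule.span k (Set.range fun t : T => (Finsupp.single t 1 : T →₀ k)) = ⊤ := by
  rw [← Set.image_univ, ← Finsupp.supported_eq_span_single, Finsupp.supported_univ]

section Multi
variable {T X N : Type*} {n : ℕ} [AddCommGroup N] [Module k N]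

/-- The multilinear extension of a map `F` to formal combinations. -/
def finsuppMulti (k : Type u) [Field k] (F : (Fin n → T) → X) :
    MultilinearMap k (fun _ : Fin n => T →₀ k) (X →₀ k) :=
  letI : DecidableEq T := Classical.decEq _
  letI : DecidableEq k := Classical.decEq _
  (Finsupp.lmapDomain k k F ∘ₗ
    (PiTensorProduct.ofFinsuppEquiv' (R := k) (κ := fun _ : Fin n => T)).toLinearMap
    ).compMultilinearMap (PiTensorProduct.tprod k)

theorem finsuppMulti_single (F : (Fin n → T) → X) (c : Fin n → T) :
    finsuppMulti k F (fun i => .single (c i) 1) = .single (F c) 1 := by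
  classical
  simp only [finsuppMulti, LinearMap.compMultilinearMap_apply, LinearMap.comp_apply,
    LinearEquiv.coe_coe]
  rw [PiTensorProduct.ofFinsuppEquiv'_tprod_single, Finsupp.lmapDomain_apply,
    Finsupp.mapDomain_single, Finset.prod_const_one]

theorem mem_support_finsuppMulti {F : (Fin n → T) → X} {x : Fin n → T →₀ k} {t : X}
    (ht : t ∈ (finsuppMulti k F x).support) : ∃ c, t = F c ∧ ∀ i, c i ∈ (x i).support := by
  classical
  obtain ⟨c, hc, rfl⟩ := Finset.mem_image.1 (Finsupp.mapDomain_support ht)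
  refine ⟨c, rfl, fun i => ?_⟩
  rw [Finsupp.mem_support_iff] at hc ⊢
  intro hi
  apply hc
  refine (PiTensorProduct.ofFinsuppEquiv'_apply_apply _ _).trans ?_
  exact Finset.prod_eq_zero (Finset.mem_univ i) hi

theorem multilinearMap_finsupp_ext {f g : MultilinearMap k (fun _ : Fin n => T →₀ k) N}
    (h : ∀ c : Fin n → T, f (fun i => .single (c i) 1) = g (fun i => .single (c i) 1)) : f = g := by
  rw [← sub_eq_zero]
  ext1 x
  refine multilinearMap_eq_zero_of_span (f - g) (fun _ => Set.range fun t : T => .single t 1)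
    (fun t ht => ?_) x fun i => ?_
  · choose c hc using ht
    rw [← show (fun i => .single (c i) 1) = t from funext hc, sub_apply, h, sub_self]
  · rw [span_range_single]
    exact Submodule.mem_top

theorem finsuppMulti_update_single (F : (Fin n → T) → X) (c : Fin n → T) (i : Fin n)
    (z : T →₀ k) : finsuppMulti k F (Function.update (fun j => .single (c j) 1) i z) =
      z.mapDomain fun s => F (Function.update c i s) := by
  have : (finsuppMulti k F).toLinearMap (fun j => .single (c j) 1) i =
      Finsupp.lmapDomain k k fun s => F (Function.update c i s) := by
    ext1 s
    ext1
    simp only [LinearMap.comp_apply, Finsupp.lsingle_apply, MultilinearMap.toLinearMap_apply,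
      Finsupp.lmapDomain_apply, Finsupp.mapDomain_single, ← finsuppMulti_single]
    congr 1
    ext1 j
    by_cases h : j = i
    · subst h; simp
    · simp [h]
  exact LinearMap.congr_fun this z

theorem finsuppMulti_mem (F : (Fin n → T) → X) {S : Submodule k (T →₀ k)}
    {W : Submodule k (X →₀ k)} (h : ∀ (c : Fin n → T) (i : Fin n), ∀ s ∈ S,
      (s.mapDomain fun s => F (Function.update c i s)) ∈ W)
    {x : Fin n → T →₀ k} {i : Fin n} (hi : x i ∈ S) : finsuppMulti k F x ∈ W := by
  rw [← Submodule.Quotient.mk_eq_zero]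
  refine multilinearMap_eq_zero_of_span (W.mkQ.compMultilinearMap (finsuppMulti k F))
    (fun j => if j = i then S else Set.range fun t => .single t 1) (fun t ht => ?_) x fun j => ?_
  · have h1 : ∀ j, j ≠ i → ∃ s, Finsupp.single s 1 = t j := fun j hj => by
      have := ht j
      rwa [if_neg hj] at this
    have h2 := ht i
    rw [if_pos rfl] at h2
    by_cases hT : Nonempty T
    · obtain ⟨c, hc⟩ : ∃ c : Fin n → T, ∀ j, j ≠ i → Finsupp.single (c j) 1 = t j :=
        ⟨fun j => if hj : j ≠ i then (h1 j hj).choose else hT.some, fun j hj => by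
          simp only [dif_pos hj]; exact (h1 j hj).choose_spec⟩
      have h3 : t = Function.update (fun j => .single (c j) 1) i (t i) := by
        ext1 j
        by_cases hj : j = i
        · subst hj; simp
        · rw [Function.update_of_ne hj, hc j hj]
      rw [h3, LinearMap.compMultilinearMap_apply, finsuppMulti_update_single, Submodule.mkQ_apply,
        Submodule.Quotient.mk_eq_zero]
      exact h c i _ h2
    · have : IsEmpty T := not_nonempty_iff.1 hT
      exact MultilinearMap.map_coord_zero _ i (Subsingleton.elim _ _)
  · split_ifs with hj
    · subst hj; exact Submodule.subset_span hi
    · rw [span_range_single]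
      exact Submodule.mem_top

end Multi

namespace RightModule.Rake
variable {M : RightModule P} {l : ℕ}

/-- The multilinear extension of `c ↦ ⟨l, m, c⟩` to formal combinations of trees. -/
abbrev multi (m : M.obj (Fin (l + 1))) :
    MultilinearMap k (fun _ : Fin (l + 1) => PTree P →₀ k) (M.Rake →₀ k) :=
  finsuppMulti k fun c : Fin (l + 1) → PTree P => (⟨l, m, c⟩ : M.Rake)

theorem multi_single (m : M.obj (Fin (l + 1))) (c : Fin (l + 1) → PTree P) :
    multi m (fun i => .single (c i) 1) = .single (⟨l, m, c⟩ : M.Rake) 1 :=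
  finsuppMulti_single _ c

theorem mem_support_multi {m : M.obj (Fin (l + 1))} {x : Fin (l + 1) → PTree P →₀ k} {t : M.Rake}
    (ht : t ∈ (multi m x).support) : ∃ c, t = ⟨l, m, c⟩ ∧ ∀ i, c i ∈ (x i).support :=
  mem_support_finsuppMulti ht

theorem ins_refl (m : M.obj (Fin (l + 1))) (c : Fin (l + 1) → PTree P) (i : Fin (l + 1))
    (z : PTree P →₀ k) : ins (Equiv.refl _) m c i z =
      z.mapDomain fun s => (⟨l, m, Function.update c i s⟩ : M.Rake) := by
  simp only [ins, of_refl, Finsupp.lmapDomain_apply]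

theorem ins_refl_single (m : M.obj (Fin (l + 1))) (c : Fin (l + 1) → PTree P) (i : Fin (l + 1))
    (s : PTree P) : ins (Equiv.refl _) m c i (.single s 1) =
      .single (⟨l, m, Function.update c i s⟩ : M.Rake) 1 := by
  rw [ins_single, of_refl]

theorem multi_update_single (m : M.obj (Fin (l + 1))) (c : Fin (l + 1) → PTree P)
    (i : Fin (l + 1)) (z : PTree P →₀ k) :
    multi m (Function.update (fun j => .single (c j) 1) i z) = ins (Equiv.refl _) m c i z := by
  rw [finsuppMulti_update_single, ins_refl]

theorem multi_mem_relSpan (m : M.obj (Fin (l + 1))) {x : Fin (l + 1) → PTree P →₀ k}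
    {i : Fin (l + 1)} (hi : x i ∈ PTree.relSpan P) : multi m x ∈ relSpan M := by
  refine finsuppMulti_mem _ (fun c i s hs => ?_) hi
  rw [← ins_refl, ← Submodule.Quotient.mk_eq_zero]
  exact cl_ins _ _ _ _ hs

/-! ### Homotopies on the cobar construction of a module -/

theorem mem_support_childSum {w : Multiset ℕ → k} {u : (PTree P →₀ k) →ₗ[k] (PTree P →₀ k)}
    {t t' : M.Rake} (h : t' ∈ (childSum M w u (.single t 1)).support) :
    ∃ i, ∃ s ∈ (u (.single (t.2.2 i) 1)).support,
      t' = ⟨t.1, t.2.1, Function.update t.2.2 i s⟩ := by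
  classical
  rw [childSum, Finsupp.linearCombination_single, one_smul] at h
  obtain ⟨i, -, h⟩ := Finset.mem_biUnion.1 (Finsupp.support_finsetSum h)
  obtain ⟨s, hs, rfl⟩ := Finset.mem_image.1 (Finsupp.mapDomain_support (Finsupp.support_smul h))
  exact ⟨i, s, hs, rfl⟩

theorem mem_support_rootDelta {t t' : M.Rake} (h : t' ∈ (rootDelta M (.single t 1)).support) :
    t.1 < t'.1 := by
  classical
  rw [rootDelta, Finsupp.linearCombination_single, one_smul] at h
  obtain ⟨i, -, h⟩ := Finset.mem_biUnion.1 (Finsupp.support_finsetSum h)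
  cases hi : t.2.2 i with
  | leaf x => rw [hi] at h; simp [contract] at h
  | node q p d =>
    rw [hi, contract] at h
    rw [Finset.mem_singleton.1 (Finsupp.support_single_subset h)]
    show t.1 < t.1 + q + 1
    omega

theorem labels_update (m : M.obj (Fin (l + 1))) (c : Fin (l + 1) → PTree P) (i : Fin (l + 1))
    {s : PTree P} (h : s.labels = (c i).labels) :
    labels (⟨l, m, Function.update c i s⟩ : M.Rake) = labels (⟨l, m, c⟩ : M.Rake) := by
  rw [← of_refl, ← of_refl m c, labels_of_update, labels_of, sum_eq_add_sum_ne _ i, h]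

theorem deg_update (m : M.obj (Fin (l + 1))) (c : Fin (l + 1) → PTree P) (i : Fin (l + 1))
    (s : PTree P) : deg (⟨l, m, Function.update c i s⟩ : M.Rake) + (c i).deg =
      deg (⟨l, m, c⟩ : M.Rake) + s.deg := by
  rw [← of_refl, ← of_refl m c, deg_of_update, deg_of, sum_eq_add_sum_ne (fun y => (c y).deg) i]
  ring

end RightModule.Rake

namespace RightModule
variable {M : RightModule P} {l : ℕ}
open Rake

theorem exists_homotopic {H : (PTree P →₀ k) →ₗ[k] (PTree P →₀ k)}
    (hH : ∀ t, ∀ s ∈ (H (.single t 1)).support, s.labels = t.labels ∧ s.deg + 1 = t.deg)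
    (hHS : ∀ z ∈ PTree.relSpan P, H z ∈ PTree.relSpan P) {A : Finset ℕ} {a : ℕ} (ha : a ∈ A)
    {q : ℤ} {f : Module.Dual k (M.Rake →₀ k)} (hf : f ∈ (M.cobar A).Z 1 l q) :
    ∃ g ∈ (M.cobar A).Z 0 l (q + 1), ∀ (m : M.obj (Fin (l + 1))) (c : Fin (l + 1) → PTree P),
      labels (⟨l, m, c⟩ : M.Rake) = A.val →
      (f - (M.cobar A).D g) (.single ⟨l, m, c⟩ 1) =
        ∑ i, ((c i).labels.count a : k) * f (ins (Equiv.refl _) m c i (.single (c i) 1 -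
          (H ∘ₗ PTree.deltaMap P + PTree.deltaMap P ∘ₗ H) (.single (c i) 1))) := by
  have hodd : PTree.OddOp H := fun t s hs => by
    obtain ⟨h1, h2⟩ := hH t s hs
    exact ⟨h1, by rw [← h2]; exact ⟨s.deg, by ring⟩⟩
  set w : Multiset ℕ → k := fun B => (B.count a : k) with hw
  obtain ⟨⟨hfC, hfF⟩, hfD⟩ := hf
  replace hfC := mem_cobarC.1 hfC
  have hgC : f ∘ₗ childSum M w H ∈ (M.cobar A).C (l + (q + 1)) := by
    refine mem_cobarC.2 ⟨fun x hx => hfC.1 _ ?_, fun t ht => ?_⟩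
    · rw [← Submodule.Quotient.mk_eq_zero]
      exact cl_childSum w hodd (fun z hz => hHS z (Submodule.subset_span hz)) hx
    · rw [LinearMap.comp_apply]
      refine apply_eq_zero_of_support fun s hs => hfC.2 s fun hs' => ht ?_
      obtain ⟨i, s', hi, rfl⟩ := mem_support_childSum hs
      obtain ⟨h1, h2⟩ : s'.labels = (t.2.2 i).labels ∧ s'.deg + 1 = (t.2.2 i).deg := hH _ s' hi
      refine ⟨(labels_update _ _ i h1).symm.trans hs'.1, ?_⟩
      have h3 := deg_update t.2.1 t.2.2 i s'
      have h4 := hs'.2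
      change deg _ + (t.2.2 i).deg = deg t + _ at h3
      omega
  have hgF : f ∘ₗ childSum M w H ∈ (M.cobar A).F l := fun t ht => by
    rw [LinearMap.comp_apply]
    refine apply_eq_zero_of_support fun s hs => hfF s ?_
    obtain ⟨i, s, hs, rfl⟩ := mem_support_childSum hs
    exact ht
  refine ⟨f ∘ₗ childSum M w H, ⟨⟨hgC, hgF⟩, ?_⟩, fun m c hc => ?_⟩
  · have := (cobar_isFilteredComplex M A).D_filt _ _ _ hgC hgF
    simpa using this
  · -- terms where the arity of the root grows do not contribute
    have hroot : f (childSum M w H (rootDelta M (.single ⟨l, m, c⟩ 1))) = 0 := by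
      refine linearMap_congr_support (f := f ∘ₗ childSum M w H) (g := 0) fun t ht => ?_
      exact hgF t (by exact_mod_cast mem_support_rootDelta ht)
    have hDf : ∀ t : M.Rake, t.1 = l → f (childSum M (fun _ => 1) (PTree.deltaMap P)
        (.single t 1)) = 0 := fun t ht => by
      have h1 := hfD t (by omega)
      have h2 : f (rootDelta M (.single t 1)) = 0 :=
        linearMap_congr_support (f := f) (g := 0) fun s hs => hfF s (by
          have := mem_support_rootDelta hs; omega)
      rw [cobar_D_apply, deltaMap_eq, LinearMap.add_apply, map_add, h2, zero_add] at h1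
      exact h1
    have hDf' : f (childSum M (fun _ => 1) (PTree.deltaMap P)
        (childSum M w H (.single ⟨l, m, c⟩ 1))) = 0 := by
      refine linearMap_congr_support (f := f ∘ₗ childSum M (fun _ => 1) (PTree.deltaMap P)) (g := 0)
        fun t ht => hDf t ?_
      obtain ⟨i, s, hs, rfl⟩ := mem_support_childSum ht
      rfl
    have hac := childSum_anticomm (M := M) (Equiv.refl _) m c w (fun _ => 1) hodd
      PTree.oddOp_deltaMap
    rw [of_refl] at hac
    have hac := congrArg f hac
    rw [map_add, hDf', zero_add] at hac
    have hcount : ∑ i, w (c i).labels = 1 := by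
      have : ∑ i, (c i).labels.count a = 1 := by
        rw [← Multiset.count_sum', show ∑ i, (c i).labels = A.val from hc]
        exact Multiset.count_eq_one_of_mem A.nodup ha
      simp only [hw]
      rw [← Nat.cast_sum, this, Nat.cast_one]
    rw [LinearMap.sub_apply, cobar_D_apply, LinearMap.comp_apply, deltaMap_eq,
      LinearMap.add_apply, map_add, map_add, hroot, zero_add, hac]
    have hself : ∀ i, ins (Equiv.refl _) m c i (.single (c i) 1) =
        .single (⟨l, m, c⟩ : M.Rake) 1 := fun i => by
      rw [ins_refl_single, Function.update_eq_self]
    simp only [map_sub, hself, mul_sub, Finset.sum_sub_distrib, ← Finset.sum_mul, map_sum, map_smul,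
      mul_one, smul_eq_mul]
    rw [show ∑ i, ((c i).labels.count a : k) = 1 from hcount, one_mul]
    congr 1
    refine Finset.sum_congr rfl fun i _ => ?_
    rw [add_comm (_ ∘ₗ H)]

theorem exists_count_eq {n : ℕ} {B : Fin n → Multiset ℕ} {A : Finset ℕ} (h : ∑ i, B i = A.val)
    {a : ℕ} (ha : a ∈ A) : ∃ i₀, a ∈ B i₀ ∧ ∀ i, (B i).count a = if i = i₀ then 1 else 0 := by
  have h1 : ∑ i, (B i).count a = 1 := by
    rw [← Multiset.count_sum', h]
    exact Multiset.count_eq_one_of_mem A.nodup ha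
  obtain ⟨i₀, -, h0⟩ := Finset.exists_ne_zero_of_sum_ne_zero (by rw [h1]; exact one_ne_zero)
  rw [← Finset.add_sum_erase _ _ (Finset.mem_univ i₀)] at h1
  have h2 : ∑ i ∈ Finset.univ.erase i₀, (B i).count a = 0 := by omega
  rw [Finset.sum_eq_zero_iff] at h2
  refine ⟨i₀, Multiset.count_ne_zero.1 h0, fun i => ?_⟩
  split_ifs with hi
  · subst hi; omega
  · exact h2 i (Finset.mem_erase.2 ⟨hi, Finset.mem_univ _⟩)

theorem D_mem_B_of_mem_Z {A : Finset ℕ} {l q : ℤ} {g : Module.Dual k (M.Rake →₀ k)}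
    (hg : g ∈ (M.cobar A).Z 0 l (q + 1)) : (M.cobar A).D g ∈ (M.cobar A).B 1 l q := by
  refine Submodule.mem_sup_right ⟨g, ?_, rfl⟩
  have h1 : (1 : ℤ) - 1 = 0 := by ring
  have h2 : l + 1 - 1 = l := by ring
  have h3 : q - 1 + 2 = q + 1 := by ring
  rw [h1, h2, h3]
  exact hg

theorem D_mem_Z_of_mem_Z {A : Finset ℕ} {l q : ℤ} {g : Module.Dual k (M.Rake →₀ k)}
    (hg : g ∈ (M.cobar A).Z 0 l (q + 1)) : (M.cobar A).D g ∈ (M.cobar A).Z 1 l q := by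
  obtain ⟨⟨h1, h2⟩, h3⟩ := hg
  have hX := cobar_isFilteredComplex M A
  refine ⟨⟨?_, by simpa using h3⟩, ?_⟩
  · have := hX.D_mem _ _ h1
    rwa [show l + (q + 1) - 1 = l + q by ring] at this
  · show (M.cobar A).D ((M.cobar A).D g) ∈ (M.cobar A).F (l - 1)
    rw [hX.D_D _ _ h1]
    exact zero_mem ((M.cobar A).F (l - 1))

/-- An element of `Z¹` that vanishes on families of cycles is a boundary. -/
theorem mem_B_of_vanishing (hK : P.IsKoszul) {A : Finset ℕ} {q : ℤ}
    {f : Module.Dual k (M.Rake →₀ k)} (hf : f ∈ (M.cobar A).Z 1 l q)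
    (hf0 : ∀ (m : M.obj (Fin (l + 1))) (B : Fin (l + 1) → Multiset ℕ)
      (x : Fin (l + 1) → PTree P →₀ k), ∑ i, B i = A.val → (∀ i, x i ∈ PTree.cycles P (B i)) →
        f (multi m x) = 0) : f ∈ (M.cobar A).B 1 l q := by
  obtain ⟨H, hH, hHS, hHe⟩ := PTree.exists_contraction hK
  set e := LinearMap.id - (H ∘ₗ PTree.deltaMap P + PTree.deltaMap P ∘ₗ H) with he
  have key : ∀ s : Finset ℕ, s ⊆ A → ∃ f' ∈ (M.cobar A).Z 1 l q, f - f' ∈ (M.cobar A).B 1 l q ∧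
      ∀ (m : M.obj (Fin (l + 1))) (B : Fin (l + 1) → Multiset ℕ)
        (x : Fin (l + 1) → PTree P →₀ k), ∑ i, B i = A.val →
        (∀ i, x i ∈ Finsupp.supported k k {t | t.labels = B i}) →
        (∀ i, (∃ a ∈ s, a ∈ B i) ∨ x i ∈ PTree.cycles P (B i)) → f' (multi m x) = 0 := by
    intro s
    induction s using Finset.induction_on with
    | empty =>
      refine fun _ => ⟨f, hf, by rw [sub_self]; exact zero_mem _, fun m B x hB _ hx => ?_⟩
      refine hf0 m B x hB fun i => (hx i).resolve_left ?_
      rintro ⟨a, ha, -⟩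
      exact Finset.notMem_empty a ha
    | insert a s _ ih =>
      intro hs
      obtain ⟨f', hf', hff', hv⟩ := ih ((Finset.subset_insert _ _).trans hs)
      have ha : a ∈ A := hs (Finset.mem_insert_self _ _)
      obtain ⟨g, hg, hfg⟩ := exists_homotopic hH hHS ha hf'
      refine ⟨f' - (M.cobar A).D g, sub_mem hf' (D_mem_Z_of_mem_Z hg), ?_, ?_⟩
      · rw [← sub_add]
        exact add_mem hff' (D_mem_B_of_mem_Z hg)
      · intro m B x hB hx hxs
        obtain ⟨i₀, hi₀, hcount⟩ := exists_count_eq hB ha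
        have h1 : ∀ x : Fin (l + 1) → PTree P →₀ k,
            (∀ i, x i ∈ Finsupp.supported k k {t | t.labels = B i}) →
            (f' - (M.cobar A).D g) (multi m x) =
              f' (multi m (Function.update x i₀ (e (x i₀)))) := by
          intro x hx
          have hu : ∀ x : Fin (l + 1) → PTree P →₀ k, Function.update x i₀ (e (x i₀)) =
              fun i => Function.update (fun _ => LinearMap.id) i₀ e i (x i) := fun x => by
            ext1 i
            by_cases hi : i = i₀
            · subst hi; simp
            · simp [hi]
          rw [← sub_eq_zero, hu]
          refine multilinearMap_eq_zero_of_span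
            ((f' - (M.cobar A).D g).compMultilinearMap (multi m) -
              (f'.compMultilinearMap (multi m)).compLinearMap
                (fun i => Function.update (fun _ => LinearMap.id) i₀ e i))
            (fun i => (fun t => .single t 1) '' {t : PTree P | t.labels = B i})
            (fun y hy => ?_) x fun i => ?_
          · choose c hc hcy using hy
            obtain rfl : (fun i => .single (c i) 1) = y := funext hcy
            have hl : labels (⟨l, m, c⟩ : M.Rake) = A.val := by
              rw [← hB]
              exact Finset.sum_congr rfl fun i _ => hc i
            rw [sub_apply, MultilinearMap.compLinearMap_apply,
              LinearMap.compMultilinearMap_apply, LinearMap.compMultilinearMap_apply, ← hu,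
              multi_single, hfg m c hl, multi_update_single, sub_eq_zero]
            rw [Finset.sum_eq_single i₀]
            · rw [show (c i₀).labels = B i₀ from hc i₀, hcount, if_pos rfl, Nat.cast_one, one_mul]
              rfl
            · intro i _ hi
              rw [show (c i).labels = B i from hc i, hcount, if_neg hi, Nat.cast_zero, zero_mul]
            · exact fun h => (h (Finset.mem_univ _)).elim
          · rw [← Finsupp.supported_eq_span_single]
            exact hx i
        rw [h1 x hx]
        have h2 : e (x i₀) ∈ PTree.cycles P (B i₀) ⊔ PTree.relSpan P := by
          have : Finsupp.supported k k {t : PTree P | t.labels = B i₀} ≤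
              (PTree.cycles P (B i₀) ⊔ PTree.relSpan P).comap e := by
            rw [Finsupp.supported_eq_span_single, Submodule.span_le]
            rintro _ ⟨t, ht, rfl⟩
            have hn : t.labels.Nodup := by
              rw [show t.labels = B i₀ from ht]
              refine Multiset.nodup_of_le ?_ A.nodup
              rw [← hB]
              exact Finset.single_le_sum (fun i _ => zero_le) (Finset.mem_univ i₀)
            have := hHe t hn
            rw [show t.labels = B i₀ from ht] at this
            exact this
          exact this (hx i₀)
        obtain ⟨κ, hκ, σ, hσ, hκσ⟩ := Submodule.mem_sup.1 h2
        have h3 : f' (multi m (Function.update x i₀ σ)) = 0 := by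
          refine (mem_cobarC.1 hf'.1.1).1 _ (multi_mem_relSpan m (i := i₀) ?_)
          rwa [Function.update_self]
        rw [← hκσ, MultilinearMap.map_update_add, map_add, h3, add_zero]
        refine hv m B _ hB (fun i => ?_) fun i => ?_
        · by_cases hi : i = i₀
          · subst hi
            rw [Function.update_self]
            exact fun t ht => (hκ.1 ht).1
          · rw [Function.update_of_ne hi]
            exact hx i
        · by_cases hi : i = i₀
          · subst hi
            rw [Function.update_self]
            exact Or.inr hκ
          · rw [Function.update_of_ne hi]
            refine (hxs i).imp_left ?_
            rintro ⟨b, hb, hbB⟩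
            refine ⟨b, (Finset.mem_insert.1 hb).resolve_left ?_, hbB⟩
            rintro rfl
            have := hcount i
            rw [if_neg hi] at this
            exact Multiset.count_eq_zero.1 this hbB
  obtain ⟨f', hf', hff', hv⟩ := key A subset_rfl
  have h1 : f' ∈ (M.cobar A).F ((l : ℤ) - 1) := by
    rintro ⟨l', m, c⟩ ht
    simp only at ht
    rcases (show l ≤ l' by omega).lt_or_eq with hlt | rfl
    · exact hf'.1.2 _ (by simpa using hlt)
    · by_cases hl : labels (⟨l, m, c⟩ : M.Rake) = A.val
      · rw [← multi_single]
        refine hv m (fun i => (c i).labels) _ hl (fun i => ?_) fun i => Or.inl ?_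
        · exact Finsupp.single_mem_supported k _ rfl
        · obtain ⟨a, ha⟩ := Multiset.exists_mem_of_ne_zero (c i).labels_ne_zero
          refine ⟨a, ?_, ha⟩
          rw [← Finset.mem_val, ← hl]
          exact Multiset.mem_sum.2 ⟨i, Finset.mem_univ _, ha⟩
      · exact (mem_cobarC.1 hf'.1.1).2 _ fun h => hl h.1
  rw [← sub_add_cancel f f']
  refine add_mem hff' (Submodule.mem_sup_left ⟨⟨?_, h1⟩, ?_⟩)
  · have := hf'.1.1
    rwa [show (l : ℤ) + q = l - 1 + (q + 1) by ring] at this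
  · have := hf'.2
    rw [show (l : ℤ) - 1 - (1 - 1) = l - 1 by ring]
    exact this

/-- The first term of the spectral sequence is concentrated in the row `q = 0`. -/
theorem Z_le_B_of_ne_zero (hK : P.IsKoszul) (A : Finset ℕ) (p : ℤ) {q : ℤ} (hq : q ≠ 0) :
    (M.cobar A).Z 1 p q ≤ (M.cobar A).B 1 p q := by
  intro f hf
  rcases lt_or_ge p 0 with hp | hp
  · have : f = 0 := by
      ext1 t
      ext1
      exact hf.1.2 t (by omega)
    rw [this]
    exact zero_mem _
  · lift p to ℕ using hp
    refine mem_B_of_vanishing hK hf fun m B x _ hx => ?_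
    refine apply_eq_zero_of_support fun t ht => (mem_cobarC.1 hf.1.1).2 t fun h => hq ?_
    obtain ⟨c, rfl, hc⟩ := mem_support_multi ht
    have h0 : ∑ i, (c i).deg = 0 := Finset.sum_eq_zero fun i _ => ((hx i).1 (hc i)).2
    have h1 := h.2
    simp only [deg, h0] at h1
    push_cast at h1
    omega

end RightModule
end

section

/-! ### Finite dimensionality of quadratic operads of finite type -/

namespace BTree
variable {E : Type v}

theorem card_labels_pos (t : BTree E) : 0 < t.labels.card := by
  induction t with
  | leaf x => simp [labels]
  | node e l r ihl _ => rw [labels, Multiset.card_add]; omega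

/-- The trees all of whose decorations belong to `T`. -/
def Decorated (T : Set E) : BTree E → Prop
  | leaf _ => True
  | node e l r => e ∈ T ∧ l.Decorated T ∧ r.Decorated T

theorem finite_decorated {T : Set E} (hT : T.Finite) (B : Multiset ℕ) :
    {t : BTree E | t.Decorated T ∧ t.labels = B}.Finite := by
  induction hn : B.card using Nat.strong_induction_on generalizing B with
  | _ n ih =>
    classical
    let S : Set (Multiset ℕ × Multiset ℕ) := {s | s.1 + s.2 = B ∧ s.1.card < n ∧ s.2.card < n}
    have hS : S.Finite := Set.Finite.subset (Finset.finite_toSet (Multiset.antidiagonal B).toFinset)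
      fun s hs => by simp [hs.1]
    have h1 : (⋃ s ∈ S, (fun x : E × BTree E × BTree E => node x.1 x.2.1 x.2.2) ''
        (T ×ˢ ({t | t.Decorated T ∧ t.labels = s.1} ×ˢ
          {t | t.Decorated T ∧ t.labels = s.2}))).Finite :=
      hS.biUnion fun s hs => ((hT.prod ((ih _ hs.2.1 _ rfl).prod (ih _ hs.2.2 _ rfl))).image _)
    have h2 : (leaf '' {x | x ∈ B} : Set (BTree E)).Finite :=
      (Set.Finite.subset (Finset.finite_toSet B.toFinset) fun x hx => by simpa using hx).image _
    refine (h1.union h2).subset ?_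
    rintro (x | ⟨e, l, r⟩) ⟨ht, hl⟩
    · refine Or.inr ⟨x, ?_, rfl⟩
      rw [← hl]
      exact Multiset.mem_singleton_self x
    · refine Or.inl (Set.mem_iUnion₂.2 ⟨(l.labels, r.labels), ⟨hl, ?_, ?_⟩, (e, l, r),
        ⟨ht.1, ⟨ht.2.1, rfl⟩, ht.2.2, rfl⟩, rfl⟩)
      all_goals
        have h3 := congrArg Multiset.card hl
        rw [labels, Multiset.card_add] at h3
        have h4 := l.card_labels_pos
        have h5 := r.card_labels_pos
        simp only
        omega

end BTree

namespace QuadData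
variable (D : QuadData.{u, v} k)

/-- The span of all relations among decorated trees. -/
def relSpan : Submodule k (BTree D.E →₀ k) := Submodule.span k {x | D.Rel x}

variable {D}

theorem Rel.homogeneous {x : BTree D.E →₀ k} (h : D.Rel x) :
    ∃ B, ∀ t ∈ x.support, t.labels = B := by
  classical
  induction h with
  | add e e' l r =>
    refine ⟨l.labels + r.labels, fun t ht => ?_⟩
    rcases Finset.mem_union.1 (Finsupp.support_sub ht) with ht | ht
    · rcases Finset.mem_union.1 (Finsupp.support_sub ht) with ht | ht <;>
        rw [Finset.mem_singleton.1 (Finsupp.support_single_subset ht)] <;> rfl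
    · rw [Finset.mem_singleton.1 (Finsupp.support_single_subset ht)]; rfl
  | smul a e l r =>
    refine ⟨l.labels + r.labels, fun t ht => ?_⟩
    rcases Finset.mem_union.1 (Finsupp.support_sub ht) with ht | ht <;>
      rw [Finset.mem_singleton.1 (Finsupp.support_single_subset ht)] <;> rfl
  | swap e l r =>
    refine ⟨l.labels + r.labels, fun t ht => ?_⟩
    rcases Finset.mem_union.1 (Finsupp.support_sub ht) with ht | ht <;>
      rw [Finset.mem_singleton.1 (Finsupp.support_single_subset ht)]
    · exact add_comm _ _
    · rfl
  | rel ρ hρ g =>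
    refine ⟨∑ i, (g i).labels, fun t ht => ?_⟩
    obtain ⟨x, -, rfl⟩ := Finset.mem_image.1 (Finsupp.mapDomain_support ht)
    rw [← Equiv.sum_comp x.2.2 fun i => (g i).labels, Fin.sum_univ_three]
    rfl
  | left e r x hx ih =>
    obtain ⟨B, hB⟩ := ih
    refine ⟨B + r.labels, fun t ht => ?_⟩
    obtain ⟨s, hs, rfl⟩ := Finset.mem_image.1 (Finsupp.mapDomain_support ht)
    rw [BTree.labels, hB s hs]
  | right e l x hx ih =>
    obtain ⟨B, hB⟩ := ih
    refine ⟨l.labels + B, fun t ht => ?_⟩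
    obtain ⟨s, hs, rfl⟩ := Finset.mem_image.1 (Finsupp.mapDomain_support ht)
    rw [BTree.labels, hB s hs]

theorem mapDomain_left_mem (e : D.E) (r : BTree D.E) {x : BTree D.E →₀ k} (hx : x ∈ D.relSpan) :
    Finsupp.lmapDomain k k (fun t => .node e t r) x ∈ D.relSpan :=
  (Submodule.span_le.2 fun z hz => Submodule.subset_span (.left e r z hz) :
    D.relSpan ≤ D.relSpan.comap (Finsupp.lmapDomain k k fun t => .node e t r)) hx

theorem mapDomain_right_mem (e : D.E) (l : BTree D.E) {x : BTree D.E →₀ k}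
    (hx : x ∈ D.relSpan) : Finsupp.lmapDomain k k (fun t => .node e l t) x ∈ D.relSpan :=
  (Submodule.span_le.2 fun z hz => Submodule.subset_span (.right e l z hz) :
    D.relSpan ≤ D.relSpan.comap (Finsupp.lmapDomain k k fun t => .node e l t)) hx

/-- The class of a tree whose root vertex is decorated by `e`, as a linear function of `e`. -/
def nodeLin (l r : BTree D.E) : D.E →ₗ[k] (BTree D.E →₀ k) ⧸ D.relSpan where
  toFun e := D.relSpan.mkQ (.single (.node e l r) 1)
  map_add' e e' := by
    rw [← map_add, ← sub_eq_zero, ← map_sub, Submodule.mkQ_apply, Submodule.Quotient.mk_eq_zero,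
      ← sub_sub]
    exact Submodule.subset_span (Rel.add e e' l r)
  map_smul' a e := by
    rw [RingHom.id_apply, ← map_smul, ← sub_eq_zero, ← map_sub, Submodule.mkQ_apply,
      Submodule.Quotient.mk_eq_zero, Finsupp.smul_single, smul_eq_mul, mul_one]
    exact Submodule.subset_span (Rel.smul a e l r)

theorem single_mem_sup_span_decorated {T : Set D.E} (hT : Submodule.span k T = ⊤)
    (t : BTree D.E) : Finsupp.single t 1 ∈ D.relSpan ⊔
      Submodule.span k ((fun s => Finsupp.single s (1 : k)) ''
        {s : BTree D.E | s.Decorated T ∧ s.labels = t.labels}) := by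
  induction t with
  | leaf x =>
    exact Submodule.mem_sup_right (Submodule.subset_span ⟨.leaf x, ⟨trivial, rfl⟩, rfl⟩)
  | node e l r ihl ihr =>
    set W := D.relSpan ⊔ Submodule.span k ((fun s => Finsupp.single s (1 : k)) ''
        {s : BTree D.E | s.Decorated T ∧ s.labels = (BTree.node e l r).labels}) with hW
    have h1 : ∀ l' r' : BTree D.E, l'.Decorated T ∧ l'.labels = l.labels →
        r'.Decorated T ∧ r'.labels = r.labels →
        Finsupp.single (BTree.node e l' r') (1 : k) ∈ W := by
      intro l' r' hl hr
      have h2 : (⊤ : Submodule k D.E) ≤ (W.map D.relSpan.mkQ).comap (nodeLin l' r') := by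
        rw [← hT, Submodule.span_le]
        intro e' he'
        refine ⟨.single (.node e' l' r') 1, Submodule.mem_sup_right (Submodule.subset_span
          ⟨.node e' l' r', ⟨⟨he', hl.1, hr.1⟩, ?_⟩, rfl⟩), rfl⟩
        rw [BTree.labels, hl.2, hr.2, BTree.labels]
      obtain ⟨y, hy, hy'⟩ := h2 (Submodule.mem_top (x := e))
      have h3 := (Submodule.Quotient.eq D.relSpan).1 hy'
      rw [← sub_sub_cancel y (.single (.node e l' r') 1)]
      exact sub_mem hy (Submodule.mem_sup_left h3)
    have h2 : ∀ l' : BTree D.E, l'.Decorated T ∧ l'.labels = l.labels →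
        Finsupp.single (BTree.node e l' r) (1 : k) ∈ W := by
      intro l' hl
      have : D.relSpan ⊔ Submodule.span k ((fun s => Finsupp.single s (1 : k)) ''
        {s : BTree D.E | s.Decorated T ∧ s.labels = r.labels}) ≤
          W.comap (Finsupp.lmapDomain k k fun s => .node e l' s) := by
        refine sup_le (fun x hx => Submodule.mem_sup_left (mapDomain_right_mem e l' hx)) ?_
        rw [Submodule.span_le]
        rintro _ ⟨r', hr, rfl⟩
        show Finsupp.mapDomain _ _ ∈ W
        rw [Finsupp.mapDomain_single]
        exact h1 l' r' hl hr
      have := this ihr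
      rwa [Submodule.mem_comap, Finsupp.lmapDomain_apply, Finsupp.mapDomain_single] at this
    have : D.relSpan ⊔ Submodule.span k ((fun s => Finsupp.single s (1 : k)) ''
      {s : BTree D.E | s.Decorated T ∧ s.labels = l.labels}) ≤
        W.comap (Finsupp.lmapDomain k k fun s => .node e s r) := by
      refine sup_le (fun x hx => Submodule.mem_sup_left (mapDomain_left_mem e r hx)) ?_
      rw [Submodule.span_le]
      rintro _ ⟨l', hl, rfl⟩
      show Finsupp.mapDomain _ _ ∈ W
      rw [Finsupp.mapDomain_single]
      exact h2 l' hl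
    have := this ihl
    rwa [Submodule.mem_comap, Finsupp.lmapDomain_apply, Finsupp.mapDomain_single] at this

theorem mk_eq_zero_iff {A : Finset ℕ} (x : D.Raw A) :
    (Submodule.Quotient.mk x : D.Piece A) = 0 ↔ x.mapDomain Subtype.val ∈ D.relSpan :=
  Submodule.Quotient.mk_eq_zero _

theorem finiteDimensional_piece [FiniteDimensional k D.E] (A : Finset ℕ) :
    FiniteDimensional k (D.Piece A) := by
  classical
  obtain ⟨T, hT⟩ := (inferInstance : FiniteDimensional k D.E).fg_top
  have hfin := BTree.finite_decorated T.finite_toSet A.val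
  let Y : Set (D.Raw A) := (fun t : {t : BTree D.E // t.Linear A} => Finsupp.single t 1) ''
    {t | t.1.Decorated (T : Set D.E)}
  have hY : Y.Finite := by
    refine Set.Finite.image _ ?_
    refine Set.Finite.of_finite_image (f := Subtype.val) (hfin.subset ?_)
      Subtype.val_injective.injOn
    rintro _ ⟨t, ht, rfl⟩
    exact ⟨ht, (BTree.linear_iff _ _).1 t.2⟩
  refine ⟨⟨(hY.image (D.relations A).mkQ).toFinset, ?_⟩⟩
  rw [Set.Finite.coe_toFinset, Submodule.span_image, ← top_le_iff]
  have hle : D.relSpan ⊔ Submodule.span k ((fun s => Finsupp.single s (1 : k)) ''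
        {s : BTree D.E | s.Decorated (T : Set D.E) ∧ s.labels = A.val}) ≤
      D.relSpan ⊔ (Submodule.span k Y).map (Finsupp.lmapDomain k k Subtype.val) := by
    refine sup_le_sup_left (Submodule.span_le.2 ?_) _
    rintro _ ⟨s, ⟨hs, hsA⟩, rfl⟩
    refine ⟨.single ⟨s, (BTree.linear_iff _ _).2 hsA⟩ 1, Submodule.subset_span ⟨_, hs, rfl⟩, ?_⟩
    rw [Finsupp.lmapDomain_apply, Finsupp.mapDomain_single]
  have key : ∀ t : {t : BTree D.E // t.Linear A}, (D.relations A).mkQ (.single t 1) ∈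
      (Submodule.span k Y).map (D.relations A).mkQ := by
    intro t
    have h1 := single_mem_sup_span_decorated hT t.1
    rw [(BTree.linear_iff _ _).1 t.2] at h1
    obtain ⟨r, hr, _, ⟨y, hy, rfl⟩, h⟩ := Submodule.mem_sup.1 (hle h1)
    refine ⟨y, hy, ?_⟩
    rw [← sub_eq_zero, ← map_sub, Submodule.mkQ_apply, mk_eq_zero_iff, ← neg_mem_iff]
    convert hr using 1
    rw [← Finsupp.lmapDomain_apply k k, map_sub, neg_sub, Finsupp.lmapDomain_apply k k _ (.single t 1),
      Finsupp.mapDomain_single, ← h, add_sub_cancel_right]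
  rintro x -
  obtain ⟨x, rfl⟩ := Submodule.mkQ_surjective _ x
  rw [← x.sum_single, Finsupp.sum, map_sum]
  refine Submodule.sum_mem _ fun t _ => ?_
  rw [← mul_one (x t), ← smul_eq_mul, ← Finsupp.smul_single, map_smul]
  exact Submodule.smul_mem _ _ (key t)

end QuadData
end

section
variable {P : Operad.{u, v} k}

/-! ### Dual bases of the Koszul dual operad and of the cycles of degree zero -/

theorem labels_eq_of_btreePair_ne_zero (t : BTree (Module.Dual k (P.obj (Fin 2)))) (s : PTree P)
    (h : btreePair t s ≠ 0) : t.labels = s.labels ∧ s.deg = 0 := by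
  induction t generalizing s with
  | leaf x =>
    cases s with
    | leaf y =>
      rw [btreePair, ne_eq, ite_eq_right_iff, Classical.not_imp] at h
      rw [h.1]
      exact ⟨rfl, rfl⟩
    | node n p c => simp [btreePair] at h
  | node φ l r ihl ihr =>
    cases s with
    | leaf y => simp [btreePair] at h
    | node n p c =>
      cases n with
      | succ n => simp [btreePair] at h
      | zero =>
        rw [PTree.labels, PTree.deg, BTree.labels]
        change _ = ∑ i : Fin 2, _ ∧ 0 + ∑ i : Fin 2, _ = 0
        rw [Fin.sum_univ_two, Fin.sum_univ_two]
        rw [btreePair] at h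
        by_cases h0 : φ p * btreePair l (c 0) * btreePair r (c 1) = 0
        · rw [h0, zero_sub, neg_ne_zero] at h
          obtain ⟨h1, h2⟩ := ihl _ (right_ne_zero_of_mul (left_ne_zero_of_mul h))
          obtain ⟨h3, h4⟩ := ihr _ (right_ne_zero_of_mul h)
          exact ⟨by rw [h1, h3, add_comm], by rw [h2, h4]; rfl⟩
        · obtain ⟨h1, h2⟩ := ihl _ (right_ne_zero_of_mul (left_ne_zero_of_mul h0))
          obtain ⟨h3, h4⟩ := ihr _ (right_ne_zero_of_mul h0)
          exact ⟨by rw [h1, h3], by rw [h2, h4]; rfl⟩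

theorem btreeElt_single (t : BTree (Module.Dual k (P.obj (Fin 2)))) (s : PTree P) :
    btreeElt t (.single s 1) = btreePair t s := by
  simp [btreeElt]

theorem btreeElt_eq_zero_of_labels_ne {t : BTree (Module.Dual k (P.obj (Fin 2)))}
    {B : Multiset ℕ} (h : t.labels ≠ B) {x : PTree P →₀ k}
    (hx : x ∈ Finsupp.supported k k {s | s.labels = B ∧ s.deg = 0}) : btreeElt t x = 0 := by
  refine linearMap_congr_support (f := btreeElt t) (g := 0) fun s hs => ?_
  rw [btreeElt_single, LinearMap.zero_apply]
  by_contra hc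
  exact h ((labels_eq_of_btreePair_ne_zero t s hc).1.trans (hx hs).1)

theorem exists_comp_eq_of_ker_le {V W : Type*} [AddCommGroup V] [Module k V] [AddCommGroup W]
    [Module k W] (φ : V →ₗ[k] W) (f : V →ₗ[k] k) (h : ∀ x, φ x = 0 → f x = 0) :
    ∃ g : W →ₗ[k] k, g ∘ₗ φ = f := by
  have : f ∈ LinearMap.range φ.dualMap := by
    rw [LinearMap.range_dualMap_eq_dualAnnihilator_ker, Submodule.mem_dualAnnihilator]
    exact h
  exact this

/-- The pairing of combinations of trees decorated by `P(2)^*` with combinations of trees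
decorated by `P`. -/
def btreeMap (P : Operad.{u, v} k) :
    (BTree P.dualData.E →₀ k) →ₗ[k] Module.Dual k (PTree P →₀ k) :=
  Finsupp.linearCombination k btreeElt

theorem btreeMap_single (t : BTree P.dualData.E) : btreeMap P (.single t 1) = btreeElt t := by
  simp [btreeMap]

theorem Operad.mem_cobar_iff_vanishing {A : Finset ℕ} {f : Module.Dual k (PTree P →₀ k)}
    (hf : f ∈ P.cobar A 0) :
    (∃ g ∈ P.cobar A 1, P.cobarD g = f) ↔ ∀ x ∈ PTree.cycles P A.val, f x = 0 := by
  constructor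
  · rintro ⟨g, hg, rfl⟩ x hx
    exact (mem_cobar.1 hg).1 _ hx.2
  · intro h
    set S := PTree.relSpan P
    let W := Finsupp.supported k k {t : PTree P | t.labels = A.val ∧ t.deg = 0}
    let φ : W →ₗ[k] (PTree P →₀ k) ⧸ S := S.mkQ ∘ₗ PTree.deltaMap P ∘ₗ W.subtype
    obtain ⟨g, hg⟩ := exists_comp_eq_of_ker_le φ (f ∘ₗ W.subtype) fun (w : W) hw =>
      h w.1 ⟨w.2, (Submodule.Quotient.mk_eq_zero S).1 hw⟩
    have h1 := comp_part_mem_cobar (P := P) (f := g ∘ₗ S.mkQ) (fun x hx => by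
      rw [LinearMap.comp_apply, Submodule.mkQ_apply, (Submodule.Quotient.mk_eq_zero S).2 hx,
        map_zero]) A 1
    refine ⟨_, h1, ?_⟩
    ext1 t
    ext1
    show g (S.mkQ (PTree.part A.val 1 (PTree.deltaMap P (.single t 1)))) = f (.single t 1)
    rw [← zero_add 1, ← PTree.deltaMap_part]
    by_cases ht : t.labels = A.val ∧ t.deg = 0
    · rw [PTree.part_of_forall fun s hs => by
        rwa [Finset.mem_singleton.1 (Finsupp.support_single_subset hs)]]
      exact LinearMap.congr_fun hg ⟨.single t 1, Finsupp.single_mem_supported k _ ht⟩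
    · rw [PTree.part_of_forall_not fun s hs => by
        rwa [Finset.mem_singleton.1 (Finsupp.support_single_subset hs)], map_zero, map_zero,
        map_zero, (mem_cobar.1 hf).2 t fun h => ht ⟨h.1, by exact_mod_cast h.2⟩]

theorem Operad.IsKoszul.exists_pi (hK : P.IsKoszul) {A : Finset ℕ} (hA : A.Nonempty) :
    ∃ (elt : P.dualData.Raw A →ₗ[k] P.cobar A 0) (π : P.cobar A 0 →ₗ[k] P.dualData.Piece A),
      (∀ y, (elt y : Module.Dual k (PTree P →₀ k)) = btreeMap P (y.mapDomain Subtype.val)) ∧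
      (∀ y, π (elt y) = Submodule.Quotient.mk y) ∧
      ∀ f, π f = 0 ↔ ∀ x ∈ PTree.cycles P A.val, f.1 x = 0 := by
  obtain ⟨⟨π, hπ, -, hker⟩, -⟩ := hK A hA
  choose hmem hcls using hπ
  refine ⟨Finsupp.linearCombination k fun t => ⟨btreeElt t.1, hmem t⟩, π, fun y => ?_, fun y => ?_,
    fun f => (hker f).trans (mem_cobar_iff_vanishing f.2)⟩
  · have : (P.cobar A 0).subtype ∘ₗ (Finsupp.linearCombination k
        fun t : {t : BTree P.dualData.E // t.Linear A} => ⟨btreeElt t.1, hmem t⟩) =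
        btreeMap P ∘ₗ Finsupp.lmapDomain k k Subtype.val := by
      ext1 t
      ext1
      simp [btreeMap]
    exact LinearMap.congr_fun this y
  · have : π ∘ₗ (Finsupp.linearCombination k
        fun t : {t : BTree P.dualData.E // t.Linear A} => ⟨btreeElt t.1, hmem t⟩) =
        (P.dualData.relations A).mkQ := by
      ext1 t
      ext1
      simp only [LinearMap.comp_apply, Finsupp.lsingle_apply, Finsupp.linearCombination_single,
        one_smul, hcls]
      rfl
    exact LinearMap.congr_fun this y

theorem btreeElt_mem_cobar (hK : P.IsKoszul) {A : Finset ℕ} {t : BTree P.dualData.E}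
    (ht : t.labels = A.val) : btreeElt t ∈ P.cobar A 0 := by
  have hA : A.Nonempty := by
    rw [← Finset.card_pos, Finset.card_def, ← ht]
    exact t.card_labels_pos
  obtain ⟨⟨π, hπ, -, -⟩, -⟩ := hK A hA
  exact (hπ ⟨t, (t.linear_iff A).2 ht⟩).1

theorem mapDomain_subtypeDomain {α : Type*} (p : α → Prop) {x : α →₀ k}
    (h : ∀ t ∈ x.support, p t) :
    (x.subtypeDomain p).mapDomain Subtype.val = x := by
  classical
  ext a
  by_cases ha : p a
  · exact (Finsupp.mapDomain_apply Subtype.val_injective _ (⟨a, ha⟩ : Subtype p)).trans rfl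
  · rw [Finsupp.mapDomain_of_notMem_range, eq_comm]
    · by_contra hc
      exact ha (h a (Finsupp.mem_support_iff.2 hc))
    · rintro ⟨⟨b, hb⟩, rfl⟩
      exact ha hb

theorem btreeMap_eq_zero_of_mem (hK : P.IsKoszul) {y : BTree P.dualData.E →₀ k}
    (hy : y ∈ P.dualData.relSpan) {B : Finset ℕ} {x : PTree P →₀ k}
    (hx : x ∈ PTree.cycles P B.val) : btreeMap P y x = 0 := by
  have : P.dualData.relSpan ≤ LinearMap.ker ((btreeMap P).flip x) := by
    refine Submodule.span_le.2 fun y hy => ?_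
    show btreeMap P y x = 0
    obtain ⟨B', hB'⟩ := QuadData.Rel.homogeneous hy
    by_cases h : B' = B.val ∧ B.Nonempty
    · obtain ⟨rfl, hB⟩ := h
      obtain ⟨elt, π, h1, h2, h3⟩ := hK.exists_pi hB
      have h4 := mapDomain_subtypeDomain (fun t : BTree P.dualData.E => t.Linear B) (x := y)
        fun t ht => (t.linear_iff B).2 (hB' t ht)
      rw [← h4, ← h1]
      refine (h3 _).1 ?_ x hx
      rw [h2, QuadData.mk_eq_zero_iff, h4]
      exact Submodule.subset_span hy
    · refine linearMap_congr_support (f := (btreeMap P).flip x) (g := 0) fun t ht => ?_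
      rw [LinearMap.flip_apply, btreeMap_single, LinearMap.zero_apply]
      refine btreeElt_eq_zero_of_labels_ne (fun hl => h ⟨(hB' t ht).symm.trans hl, ?_⟩) hx.1
      rw [← Finset.card_pos, Finset.card_def, ← hl]
      exact t.card_labels_pos
  exact this hy

theorem exists_frame_of_nonempty (hK : P.IsKoszul) (hP : P.FiniteType) {B : Finset ℕ}
    (hB : B.Nonempty) :
    ∃ (n : ℕ) (y : Fin n → BTree P.dualData.E) (v : Fin n → PTree P →₀ k),
      (∀ i, (y i).labels = B.val) ∧ (∀ i, v i ∈ PTree.cycles P B.val) ∧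
      (∀ i j, btreeElt (y i) (v j) = if i = j then 1 else 0) ∧
      PTree.cycles P B.val ≤ Submodule.span k (Set.range v) ⊔ PTree.relSpan P ∧
      ∀ t : BTree P.dualData.E, t.labels = B.val → Finsupp.single t 1 ∈
        Submodule.span k (Set.range fun i => Finsupp.single (y i) (1 : k)) ⊔
          P.dualData.relSpan := by
  classical
  have : FiniteDimensional k (P.obj (Fin 2)) := hP _
  have : FiniteDimensional k P.dualData.E :=
    inferInstanceAs (FiniteDimensional k (Module.Dual k (P.obj (Fin 2))))
  have := QuadData.finiteDimensional_piece (D := P.dualData) B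
  obtain ⟨elt, π, helt, hπ, hker⟩ := hK.exists_pi hB
  let cl : {t : BTree P.dualData.E // t.Linear B} → P.dualData.Piece B :=
    fun t => Submodule.Quotient.mk (.single t 1)
  have hspan : ⊤ ≤ Submodule.span k (Set.range cl) := by
    rintro x -
    obtain ⟨x, rfl⟩ := Submodule.mkQ_surjective _ x
    rw [← x.sum_single, Finsupp.sum, map_sum]
    refine Submodule.sum_mem _ fun t _ => ?_
    rw [← mul_one (x t), ← smul_eq_mul, ← Finsupp.smul_single, map_smul]
    exact Submodule.smul_mem _ _ (Submodule.subset_span ⟨t, rfl⟩)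
  let b₀ := Module.Basis.ofSpan hspan
  have := Module.Finite.finite_basis b₀
  obtain ⟨n, ⟨en⟩⟩ := Finite.exists_equiv_fin (α := (linearIndepOn_empty k id).extend
    (Set.empty_subset (Set.range cl)))
  let b : Module.Basis (Fin n) k (P.dualData.Piece B) := b₀.reindex en
  have hb : ∀ i, ∃ t, cl t = b i := fun i => by
    have h1 : b i ∈ Set.range b₀ := ⟨en.symm i, (b₀.reindex_apply en i).symm⟩
    exact Module.Basis.ofSpan_subset hspan h1
  choose y hy using hb
  have helt1 : ∀ t, (elt (.single t 1) : Module.Dual k (PTree P →₀ k)) = btreeElt t.1 := fun t => by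
    rw [helt, Finsupp.mapDomain_single, btreeMap_single]
  -- the combination of the `y i` with the same class as a given combination
  have hval : ∀ (z : P.dualData.Raw B) (c : Fin n → k),
      (Submodule.Quotient.mk z : P.dualData.Piece B) = ∑ i, c i • b i →
      ∀ x ∈ PTree.cycles P B.val, (elt z).1 x = ∑ i, c i * btreeElt (y i).1 x := by
    intro z c hz x hx
    have h1 : π (elt (z - ∑ i, c i • .single (y i) 1)) = 0 := by
      rw [map_sub, map_sub, hπ, hz, map_sum, map_sum, sub_eq_zero]
      refine Finset.sum_congr rfl fun i _ => ?_
      rw [map_smul, map_smul, hπ, ← hy]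
    have h2 := (hker _).1 h1 x hx
    rw [map_sub, map_sum] at h2
    rw [AddSubgroupClass.coe_sub, LinearMap.sub_apply, sub_eq_zero] at h2
    rw [h2, AddSubmonoidClass.coe_finsetSum, LinearMap.sum_apply]
    refine Finset.sum_congr rfl fun i _ => ?_
    rw [map_smul, Submodule.coe_smul, helt1, LinearMap.smul_apply, smul_eq_mul]
  let ev : PTree.cycles P B.val →ₗ[k] (Fin n → k) :=
    LinearMap.pi fun i => btreeElt (y i).1 ∘ₗ (PTree.cycles P B.val).subtype
  have hev : Function.Surjective ev := by
    rw [← LinearMap.range_eq_top]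
    by_contra hc
    obtain ⟨ℓ, hℓ, hℓ'⟩ := Submodule.exists_le_ker_of_lt_top _ (lt_top_iff_ne_top.2 hc)
    have h0 : ∀ w : Fin n → k, ℓ w = ∑ i, ℓ (Pi.single i 1) * w i := fun w => by
      conv_lhs => rw [← Finset.univ_sum_single w, map_sum]
      refine Finset.sum_congr rfl fun i _ => ?_
      rw [← mul_one (w i), ← smul_eq_mul, Pi.single_smul, map_smul, smul_eq_mul, smul_eq_mul,
        mul_one, mul_comm]
    have h1 : π (elt (∑ i, ℓ (Pi.single i 1) • .single (y i) 1)) = 0 := by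
      refine (hker _).2 fun x hx => ?_
      have h2 : ℓ (ev ⟨x, hx⟩) = 0 := hℓ' ⟨_, rfl⟩
      rw [h0] at h2
      rw [hval _ (fun i => ℓ (Pi.single i 1)) ?_ x hx]
      · exact h2
      · rw [← Submodule.mkQ_apply, map_sum]
        refine Finset.sum_congr rfl fun i _ => ?_
        rw [map_smul, ← hy]
        rfl
    rw [hπ, ← Submodule.mkQ_apply, map_sum] at h1
    have h2 := Fintype.linearIndependent_iff.1 b.linearIndependent
      (fun i => ℓ (Pi.single i 1)) (by
        rw [← h1]
        refine Finset.sum_congr rfl fun i _ => ?_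
        rw [map_smul, ← hy]
        rfl)
    refine hℓ (LinearMap.ext fun w => ?_)
    rw [h0, LinearMap.zero_apply]
    exact Finset.sum_eq_zero fun i _ => by rw [h2, zero_mul]
  choose v hv using fun i : Fin n => hev (Pi.single i 1)
  have hyv : ∀ i j, btreeElt (y i).1 (v j).1 = if i = j then 1 else 0 := fun i j => by
    have := congrFun (hv j) i
    rw [Pi.single_apply] at this
    exact this
  refine ⟨n, fun i => (y i).1, fun i => (v i).1, fun i => ((y i).1.linear_iff B).1 (y i).2,
    fun i => (v i).2, hyv, fun x hx => ?_, fun t ht => ?_⟩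
  · have hin : ∑ i, btreeElt (y i).1 x • (v i).1 ∈
        Submodule.span k (Set.range fun i => (v i).1) :=
      Submodule.sum_mem _ fun i _ => Submodule.smul_mem _ _ (Submodule.subset_span ⟨i, rfl⟩)
    rw [← add_sub_cancel (∑ i, btreeElt (y i).1 x • (v i).1) x]
    refine add_mem (Submodule.mem_sup_left hin) (Submodule.mem_sup_right ?_)
    set x' := x - ∑ i, btreeElt (y i).1 x • (v i).1 with hx'
    have hx'c : x' ∈ PTree.cycles P B.val :=
      sub_mem hx (Submodule.sum_mem _ fun i _ => Submodule.smul_mem _ _ (v i).2)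
    have hx'0 : ∀ i, btreeElt (y i).1 x' = 0 := fun i => by
      rw [hx', map_sub, map_sum, Finset.sum_eq_single i]
      · rw [map_smul, hyv, if_pos rfl, smul_eq_mul, mul_one, sub_self]
      · intro j _ hj
        rw [map_smul, hyv, if_neg hj.symm, smul_zero]
      · exact fun h => (h (Finset.mem_univ _)).elim
    by_contra hc
    obtain ⟨f, hf, hf'⟩ := Submodule.exists_le_ker_of_notMem hc
    have hfC : f ∘ₗ PTree.part B.val 0 ∈ P.cobar B 0 :=
      Operad.comp_part_mem_cobar (P := P) (f := f) (fun x hx => hf' hx) B 0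
    let F : P.cobar B 0 := ⟨_, hfC⟩
    obtain ⟨z, hz⟩ := Submodule.mkQ_surjective _ (π F)
    have h1 : π (F - elt z) = 0 := by
      refine (LinearMap.map_sub π F (elt z)).trans ?_
      rw [hπ, sub_eq_zero, ← hz]
      rfl
    have h2 := (hker _).1 h1 x' hx'c
    rw [AddSubgroupClass.coe_sub, LinearMap.sub_apply, hval z (fun i => b.repr (π F) i) (by
      rw [b.sum_repr]; exact hz) x' hx'c, Finset.sum_eq_zero fun i _ => by rw [hx'0, mul_zero],
      sub_zero] at h2
    apply hf
    change f (PTree.part B.val 0 x') = 0 at h2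
    rwa [PTree.part_of_forall fun s hs => hx'c.1 hs] at h2
  · set c := b.repr (cl ⟨t, (t.linear_iff B).2 ht⟩) with hc
    have h1 : (Submodule.Quotient.mk (.single ⟨t, (t.linear_iff B).2 ht⟩ 1 -
        ∑ i, c i • .single (y i) 1) : P.dualData.Piece B) = 0 := by
      rw [← Submodule.mkQ_apply, map_sub, sub_eq_zero, map_sum]
      refine (b.sum_repr (cl ⟨t, (t.linear_iff B).2 ht⟩)).symm.trans ?_
      refine Finset.sum_congr rfl fun i _ => ?_
      rw [map_smul, ← hy]
      rfl
    rw [QuadData.mk_eq_zero_iff, ← Finsupp.lmapDomain_apply k k, map_sub,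
      Finsupp.lmapDomain_apply k k _ (.single _ _), Finsupp.mapDomain_single] at h1
    rw [← add_sub_cancel (Finsupp.lmapDomain k k Subtype.val
      (∑ i, c i • Finsupp.single (y i) (1 : k))) (.single t 1)]
    refine add_mem (Submodule.mem_sup_left ?_) (Submodule.mem_sup_right h1)
    rw [map_sum]
    refine Submodule.sum_mem _ fun i _ => ?_
    rw [map_smul, Finsupp.lmapDomain_apply, Finsupp.mapDomain_single]
    exact Submodule.smul_mem _ _ (Submodule.subset_span ⟨i, rfl⟩)

theorem exists_frame (hK : P.IsKoszul) (hP : P.FiniteType) (B : Finset ℕ) :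
    ∃ (n : ℕ) (y : Fin n → BTree P.dualData.E) (v : Fin n → PTree P →₀ k),
      (∀ i, (y i).labels = B.val) ∧ (∀ i, v i ∈ PTree.cycles P B.val) ∧
      (∀ i j, btreeElt (y i) (v j) = if i = j then 1 else 0) ∧
      PTree.cycles P B.val ≤ Submodule.span k (Set.range v) ⊔ PTree.relSpan P ∧
      ∀ t : BTree P.dualData.E, t.labels = B.val → Finsupp.single t 1 ∈
        Submodule.span k (Set.range fun i => Finsupp.single (y i) (1 : k)) ⊔
          P.dualData.relSpan := by
  rcases B.eq_empty_or_nonempty with rfl | hB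
  · refine ⟨0, Fin.elim0, Fin.elim0, fun i => i.elim0, fun i => i.elim0, fun i => i.elim0,
      fun x hx => ?_, fun t ht => ?_⟩
    · have : x = 0 := by
        rw [← Finsupp.support_eq_empty, Finset.eq_empty_iff_forall_notMem]
        exact fun t ht => t.labels_ne_zero (hx.1 ht).1
      rw [this]
      exact zero_mem _
    · have := t.card_labels_pos
      rw [ht] at this
      exact (lt_irrefl _ this).elim
  · exact exists_frame_of_nonempty hK hP hB
end

section
variable {P : Operad.{u, v} k}

/-! ### Evaluation of functionals on families of cycles -/

theorem permSign_zero {n : ℕ} (σ : Equiv.Perm (Fin n)) :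
    permSign σ (fun _ => 0) = (Equiv.Perm.sign σ : ℤ) := by
  rw [Equiv.Perm.sign_eq_prod_prod_Ioi, permSign]
  push_cast
  refine Finset.prod_congr rfl fun i _ => ?_
  rw [← Finset.prod_filter_mul_prod_filter_not Finset.univ (fun j => i < j)]
  rw [Finset.prod_eq_one (s := Finset.univ.filter fun j => ¬ i < j) fun j hj => by
    rw [if_neg fun h => (Finset.mem_filter.1 hj).2 h.1], mul_one]
  refine Finset.prod_congr (by ext; simp) fun j hj => ?_
  have hij : i < j := Finset.mem_Ioi.1 hj
  have : σ i ≠ σ j := σ.injective.ne hij.ne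
  rcases lt_or_gt_of_ne this with h | h
  · rw [if_neg fun h' => lt_asymm h h'.2, if_pos h]; simp
  · rw [if_pos ⟨hij, h⟩, if_neg (lt_asymm h)]; simp

namespace RightModule
variable {M : RightModule P} {l : ℕ}
open Rake

/-- The value of `f` at `⟨l, m, x⟩`, as a linear function of `m`. -/
def evalRoot (f : Module.Dual k (M.Rake →₀ k)) (hf : ∀ z ∈ relSpan M, f z = 0)
    (x : Fin (l + 1) → PTree P →₀ k) : M.obj (Fin (l + 1)) →ₗ[k] k where
  toFun m := f (multi m x)
  map_add' m m' := by
    have : f.compMultilinearMap (multi (m + m')) =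
        f.compMultilinearMap (multi m) + f.compMultilinearMap (multi m') :=
      multilinearMap_finsupp_ext fun c => by
        rw [add_apply]
        simp only [LinearMap.compMultilinearMap_apply, multi_single]
        rw [← sub_eq_zero, ← sub_sub, ← map_sub, ← map_sub]
        exact hf _ (Submodule.subset_span (Rel.add l m m' c))
    exact congrArg (· x) this
  map_smul' a m := by
    have : f.compMultilinearMap (multi (a • m)) = a • f.compMultilinearMap (multi m) :=
      multilinearMap_finsupp_ext fun c => by
        rw [smul_apply]
        simp only [LinearMap.compMultilinearMap_apply, multi_single]
        rw [← sub_eq_zero, ← map_smul, ← map_sub, Finsupp.smul_single, smul_eq_mul, mul_one]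
        exact hf _ (Submodule.subset_span (Rel.smul l a m c))
    exact congrArg (· x) this

theorem apply_multi_perm {f : Module.Dual k (M.Rake →₀ k)} (hf : ∀ z ∈ relSpan M, f z = 0)
    (σ : Equiv.Perm (Fin (l + 1))) (m : M.obj (Fin (l + 1))) {x : Fin (l + 1) → PTree P →₀ k}
    (hx : ∀ i, x i ∈ Finsupp.supported k k {t | t.deg = 0}) :
    f (multi (M.map σ m) (x ∘ σ.symm)) = ((Equiv.Perm.sign σ : ℤ) : k) * f (multi m x) := by
  rw [← sub_eq_zero]
  refine multilinearMap_eq_zero_of_span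
    ((f.compMultilinearMap (multi (M.map σ m))).domDomCongr σ.symm -
      ((Equiv.Perm.sign σ : ℤ) : k) • f.compMultilinearMap (multi m))
    (fun _ => (fun t => .single t 1) '' {t : PTree P | t.deg = 0}) (fun y hy => ?_) x fun i => ?_
  · choose c hc hcy using hy
    obtain rfl : (fun i => .single (c i) 1) = y := funext hcy
    rw [sub_apply, smul_apply, MultilinearMap.domDomCongr_apply]
    simp only [LinearMap.compMultilinearMap_apply]
    rw [multi_single, multi_single, ← map_smul, ← map_sub,
      Finsupp.smul_single, smul_eq_mul, mul_one, ← permSign_zero,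
      ← show (fun i => (c i).deg) = fun _ => 0 from funext hc]
    exact hf _ (Submodule.subset_span (Rel.perm l σ m c))
  · rw [← Finsupp.supported_eq_span_single]
    exact hx i

/-- Boundaries vanish on families of cycles. -/
theorem apply_multi_eq_zero_of_mem_B {A : Finset ℕ} {q : ℤ} {f : Module.Dual k (M.Rake →₀ k)}
    (hf : f ∈ (M.cobar A).B 1 l q) (m : M.obj (Fin (l + 1))) {x : Fin (l + 1) → PTree P →₀ k}
    (hx : ∀ i, x i ∈ Finsupp.supported k k {t | t.deg = 0})
    (hδ : ∀ i, PTree.deltaMap P (x i) ∈ PTree.relSpan P) : f (multi m x) = 0 := by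
  obtain ⟨f₁, hf₁, _, ⟨g, hg, rfl⟩, rfl⟩ := Submodule.mem_sup.1 hf
  have h1 : ∀ t ∈ (multi m x).support, t.1 = l := fun t ht => by
    obtain ⟨c, rfl, -⟩ := mem_support_multi ht
    rfl
  have h2 : f₁ (multi m x) = 0 := by
    refine apply_eq_zero_of_support fun t ht => hf₁.1.2 t ?_
    rw [h1 t ht]
    omega
  have hgF : ∀ t : M.Rake, l < t.1 → g (.single t 1) = 0 := fun t ht => hg.1.2 t (by omega)
  have hgS := (mem_cobarC.1 hg.1.1).1
  have h3 : g (rootDelta M (multi m x)) = 0 := by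
    refine linearMap_congr_support (f := g ∘ₗ rootDelta M) (g := 0) fun t ht => ?_
    refine linearMap_congr_support (f := g) (g := 0) fun s hs => hgF s ?_
    have := mem_support_rootDelta hs
    rwa [h1 t ht] at this
  have h4 : g (childSum M (fun _ => 1) (PTree.deltaMap P) (multi m x)) =
      ∑ i, (-1 : k) ^ l * g (multi m (Function.update x i (PTree.deltaMap P (x i)))) := by
    have hu : ∀ (x : Fin (l + 1) → PTree P →₀ k) i, Function.update x i (PTree.deltaMap P (x i)) =
        fun j => Function.update (fun _ => LinearMap.id) i (PTree.deltaMap P) j (x j) :=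
      fun x i => by
        ext1 j
        by_cases hj : j = i
        · subst hj; simp
        · simp [hj]
    rw [← sub_eq_zero]
    simp only [hu]
    have hsum : ∀ x : Fin (l + 1) → PTree P →₀ k, (∑ i, (-1 : k) ^ l •
        (g.compMultilinearMap (multi m)).compLinearMap
          (fun j => Function.update (fun _ => LinearMap.id) i (PTree.deltaMap P) j)) x =
        ∑ i, (-1 : k) ^ l * g (multi m
          fun j => Function.update (fun _ => LinearMap.id) i (PTree.deltaMap P) j (x j)) :=
      fun x => by rw [sum_apply]; rfl
    rw [← hsum]
    refine multilinearMap_eq_zero_of_span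
      ((g ∘ₗ childSum M (fun _ => 1) (PTree.deltaMap P)).compMultilinearMap (multi m) -
        ∑ i, (-1 : k) ^ l • (g.compMultilinearMap (multi m)).compLinearMap
          (fun j => Function.update (fun _ => LinearMap.id) i (PTree.deltaMap P) j))
      (fun _ => (fun t => .single t 1) '' {t : PTree P | t.deg = 0}) (fun y hy => ?_) x fun i => ?_
    · choose c hc hcy using hy
      obtain rfl : (fun i => .single (c i) 1) = y := funext hcy
      rw [sub_apply, hsum]
      simp only [LinearMap.compMultilinearMap_apply, ← hu]
      rw [multi_single, LinearMap.comp_apply, ← of_refl, childSum_of, map_sum, sub_eq_zero]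
      refine Finset.sum_congr rfl fun i _ => ?_
      rw [multi_update_single, map_smul, smul_eq_mul, one_mul]
      congr 2
      rw [show (fun y => (c y).deg) = fun _ => 0 from funext hc]
      simp [degBefore]
    · rw [← Finsupp.supported_eq_span_single]
      exact hx i
  rw [LinearMap.add_apply, h2, zero_add, cobar_D_apply, deltaMap_eq, LinearMap.add_apply, map_add,
    h3, zero_add, h4]
  refine Finset.sum_eq_zero fun i _ => ?_
  rw [hgS _ (multi_mem_relSpan m (i := i) (by rw [Function.update_self]; exact hδ i)), mul_zero]

/-! ### Symbols -/

theorem symElt_single (z : M.DualSym l) (m : M.obj (Fin (l + 1))) (c : Fin (l + 1) → PTree P) :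
    M.symElt z (.single ⟨l, m, c⟩ 1) = ∑ σ : Equiv.Perm (Fin (l + 1)),
      ((Equiv.Perm.sign σ : ℤ) : k) * z.1 (M.map σ m) * ∏ i, btreePair (z.2 (σ i)) (c i) := by
  rw [symElt, Finsupp.linearCombination_single, one_smul, symPair, dif_pos rfl]

theorem symElt_single_of_ne (z : M.DualSym l) {t : M.Rake} (h : t.1 ≠ l) :
    M.symElt z (.single t 1) = 0 := by
  obtain ⟨l', x⟩ := t
  rw [symElt, Finsupp.linearCombination_single, one_smul, symPair, dif_neg h]

theorem symElt_multi (z : M.DualSym l) (m : M.obj (Fin (l + 1)))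
    (x : Fin (l + 1) → PTree P →₀ k) :
    M.symElt z (multi m x) = ∑ σ : Equiv.Perm (Fin (l + 1)),
      ((Equiv.Perm.sign σ : ℤ) : k) * z.1 (M.map σ m) * ∏ i, btreeElt (z.2 (σ i)) (x i) := by
  have h : ∀ x : Fin (l + 1) → PTree P →₀ k, (∑ σ : Equiv.Perm (Fin (l + 1)),
      (((Equiv.Perm.sign σ : ℤ) : k) * z.1 (M.map σ m)) •
        (MultilinearMap.mkPiAlgebra k (Fin (l + 1)) k).compLinearMap
          fun i => btreeElt (z.2 (σ i))) x = ∑ σ : Equiv.Perm (Fin (l + 1)),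
      ((Equiv.Perm.sign σ : ℤ) : k) * z.1 (M.map σ m) * ∏ i, btreeElt (z.2 (σ i)) (x i) :=
    fun x => by
      rw [sum_apply]
      refine Finset.sum_congr rfl fun σ _ => ?_
      rw [smul_apply, MultilinearMap.compLinearMap_apply, MultilinearMap.mkPiAlgebra_apply,
        smul_eq_mul]
  rw [← h]
  refine congrArg (fun g : MultilinearMap k _ k => g x)
    (multilinearMap_finsupp_ext (f := (M.symElt z).compMultilinearMap (multi m)) fun c => ?_)
  rw [h, LinearMap.compMultilinearMap_apply, multi_single, symElt_single]
  simp only [btreeElt_single]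

/-- Evaluation of combinations of symbols. -/
def symMap (M : RightModule P) (l : ℕ) : (M.DualSym l →₀ k) →ₗ[k] Module.Dual k (M.Rake →₀ k) :=
  Finsupp.linearCombination k M.symElt

theorem symMap_single (z : M.DualSym l) : symMap M l (.single z 1) = M.symElt z := by
  simp [symMap]

theorem symMap_single_smul (z : M.DualSym l) (a : k) :
    symMap M l (.single z a) = a • M.symElt z := by
  simp [symMap]

/-- The span of the relations between symbols. -/
def symRelSpan (M : RightModule P) (l : ℕ) : Submodule k (M.DualSym l →₀ k) :=
  Submodule.span k {x | P.dualData.SymRel (M.susDualAct l) x}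

theorem symMap_apply_multi_eq_zero (hK : P.IsKoszul) {z : M.DualSym l →₀ k}
    (hz : z ∈ symRelSpan M l) (m : M.obj (Fin (l + 1))) {B : Fin (l + 1) → Finset ℕ}
    {x : Fin (l + 1) → PTree P →₀ k} (hx : ∀ i, x i ∈ PTree.cycles P (B i).val) :
    symMap M l z (multi m x) = 0 := by
  have : symRelSpan M l ≤ LinearMap.ker ((symMap M l).flip (multi m x)) := by
    refine Submodule.span_le.2 fun z hz => ?_
    show symMap M l z (multi m x) = 0
    cases hz with
    | add ν ν' c =>
      simp only [map_sub, symMap_single, LinearMap.sub_apply, symElt_multi, LinearMap.add_apply,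
        mul_add, add_mul, Finset.sum_add_distrib]
      abel
    | smul a ν c =>
      simp only [map_sub, symMap_single_smul, LinearMap.sub_apply, symElt_multi,
        LinearMap.smul_apply, smul_eq_mul, one_mul, Finset.mul_sum, sub_eq_zero]
      exact Finset.sum_congr rfl fun σ _ => by ring
    | perm σ ν c =>
      simp only [map_sub, symMap_single, LinearMap.sub_apply, symElt_multi, sub_eq_zero]
      rw [← Equiv.sum_comp (Equiv.mulLeft σ)]
      refine Finset.sum_congr rfl fun τ _ => ?_
      have h1 : M.map σ.symm (M.map (σ * τ) m) = M.map τ m := by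
        rw [← M.map_trans]
        congr 1
        congr 1
        ext1 i
        simp
      simp only [Equiv.coe_mulLeft, susDualAct, Function.comp_apply, Equiv.Perm.mul_apply,
        Equiv.symm_apply_apply]
      rw [LinearMap.smul_apply, LinearMap.comp_apply]
      erw [h1]
      rw [Equiv.Perm.sign_mul, zsmul_eq_mul]
      have h2 : ((Equiv.Perm.sign σ : ℤ) : k) * ((Equiv.Perm.sign σ : ℤ) : k) = 1 := by
        rcases Int.units_eq_one_or (Equiv.Perm.sign σ) with h | h <;> simp [h]
      push_cast
      linear_combination (((Equiv.Perm.sign τ : ℤ) : k) * ν (M.map τ m) *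
        ∏ i, btreeElt (c (τ i)) (x i)) * h2
    | tree ν c i y hy =>
      have h1 : (symMap M l).flip (multi m x) ∘ₗ
          Finsupp.lmapDomain k k (fun t => ((ν, Function.update c i t) : M.DualSym l)) =
          ∑ σ : Equiv.Perm (Fin (l + 1)), (((Equiv.Perm.sign σ : ℤ) : k) * ν (M.map σ m) *
            ∏ j ∈ Finset.univ.erase (σ.symm i), btreeElt (c (σ j)) (x j)) •
              (btreeMap P).flip (x (σ.symm i)) := by
        ext1 t
        ext1
        simp only [LinearMap.comp_apply, Finsupp.lsingle_apply, Finsupp.lmapDomain_apply,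
          Finsupp.mapDomain_single, LinearMap.flip_apply, symMap_single, LinearMap.sum_apply,
          LinearMap.smul_apply, symElt_multi, smul_eq_mul]
        rw [show btreeMap P (.single t 1) = btreeElt t from btreeMap_single t]
        refine Finset.sum_congr rfl fun σ _ => ?_
        rw [mul_assoc, ← Finset.mul_prod_erase Finset.univ _ (Finset.mem_univ (σ.symm i)),
          Equiv.apply_symm_apply, Function.update_self, mul_assoc]
        rw [Finset.prod_congr rfl fun j hj => by
          rw [Function.update_of_ne fun h => (Finset.mem_erase.1 hj).1
            ((Equiv.eq_symm_apply _).2 h)]]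
        ring
      have h2 := LinearMap.congr_fun h1 y
      refine h2.trans ?_
      rw [LinearMap.sum_apply]
      refine Finset.sum_eq_zero fun σ _ => ?_
      rw [LinearMap.smul_apply, LinearMap.flip_apply,
        btreeMap_eq_zero_of_mem hK (Submodule.subset_span hy) (hx _), smul_zero]
  exact this hz

/-- An element of degree and filtration `l` lies in `Z¹_{l,0}`. -/
theorem mem_Z_of_mem {A : Finset ℕ} {f : Module.Dual k (M.Rake →₀ k)}
    (hC : f ∈ (M.cobar A).C l) (hF : f ∈ (M.cobar A).F l) : f ∈ (M.cobar A).Z 1 l 0 := by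
  refine ⟨⟨by rwa [add_zero], hF⟩, fun t ht => ?_⟩
  rw [cobar_D_apply, deltaMap_single]
  refine apply_eq_zero_of_support fun s hs => ?_
  obtain ⟨h1, h2, h3⟩ := mem_support_delta t s hs
  refine (mem_cobarC.1 hC).2 s fun h => ?_
  have h4 := h.2
  rw [h2, deg] at h4
  push_cast at h4
  have : (0 : ℤ) ≤ ∑ i, ((t.2.2 i).deg : ℤ) := Finset.sum_nonneg fun i _ => by positivity
  omega

theorem symElt_mem_C (hK : P.IsKoszul) {A : Finset ℕ} {z : M.DualSym l}
    (hz : ∑ i, (z.2 i).labels = A.val) : M.symElt z ∈ (M.cobar A).C l := by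
  have hle : ∀ i, (z.2 i).labels ≤ A.val := fun i => by
    rw [← hz]
    exact Finset.single_le_sum (f := fun i => (z.2 i).labels) (fun i _ => Multiset.zero_le _)
      (Finset.mem_univ i)
  have hmem : ∀ i, ∀ y ∈ PTree.relSpan P, btreeElt (z.2 i) y = 0 := fun i =>
    (Operad.mem_cobar.1 (btreeElt_mem_cobar hK (A := ⟨(z.2 i).labels,
      Multiset.nodup_of_le (hle i) A.nodup⟩) rfl)).1
  have hpair : ∀ (m : M.obj (Fin (l + 1))) (c : Fin (l + 1) → PTree P),
      M.symElt z (.single ⟨l, m, c⟩ 1) ≠ 0 → ∑ i, (c i).labels = A.val ∧ ∀ i, (c i).deg = 0 := by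
    intro m c h
    rw [symElt_single] at h
    obtain ⟨σ, -, hσ⟩ := Finset.exists_ne_zero_of_sum_ne_zero h
    have h1 := fun i => labels_eq_of_btreePair_ne_zero _ _
      (Finset.prod_ne_zero_iff.1 (right_ne_zero_of_mul hσ) i (Finset.mem_univ i))
    refine ⟨?_, fun i => (h1 i).2⟩
    rw [← hz, ← Equiv.sum_comp σ fun i => (z.2 i).labels]
    exact Finset.sum_congr rfl fun i _ => (h1 i).1.symm
  refine mem_cobarC.2 ⟨fun y hy => ?_, fun t ht => ?_⟩
  · have : relSpan M ≤ LinearMap.ker (M.symElt z) := by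
      refine Submodule.span_le.2 fun y hy => ?_
      show M.symElt z y = 0
      have hs : ∀ (t : M.Rake) (a : k), M.symElt z (.single t a) = a * M.symElt z (.single t 1) :=
        fun t a => by simp [symElt]
      cases hy with
      | add l' m m' c =>
        by_cases h : l' = l
        · subst h
          simp only [map_sub, symElt_single, map_add, mul_add, add_mul, Finset.sum_add_distrib]
          abel
        · simp only [map_sub]
          rw [symElt_single_of_ne z h, symElt_single_of_ne z h, symElt_single_of_ne z h]
          simp
      | smul l' a m c =>
        by_cases h : l' = l
        · subst h
          rw [map_sub, hs _ a]
          simp only [symElt_single, map_smul, smul_eq_mul, Finset.mul_sum, sub_eq_zero]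
          exact Finset.sum_congr rfl fun σ _ => by ring
        · rw [map_sub, hs _ a, symElt_single_of_ne z h, symElt_single_of_ne z h]
          simp
      | perm l' σ m c =>
        by_cases h : l' = l
        · subst h
          have h1 : M.symElt z (.single ⟨l', M.map σ m, c ∘ σ.symm⟩ 1) =
              ((Equiv.Perm.sign σ : ℤ) : k) * M.symElt z (.single ⟨l', m, c⟩ 1) := by
            rw [symElt_single, symElt_single, ← Equiv.sum_comp (Equiv.mulRight σ⁻¹),
              Finset.mul_sum]
            refine Finset.sum_congr rfl fun τ _ => ?_
            have h2 : M.map (τ * σ⁻¹) (M.map σ m) = M.map τ m := by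
              rw [← M.map_trans]
              congr 1
              congr 1
              ext1 i
              simp
            simp only [Equiv.coe_mulRight]
            erw [h2]
            rw [Equiv.Perm.sign_mul, Equiv.Perm.sign_inv, ← Equiv.prod_comp σ]
            simp only [Equiv.Perm.mul_apply, Equiv.Perm.inv_def, Function.comp_apply,
              Equiv.symm_apply_apply]
            push_cast
            ring
          rw [map_sub, h1, hs _ ((permSign σ fun i => (c i).deg : ℤ) : k), sub_eq_zero]
          by_cases h0 : M.symElt z (.single ⟨l', m, c⟩ 1) = 0
          · rw [h0, mul_zero, mul_zero]
          · rw [funext (hpair m c h0).2, permSign_zero]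
        · rw [map_sub, hs _ ((permSign σ fun i => (c i).deg : ℤ) : k), symElt_single_of_ne z h, symElt_single_of_ne z h]
          simp
      | child l' m c i y hy =>
        by_cases h : l' = l
        · subst h
          have h1 : M.symElt z ∘ₗ Finsupp.lmapDomain k k
              (fun s => (⟨l', m, Function.update c i s⟩ : M.Rake)) =
              ∑ σ : Equiv.Perm (Fin (l' + 1)), (((Equiv.Perm.sign σ : ℤ) : k) * z.1 (M.map σ m) *
                ∏ j ∈ Finset.univ.erase i, btreePair (z.2 (σ j)) (c j)) •
                  btreeElt (z.2 (σ i)) := by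
            ext1 t
            ext1
            simp only [LinearMap.comp_apply, Finsupp.lsingle_apply, Finsupp.lmapDomain_apply,
              Finsupp.mapDomain_single, LinearMap.sum_apply, LinearMap.smul_apply, btreeElt_single,
              symElt_single, smul_eq_mul]
            refine Finset.sum_congr rfl fun σ _ => ?_
            rw [← Finset.mul_prod_erase Finset.univ _ (Finset.mem_univ i), Function.update_self]
            rw [Finset.prod_congr rfl fun j hj => by
              rw [Function.update_of_ne (Finset.mem_erase.1 hj).1]]
            ring
          refine (LinearMap.congr_fun h1 y).trans ?_
          rw [LinearMap.sum_apply]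
          refine Finset.sum_eq_zero fun σ _ => ?_
          rw [LinearMap.smul_apply, hmem _ _ (Submodule.subset_span hy), smul_zero]
        · refine apply_eq_zero_of_support fun t ht => ?_
          classical
          obtain ⟨s, -, rfl⟩ := Finset.mem_image.1 (Finsupp.mapDomain_support ht)
          exact symElt_single_of_ne z h
    exact this hy
  · by_contra hc
    obtain ⟨l', m, c⟩ := t
    by_cases h : l' = l
    · subst h
      obtain ⟨h1, h2⟩ := hpair m c hc
      refine ht ⟨h1, ?_⟩
      simp [deg, h2]
    · exact hc (symElt_single_of_ne z h)

theorem symElt_mem_Z (hK : P.IsKoszul) {A : Finset ℕ} {z : M.DualSym l}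
    (hz : ∑ i, (z.2 i).labels = A.val) : M.symElt z ∈ (M.cobar A).Z 1 l 0 := by
  refine mem_Z_of_mem (symElt_mem_C hK hz) fun t ht => symElt_single_of_ne z ?_
  omega

end RightModule
end

section
variable {P : Operad.{u, v} k}

/-! ### The row `q = 0` of the first term -/

theorem exists_quotient_equiv {R Z I : Type*} [AddCommGroup R] [Module k R] [AddCommGroup Z]
    [Module k Z] [Finite I] [DecidableEq I] (rel : Submodule k R) (bd : Submodule k Z)
    (s : R →ₗ[k] Z) (ev : Z →ₗ[k] (I → k)) (y : I → R) (h1 : ∀ i, ev (s (y i)) = Pi.single i 1)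
    (h2 : ∀ z, ev z = 0 ↔ z ∈ bd) (h3 : ∀ r ∈ rel, ev (s r) = 0)
    (h4 : ⊤ ≤ Submodule.span k (Set.range y) ⊔ rel) :
    ∃ Φ : (Z ⧸ bd) ≃ₗ[k] (R ⧸ rel), ∀ r, Φ (Submodule.Quotient.mk (s r)) =
      Submodule.Quotient.mk r := by
  have := Fintype.ofFinite I
  let Ψ : (R ⧸ rel) →ₗ[k] (Z ⧸ bd) := rel.mapQ bd s fun r hr => (h2 _).1 (h3 r hr)
  have hΨ : ∀ r, Ψ (Submodule.Quotient.mk r) = Submodule.Quotient.mk (s r) := fun r => rfl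
  have hinj : Function.Injective Ψ := by
    rw [injective_iff_map_eq_zero]
    intro r hr
    obtain ⟨r, rfl⟩ := Submodule.mkQ_surjective _ r
    rw [Submodule.mkQ_apply] at hr ⊢
    rw [hΨ, Submodule.Quotient.mk_eq_zero, ← h2] at hr
    rw [Submodule.Quotient.mk_eq_zero]
    obtain ⟨x, hx, t, ht, rfl⟩ := Submodule.mem_sup.1 (h4 (Submodule.mem_top (x := r)))
    obtain ⟨c, rfl⟩ := (Submodule.mem_span_range_iff_exists_fun k).1 hx
    rw [map_add, map_add, h3 t ht, add_zero, map_sum, map_sum] at hr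
    have hc : c = 0 := by
      rw [← hr]
      ext1 i
      rw [Finset.sum_apply, Finset.sum_eq_single i]
      · rw [map_smul, map_smul, h1]; simp
      · intro j _ hj
        rw [map_smul, map_smul, h1, Pi.smul_apply, Pi.single_eq_of_ne hj.symm, smul_zero]
      · exact fun h => (h (Finset.mem_univ _)).elim
    rw [hc]
    simpa using ht
  have hsurj : Function.Surjective Ψ := by
    intro z
    obtain ⟨z, rfl⟩ := Submodule.mkQ_surjective _ z
    refine ⟨Submodule.Quotient.mk (∑ i, ev z i • y i), ?_⟩
    rw [hΨ, Submodule.mkQ_apply, Submodule.Quotient.eq, ← h2, map_sub, map_sum, map_sum, sub_eq_zero]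
    conv_rhs => rw [← Finset.univ_sum_single (ev z)]
    refine Finset.sum_congr rfl fun i _ => ?_
    rw [map_smul, map_smul, h1, ← Pi.single_smul, smul_eq_mul, mul_one]
  refine ⟨(LinearEquiv.ofBijective Ψ ⟨hinj, hsurj⟩).symm, fun r => ?_⟩
  rw [LinearEquiv.symm_apply_eq]
  rfl

/-- Sequences of finite sets which are sorted with respect to an enumeration of all of them. -/
def IsSorted {n : ℕ} (B : Fin n → Finset ℕ) : Prop :=
  StrictMono fun i => Encodable.encode (B i)

theorem exists_isSorted {n : ℕ} {B : Fin n → Finset ℕ} (hB : Function.Injective B) :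
    ∃ σ : Equiv.Perm (Fin n), IsSorted (B ∘ σ) :=
  ⟨Tuple.sort fun i => Encodable.encode (B i), (Tuple.monotone_sort fun i =>
    Encodable.encode (B i)).strictMono_of_injective
      (Encodable.encode_injective.comp (hB.comp (Equiv.injective _)))⟩

theorem IsSorted.perm_eq_one {n : ℕ} {B : Fin n → Finset ℕ} (hB : IsSorted B)
    {σ : Equiv.Perm (Fin n)} (hσ : IsSorted (B ∘ σ)) : σ = 1 := by
  have h1 : StrictMono σ := fun i j hij => hB.lt_iff_lt.1 (hσ hij)
  have h2 : (σ : Fin n → Fin n) = id :=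
    (h1.range_inj strictMono_id).1 (by rw [σ.surjective.range_eq, Set.range_id])
  exact Equiv.ext fun i => congrFun h2 i

theorem injective_of_sum_val {n : ℕ} {B : Fin n → Finset ℕ} {A : Finset ℕ}
    (h : ∑ i, (B i).val = A.val) (hne : ∀ i, (B i).Nonempty) : Function.Injective B := by
  intro i j hij
  obtain ⟨a, ha⟩ := hne i
  have haA : a ∈ A := by
    rw [← Finset.mem_val, ← h]
    exact Multiset.mem_sum.2 ⟨i, Finset.mem_univ _, ha⟩
  obtain ⟨i₀, -, h0⟩ := RightModule.exists_count_eq (B := fun i => (B i).val) h haA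
  have h1 : ∀ i, a ∈ B i → i = i₀ := fun i hi => by
    by_contra hc
    have := h0 i
    rw [if_neg hc] at this
    exact Multiset.count_eq_zero.1 this hi
  rw [h1 i ha, h1 j (hij ▸ ha)]

/-- Partitions of `A` into `n` sets, in the chosen order. -/
abbrev SortedPartition (n : ℕ) (A : Finset ℕ) : Type :=
  {B : Fin n → Finset ℕ // IsSorted B ∧ ∑ i, (B i).val = A.val}

theorem le_of_sum_val {n : ℕ} {B : Fin n → Multiset ℕ} {A : Finset ℕ}
    (h : ∑ i, B i = A.val) (i : Fin n) : B i ≤ A.val := by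
  rw [← h]
  exact Finset.single_le_sum (f := B) (fun i _ => Multiset.zero_le _) (Finset.mem_univ i)

instance (n : ℕ) (A : Finset ℕ) : Finite (SortedPartition n A) :=
  Finite.of_injective (β := Fin n → A.powerset)
    (fun C i => ⟨C.1 i, Finset.mem_powerset.2 (Finset.val_le_iff.1
      (le_of_sum_val (B := fun i => (C.1 i).val) C.2.2 i))⟩)
    fun _ _ h => Subtype.ext (funext fun i => congrArg Subtype.val (congrFun h i))

namespace RightModule
variable {M : RightModule P} {l : ℕ}
open Rake

/-- The class of a symbol modulo relations, as a linear function of its root. -/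
def symRoot (M : RightModule P) (c : Fin (l + 1) → BTree P.dualData.E) :
    Module.Dual k (M.obj (Fin (l + 1))) →ₗ[k] (M.DualSym l →₀ k) ⧸ symRelSpan M l where
  toFun ν := (symRelSpan M l).mkQ (.single (ν, c) 1)
  map_add' ν ν' := by
    rw [← map_add, ← sub_eq_zero, ← map_sub, Submodule.mkQ_apply, Submodule.Quotient.mk_eq_zero,
      ← sub_sub]
    exact Submodule.subset_span (QuadData.SymRel.add ν ν' c)
  map_smul' a ν := by
    rw [RingHom.id_apply, ← map_smul, ← sub_eq_zero, ← map_sub, Submodule.mkQ_apply,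
      Submodule.Quotient.mk_eq_zero, Finsupp.smul_single, smul_eq_mul, mul_one]
    exact Submodule.subset_span (QuadData.SymRel.smul a ν c)

theorem mem_of_forall_root {W : Submodule k (M.DualSym l →₀ k)} (hW : symRelSpan M l ≤ W)
    {T : Set (Module.Dual k (M.obj (Fin (l + 1))))} (hT : Submodule.span k T = ⊤)
    {c : Fin (l + 1) → BTree P.dualData.E} (h : ∀ ν ∈ T, Finsupp.single (ν, c) 1 ∈ W)
    (ν : Module.Dual k (M.obj (Fin (l + 1)))) : Finsupp.single (ν, c) 1 ∈ W := by
  have h2 : (⊤ : Submodule k (Module.Dual k (M.obj (Fin (l + 1))))) ≤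
      (W.map (symRelSpan M l).mkQ).comap (symRoot M c) := by
    rw [← hT, Submodule.span_le]
    exact fun ν hν => ⟨.single (ν, c) 1, h ν hν, rfl⟩
  obtain ⟨y, hy, hy'⟩ := h2 (Submodule.mem_top (x := ν))
  rw [← sub_sub_cancel y (.single (ν, c) 1)]
  exact sub_mem hy (hW ((Submodule.Quotient.eq _).1 hy'))

theorem finsuppMulti_symbol_mem (ν : Module.Dual k (M.obj (Fin (l + 1))))
    {x : Fin (l + 1) → BTree P.dualData.E →₀ k} {i : Fin (l + 1)}
    (hi : x i ∈ P.dualData.relSpan) :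
    finsuppMulti k (fun c => ((ν, c) : M.DualSym l)) x ∈ symRelSpan M l := by
  refine finsuppMulti_mem _ (fun c i s hs => ?_) hi
  have : P.dualData.relSpan ≤ (symRelSpan M l).comap (Finsupp.lmapDomain k k
      fun t => ((ν, Function.update c i t) : M.DualSym l)) :=
    Submodule.span_le.2 fun y hy => Submodule.subset_span (QuadData.SymRel.tree ν c i y hy)
  exact this hs

/-- A system of dual bases of the pieces of `P^!` and of the spaces of cycles. -/
structure Frame (P : Operad.{u, v} k) where
  n : Finset ℕ → ℕ
  y : ∀ B, Fin (n B) → BTree P.dualData.E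
  v : ∀ B, Fin (n B) → PTree P →₀ k
  labels_y : ∀ B i, (y B i).labels = B.val
  v_mem : ∀ B i, v B i ∈ PTree.cycles P B.val
  pairing : ∀ B i j, btreeElt (y B i) (v B j) = if i = j then 1 else 0
  le_span : ∀ B, PTree.cycles P B.val ≤ Submodule.span k (Set.range (v B)) ⊔ PTree.relSpan P
  single_mem : ∀ B, ∀ t : BTree P.dualData.E, t.labels = B.val → Finsupp.single t 1 ∈
    Submodule.span k (Set.range fun i => Finsupp.single (y B i) (1 : k)) ⊔ P.dualData.relSpan

theorem nonempty_frame (hK : P.IsKoszul) (hP : P.FiniteType) : Nonempty (Frame P) := by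
  choose n y v h1 h2 h3 h4 h5 using exists_frame hK hP
  exact ⟨⟨n, y, v, h1, h2, h3, h4, h5⟩⟩

theorem Frame.nonempty_of_fin (F : Frame P) {B : Finset ℕ} (i : Fin (F.n B)) : B.Nonempty := by
  rw [← Finset.card_pos, Finset.card_def, ← F.labels_y B i]
  exact BTree.card_labels_pos _

/-- An element of `Z¹` that vanishes on the families of cycles of a frame is a boundary. -/
theorem Frame.mem_B (F : Frame P) (hK : P.IsKoszul) {A : Finset ℕ} {q : ℤ} {J : Type*}
    (β : Module.Basis J k (M.obj (Fin (l + 1)))) {f : Module.Dual k (M.Rake →₀ k)}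
    (hf : f ∈ (M.cobar A).Z 1 l q)
    (h : ∀ (B : SortedPartition (l + 1) A) (j : J) (b : ∀ i, Fin (F.n (B.1 i))),
      f (multi (β j) fun i => F.v (B.1 i) (b i)) = 0) : f ∈ (M.cobar A).B 1 l q := by
  have hS := (mem_cobarC.1 hf.1.1).1
  refine mem_B_of_vanishing hK hf fun m B' x hB' hx => ?_
  obtain ⟨B, rfl⟩ : ∃ B : Fin (l + 1) → Finset ℕ, (fun i => (B i).val) = B' :=
    ⟨fun i => ⟨B' i, Multiset.nodup_of_le (le_of_sum_val hB' i) A.nodup⟩, rfl⟩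
  by_cases hne : ∀ i, (B i).Nonempty
  · obtain ⟨σ, hσ⟩ := exists_isSorted (injective_of_sum_val hB' hne)
    have hsum : ∑ i, ((B ∘ σ) i).val = A.val := by
      rw [← hB']
      exact Equiv.sum_comp σ fun i => (B i).val
    have key : f (multi (M.map σ.symm m) (x ∘ σ)) = 0 := by
      refine multilinearMap_eq_zero_of_span
        (f.compMultilinearMap (multi (M.map σ.symm m)))
        (fun i => Set.range (F.v (B (σ i))) ∪ PTree.relSpan P) (fun t ht => ?_) _ fun i => ?_
      · rw [LinearMap.compMultilinearMap_apply]
        by_cases hr : ∃ i, t i ∈ PTree.relSpan P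
        · obtain ⟨i, hi⟩ := hr
          exact hS _ (multi_mem_relSpan _ hi)
        · push Not at hr
          have hb : ∀ i, ∃ b, F.v (B (σ i)) b = t i := fun i => (ht i).resolve_right (hr i)
          choose b hb using hb
          obtain rfl : (fun i => F.v (B (σ i)) (b i)) = t := funext hb
          have h0 : evalRoot f hS (fun i => F.v (B (σ i)) (b i)) = 0 :=
            β.ext fun j => h ⟨B ∘ σ, hσ, hsum⟩ j b
          exact LinearMap.congr_fun h0 (M.map σ.symm m)
      · rw [Submodule.span_union, Submodule.span_eq]
        exact F.le_span _ (hx (σ i))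
    have h1 := apply_multi_perm hS σ (M.map σ.symm m) (x := x ∘ σ) fun i t ht =>
      ((hx (σ i)).1 ht).2
    rw [key, mul_zero, ← M.map_trans, Equiv.symm_trans_self, M.map_refl, Function.comp_assoc,
      Equiv.self_comp_symm, Function.comp_id] at h1
    exact h1
  · push Not at hne
    obtain ⟨i, hi⟩ := hne
    have h0 : x i = 0 := by
      rw [← Finsupp.support_eq_empty, Finset.eq_empty_iff_forall_notMem]
      intro t ht
      refine t.labels_ne_zero (((hx i).1 ht).1.trans ?_)
      simp only [hi]
      rfl
    rw [MultilinearMap.map_coord_zero _ i h0, map_zero]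

/-- Symbols are spanned by those built from a frame, modulo relations. -/
theorem Frame.single_mem_span (F : Frame P) {A : Finset ℕ} {J : Type*} [Finite J]
    (β : Module.Basis J k (M.obj (Fin (l + 1)))) {z : M.DualSym l}
    (hz : ∑ i, (z.2 i).labels = A.val) :
    Finsupp.single z 1 ∈ Submodule.span k (Set.range
      fun x : (Σ B : SortedPartition (l + 1) A, J × ∀ i, Fin (F.n (B.1 i))) =>
        Finsupp.single ((β.coord x.2.1, fun i => F.y (x.1.1 i) (x.2.2 i)) : M.DualSym l) (1 : k)) ⊔
      symRelSpan M l := by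
  classical
  set W := Submodule.span k (Set.range
      fun x : (Σ B : SortedPartition (l + 1) A, J × ∀ i, Fin (F.n (B.1 i))) =>
        Finsupp.single ((β.coord x.2.1, fun i => F.y (x.1.1 i) (x.2.2 i)) : M.DualSym l) (1 : k)) ⊔
      symRelSpan M l with hW
  have hT : Submodule.span k (Set.range β.coord) = ⊤ := by
    rw [← β.coe_dualBasis]
    exact β.dualBasis.span_eq
  have h1 : ∀ (B : SortedPartition (l + 1) A) (b : ∀ i, Fin (F.n (B.1 i)))
      (ν : Module.Dual k (M.obj (Fin (l + 1)))),
      Finsupp.single ((ν, fun i => F.y (B.1 i) (b i)) : M.DualSym l) 1 ∈ W := fun B b =>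
    mem_of_forall_root le_sup_right hT (by
      rintro _ ⟨j, rfl⟩
      exact Submodule.mem_sup_left (Submodule.subset_span ⟨⟨B, j, b⟩, rfl⟩))
  have h2 : ∀ (B : Fin (l + 1) → Finset ℕ) (b : ∀ i, Fin (F.n (B i)))
      (ν : Module.Dual k (M.obj (Fin (l + 1)))), ∑ i, (B i).val = A.val →
      Finsupp.single ((ν, fun i => F.y (B i) (b i)) : M.DualSym l) 1 ∈ W := by
    intro B b ν hB
    obtain ⟨σ, hσ⟩ := exists_isSorted (injective_of_sum_val hB fun i => F.nonempty_of_fin (b i))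
    have h3 := h1 ⟨B ∘ σ, hσ, (Equiv.sum_comp σ fun i => (B i).val).trans hB⟩ (fun i => b (σ i))
      (M.susDualAct l σ.symm ν)
    have h4 := Submodule.subset_span (R := k) (QuadData.SymRel.perm (D := P.dualData)
      (α := M.susDualAct l) σ.symm ν (fun i => F.y (B i) (b i)))
    rw [← sub_sub_cancel (Finsupp.single ((M.susDualAct l σ.symm ν,
      fun i => F.y (B (σ i)) (b (σ i))) : M.DualSym l) (1 : k))
      (.single (ν, fun i => F.y (B i) (b i)) 1)]
    exact sub_mem h3 (Submodule.mem_sup_right h4)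
  obtain ⟨ν, c⟩ := z
  obtain ⟨B, hB⟩ : ∃ B : Fin (l + 1) → Finset ℕ, ∀ i, (B i).val = (c i).labels :=
    ⟨fun i => ⟨(c i).labels, Multiset.nodup_of_le
      (le_of_sum_val (B := fun i => (c i).labels) hz i) A.nodup⟩, fun i => rfl⟩
  rw [← finsuppMulti_single (k := k) (fun c => ((ν, c) : M.DualSym l)),
    ← Submodule.Quotient.mk_eq_zero]
  refine multilinearMap_eq_zero_of_span (W.mkQ.compMultilinearMap
    (finsuppMulti k (fun c => ((ν, c) : M.DualSym l))))
    (fun i => (Set.range fun b => Finsupp.single (F.y (B i) b) (1 : k)) ∪ P.dualData.relSpan)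
    (fun t ht => ?_) _ fun i => ?_
  · rw [LinearMap.compMultilinearMap_apply, Submodule.mkQ_apply, Submodule.Quotient.mk_eq_zero]
    by_cases hr : ∃ i, t i ∈ P.dualData.relSpan
    · obtain ⟨i, hi⟩ := hr
      exact Submodule.mem_sup_right (finsuppMulti_symbol_mem ν hi)
    · push Not at hr
      have hb : ∀ i, ∃ b, Finsupp.single (F.y (B i) b) (1 : k) = t i := fun i =>
        (ht i).resolve_right (hr i)
      choose b hb using hb
      obtain rfl : (fun i => Finsupp.single (F.y (B i) (b i)) (1 : k)) = t := funext hb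
      rw [finsuppMulti_single]
      refine h2 B b ν ?_
      rw [← hz]
      exact Finset.sum_congr rfl fun i _ => hB i
  · rw [Submodule.span_union, Submodule.span_eq]
    exact F.single_mem (B i) (c i) (hB i).symm

theorem Frame.symElt_apply (F : Frame P) {A : Finset ℕ} {J : Type*} [DecidableEq J]
    (β : Module.Basis J k (M.obj (Fin (l + 1))))
    [DecidableEq (Σ B : SortedPartition (l + 1) A, J × ∀ i, Fin (F.n (B.1 i)))]
    (x x' : Σ B : SortedPartition (l + 1) A, J × ∀ i, Fin (F.n (B.1 i))) :
    M.symElt (β.coord x.2.1, fun i => F.y (x.1.1 i) (x.2.2 i))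
      (multi (β x'.2.1) fun i => F.v (x'.1.1 i) (x'.2.2 i)) = if x' = x then 1 else 0 := by
  obtain ⟨⟨B, hB, hBA⟩, j, b⟩ := x
  obtain ⟨⟨B', hB', hBA'⟩, j', b'⟩ := x'
  have h0 : ∀ σ : Equiv.Perm (Fin (l + 1)), B' ≠ B ∘ σ →
      ∏ i, btreeElt (F.y (B (σ i)) (b (σ i))) (F.v (B' i) (b' i)) = 0 := fun σ hσ => by
    obtain ⟨i, hi⟩ := Function.ne_iff.1 hσ
    refine Finset.prod_eq_zero (Finset.mem_univ i) ?_
    refine btreeElt_eq_zero_of_labels_ne (B := (B' i).val) (fun h => hi ?_) (F.v_mem _ _).1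
    rw [F.labels_y] at h
    exact (Finset.val_injective h).symm
  rw [symElt_multi]
  simp only
  by_cases hBB : B' = B
  · subst hBB
    rw [Finset.sum_eq_single 1]
    · rw [show M.map (1 : Equiv.Perm (Fin (l + 1))) (β j') = β j' from M.map_refl _,
        Module.Basis.coord_apply, β.repr_self, Finsupp.single_apply]
      simp only [Equiv.Perm.sign_one, Units.val_one, Int.cast_one, one_mul, Equiv.Perm.one_apply,
        F.pairing]
      by_cases hjj : j' = j
      · subst hjj
        by_cases hbb : b' = b
        · subst hbb; simp
        · have hne : (⟨⟨B', hB', hBA'⟩, j', b'⟩ :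
              Σ B : SortedPartition (l + 1) A, J × ∀ i, Fin (F.n (B.1 i))) ≠
              ⟨⟨B', hB, hBA⟩, j', b⟩ := fun h =>
            hbb (congrArg Prod.snd (eq_of_heq (Sigma.mk.inj h).2))
          rw [if_neg hne]
          obtain ⟨i, hi⟩ := Function.ne_iff.1 hbb
          rw [Finset.prod_eq_zero (Finset.mem_univ i) (if_neg (Ne.symm hi)), mul_zero]
      · rw [if_neg hjj, zero_mul, if_neg fun h => hjj (by
          have := eq_of_heq (Sigma.mk.inj h).2
          exact congrArg Prod.fst this)]
    · intro σ _ hσ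
      rw [h0 σ fun h => hσ (IsSorted.perm_eq_one hB (h ▸ hB')), mul_zero]
    · exact fun h => (h (Finset.mem_univ _)).elim
  · rw [if_neg fun h => hBB (congrArg Subtype.val (Sigma.mk.inj h).1)]
    refine Finset.sum_eq_zero fun σ _ => ?_
    rw [h0 σ fun h => hBB ?_, mul_zero]
    have := IsSorted.perm_eq_one hB (σ := σ) (h ▸ hB')
    rw [h, this]
    rfl

theorem exists_equiv_susDualComp (hK : P.IsKoszul) (hP : P.FiniteType) (hM : M.FiniteType)
    (A : Finset ℕ) (l : ℕ)
    (hZ : ∀ z : {z : M.DualSym l // BTree.FamilyLinear A z.2},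
      M.symElt z.1 ∈ (M.cobar A).Z (1 : ℤ) (l : ℤ) (0 : ℤ)) :
    ∃ Φ : (M.cobar A).E (1 : ℤ) (l : ℤ) (0 : ℤ) ≃ₗ[k] M.SusDualComp l A,
      ∀ z : {z : M.DualSym l // BTree.FamilyLinear A z.2},
        Φ ((M.cobar A).cls (1 : ℤ) (l : ℤ) (0 : ℤ) (M.symElt z.1) (hZ z)) =
          M.susDualMk l A z := by
  classical
  obtain ⟨F⟩ := nonempty_frame hK hP
  have : FiniteDimensional k (M.obj (Fin (l + 1))) := hM _
  let β := Module.finBasis k (M.obj (Fin (l + 1)))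
  let I := Σ B : SortedPartition (l + 1) A,
    Fin (Module.finrank k (M.obj (Fin (l + 1)))) × ∀ i, Fin (F.n (B.1 i))
  let R := {z : M.DualSym l // BTree.FamilyLinear A z.2} →₀ k
  let s : R →ₗ[k] (M.cobar A).Z (1 : ℤ) (l : ℤ) (0 : ℤ) :=
    Finsupp.linearCombination k fun z => ⟨M.symElt z.1, hZ z⟩
  have hs1 : ∀ z, s (.single z 1) = ⟨M.symElt z.1, hZ z⟩ := fun z =>
    (Finsupp.linearCombination_single k _ _).trans (one_smul _ _)
  have hs : ∀ r, (s r).1 = symMap M l (r.mapDomain Subtype.val) := fun r => by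
    have : ((M.cobar A).Z (1 : ℤ) (l : ℤ) (0 : ℤ)).subtype ∘ₗ s =
        symMap M l ∘ₗ Finsupp.lmapDomain k k Subtype.val := by
      ext1 z
      ext1
      simp only [LinearMap.comp_apply, Finsupp.lsingle_apply, Finsupp.lmapDomain_apply,
        Finsupp.mapDomain_single, symMap_single, hs1]
      rfl
    exact LinearMap.congr_fun this r
  let ev : (M.cobar A).Z (1 : ℤ) (l : ℤ) (0 : ℤ) →ₗ[k] (I → k) :=
    LinearMap.pi fun x => (Module.Dual.eval k (M.Rake →₀ k)
      (multi (β x.2.1) fun i => F.v (x.1.1 i) (x.2.2 i))) ∘ₗ Submodule.subtype _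
  let y : I → R := fun x => .single ⟨(β.coord x.2.1, fun i => F.y (x.1.1 i) (x.2.2 i)),
    (BTree.familyLinear_iff _ _).2 ((Finset.sum_congr rfl fun i _ => F.labels_y _ _).trans
      x.1.2.2)⟩ 1
  let rel : Submodule k R := (Submodule.span k {x | P.dualData.SymRel (M.susDualAct l) x}).comap
    (Finsupp.lmapDomain k k Subtype.val)
  let bd : Submodule k ((M.cobar A).Z (1 : ℤ) (l : ℤ) (0 : ℤ)) := ((M.cobar A).B (1 : ℤ) (l : ℤ) (0 : ℤ)).comap
    ((M.cobar A).Z (1 : ℤ) (l : ℤ) (0 : ℤ)).subtype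
  have h1 : ∀ x, ev (s (y x)) = Pi.single x 1 := fun x => by
    ext1 x'
    rw [Pi.single_apply]
    show (s (.single _ 1)).1 (multi (β x'.2.1) fun i => F.v (x'.1.1 i) (x'.2.2 i)) = _
    rw [hs1]
    exact F.symElt_apply β x x'
  have h2 : ∀ z, ev z = 0 ↔ z ∈ bd := fun z => by
    constructor
    · exact fun h => F.mem_B hK β z.2 fun B j b => congrFun h ⟨B, j, b⟩
    · intro h
      ext1 x
      exact apply_multi_eq_zero_of_mem_B h _ (fun i t ht => ((F.v_mem _ _).1 ht).2)
        fun i => (F.v_mem _ _).2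
  have h3 : ∀ r ∈ rel, ev (s r) = 0 := fun r hr => by
    ext1 x
    show (s r).1 (multi (β x.2.1) fun i => F.v (x.1.1 i) (x.2.2 i)) = 0
    rw [hs]
    exact symMap_apply_multi_eq_zero hK hr _ (fun i => F.v_mem _ _)
  have h4 : ⊤ ≤ Submodule.span k (Set.range y) ⊔ rel := by
    rintro r -
    rw [← r.sum_single, Finsupp.sum]
    refine Submodule.sum_mem _ fun z _ => ?_
    rw [← mul_one (r z), ← smul_eq_mul, ← Finsupp.smul_single]
    refine Submodule.smul_mem _ _ ?_
    have h1 := F.single_mem_span (A := A) β ((BTree.familyLinear_iff _ _).1 z.2)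
    obtain ⟨w, hw, t, ht, hwt⟩ := Submodule.mem_sup.1 h1
    have h2 : Submodule.span k (Set.range
        fun x : I => Finsupp.single ((β.coord x.2.1, fun i => F.y (x.1.1 i) (x.2.2 i)) :
          M.DualSym l) (1 : k)) ≤
        (Submodule.span k (Set.range y)).map (Finsupp.lmapDomain k k Subtype.val) := by
      rw [Submodule.span_le]
      rintro _ ⟨x, rfl⟩
      refine ⟨y x, Submodule.subset_span ⟨x, rfl⟩, ?_⟩
      rw [Finsupp.lmapDomain_apply, Finsupp.mapDomain_single]
    obtain ⟨w, hw', rfl⟩ := h2 hw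
    rw [← add_sub_cancel w (.single z 1)]
    refine add_mem (Submodule.mem_sup_left hw') (Submodule.mem_sup_right ?_)
    rw [Submodule.mem_comap, map_sub, Finsupp.lmapDomain_apply k k _ (.single z 1),
      Finsupp.mapDomain_single, ← hwt, add_sub_cancel_left]
    exact ht
  obtain ⟨Φ, hΦ⟩ := exists_quotient_equiv (R := R) (Z := (M.cobar A).Z (1 : ℤ) (l : ℤ) (0 : ℤ))
    (I := I) rel bd s ev y h1 h2 h3 h4
  refine ⟨Φ, fun z => ?_⟩
  rw [susDualMk, ← hΦ, hs1]
  rfl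

end RightModule
end

/-! ### Spectral sequences concentrated in one row -/

namespace FilteredData
variable {W : Type v} [AddCommGroup W] [Module k W] {X : FilteredData k W}

theorem mem_Z {r p q d : ℤ} (hd : p + q = d) {x : W} :
    x ∈ X.Z r p q ↔ x ∈ X.C d ∧ x ∈ X.F p ∧ X.D x ∈ X.F (p - r) := by
  subst hd
  exact and_assoc

theorem IsFilteredComplex.mem_Z_zero (h : X.IsFilteredComplex) {p q d : ℤ} (hd : p + q = d)
    {x : W} : x ∈ X.Z 0 p q ↔ x ∈ X.C d ∧ x ∈ X.F p := by
  rw [mem_Z hd, sub_zero]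
  exact ⟨fun hx => ⟨hx.1, hx.2.1⟩, fun hx => ⟨hx.1, hx.2, h.D_filt d p x hx.1 hx.2⟩⟩

theorem IsFilteredComplex.mem_B_one (h : X.IsFilteredComplex) {p q d : ℤ} (hd : p + q = d)
    {x : W} : x ∈ X.B 1 p q ↔
      ∃ y z, y ∈ X.C d ∧ y ∈ X.F (p - 1) ∧ z ∈ X.C (d + 1) ∧ z ∈ X.F p ∧ x = y + X.D z := by
  constructor
  · intro hx
    obtain ⟨y, hy, _, ⟨z, hz, rfl⟩, rfl⟩ := Submodule.mem_sup.1 hx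
    rw [sub_self, h.mem_Z_zero (d := d) (by omega)] at hy
    replace hz := (h.mem_Z_zero (d := d + 1) (by omega)).1 hz
    rw [show p + 1 - 1 = p by ring] at hz
    exact ⟨y, z, hy.1, hy.2, hz.1, hz.2, rfl⟩
  · rintro ⟨y, z, hy, hy', hz, hz', rfl⟩
    refine Submodule.add_mem_sup ?_ ⟨z, ?_, rfl⟩
    · rw [sub_self, h.mem_Z_zero (d := d) (by omega)]
      exact ⟨hy, hy'⟩
    · refine (h.mem_Z_zero (d := d + 1) (by omega)).2 ⟨hz, ?_⟩
      rwa [show p + 1 - 1 = p by ring]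

theorem subsingleton_E {r p q : ℤ} (h : X.Z r p q ≤ X.B r p q) : Subsingleton (X.E r p q) := by
  rw [Submodule.Quotient.subsingleton_iff, eq_top_iff]
  exact fun x _ => h x.2

/-- A vanishing entry of the spectral sequence stays zero in the later terms. -/
theorem IsFilteredComplex.Z_le_B (h : X.IsFilteredComplex) {p q : ℤ}
    (h1 : X.Z 1 p q ≤ X.B 1 p q) {r : ℤ} (hr : 1 ≤ r) : X.Z r p q ≤ X.B r p q := by
  induction r, hr using Int.leInduction with
  | base => exact h1
  | succ r hr ih =>
    intro x hx
    rw [mem_Z rfl] at hx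
    have hx' : x ∈ X.Z r p q := (mem_Z rfl).2 ⟨hx.1, hx.2.1, h.mono (by omega) hx.2.2⟩
    obtain ⟨y, hy, _, ⟨z, hz, rfl⟩, rfl⟩ := Submodule.mem_sup.1 (ih hx')
    have hz' := (mem_Z (d := p + q + 1) (by omega)).1 hz
    have hy' := (mem_Z (d := p + q) (by omega)).1 hy
    rw [map_add, h.D_D _ z hz'.1, add_zero] at hx
    refine Submodule.add_mem_sup ?_ ⟨z, ?_, rfl⟩
    · exact (mem_Z (d := p + q) (by omega)).2 ⟨hy'.1, hy'.2.1, h.mono (by omega) hx.2.2⟩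
    · exact (mem_Z (d := p + q + 1) (by omega)).2
        ⟨hz'.1, h.mono (by omega) hz'.2.1, h.mono (by omega) hz'.2.2⟩

theorem IsFilteredComplex.d_eq_zero (h : X.IsFilteredComplex)
    (h1 : ∀ p q : ℤ, q ≠ 0 → X.Z 1 p q ≤ X.B 1 p q) {r p q p' q' : ℤ} (hr : 2 ≤ r)
    (hp : p' = p - r) (hq : q' = q + r - 1) : h.d hp hq = 0 := by
  by_cases hq0 : q = 0
  · have := subsingleton_E (h.Z_le_B (h1 p' q' (by omega)) (r := r) (by omega))
    exact Subsingleton.elim _ _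
  · have := subsingleton_E (h.Z_le_B (h1 p q hq0) (r := r) (by omega))
    exact LinearMap.ext fun x => by rw [Subsingleton.elim x 0, map_zero, map_zero]

/-- Cycles in low filtration are boundaries. -/
theorem IsFilteredComplex.exists_D_eq (h : X.IsFilteredComplex)
    (h1 : ∀ p q : ℤ, q ≠ 0 → X.Z 1 p q ≤ X.B 1 p q) (hF : ∀ p < 0, X.F p = ⊥) {d p : ℤ}
    (hpd : p < d) {y : W} (hy : y ∈ X.C d) (hyp : y ∈ X.F p) (hD : X.D y = 0) :
    ∃ w ∈ X.C (d + 1), w ∈ X.F p ∧ X.D w = y := by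
  by_cases hp : p < 0
  · rw [hF p hp, Submodule.mem_bot] at hyp
    exact ⟨0, zero_mem _, zero_mem _, by rw [map_zero, hyp]⟩
  obtain ⟨n, rfl⟩ := Int.eq_ofNat_of_zero_le (not_lt.1 hp)
  clear hp
  induction n generalizing y with
  | zero =>
    obtain ⟨y', z, -, hy'', hz, hz', rfl⟩ := (h.mem_B_one (d := d) (by omega)).1
      (h1 (0 : ℕ) d (by omega) ((mem_Z (d := d) (by simp)).2 ⟨hy, hyp, hD ▸ zero_mem _⟩))
    rw [hF _ (by simp), Submodule.mem_bot] at hy''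
    exact ⟨z, hz, hz', by rw [hy'', zero_add]⟩
  | succ n ih =>
    obtain ⟨y', z, hy', hy'', hz, hz', rfl⟩ := (h.mem_B_one (d := d) (by omega)).1
      (h1 (n + 1 : ℕ) (d - (n + 1 : ℕ)) (by omega)
        ((mem_Z (d := d) (by omega)).2 ⟨hy, hyp, hD ▸ zero_mem _⟩))
    rw [map_add, h.D_D _ z hz, add_zero] at hD
    obtain ⟨w, hw, hw', rfl⟩ := ih hy' hD (by push_cast at hpd; omega)
      (by rwa [show ((n + 1 : ℕ) : ℤ) - 1 = n by omega] at hy'')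
    exact ⟨w + z, add_mem hw hz, add_mem (h.mono (by omega) hw') hz', map_add _ _ _⟩

theorem cls_eq_zero_iff {r p q : ℤ} {x : W} {hx : x ∈ X.Z r p q} :
    X.cls r p q x hx = 0 ↔ x ∈ X.B r p q :=
  Submodule.Quotient.mk_eq_zero _

theorem cls_eq_iff {r p q : ℤ} {x y : W} {hx : x ∈ X.Z r p q} {hy : y ∈ X.Z r p q} :
    X.cls r p q x hx = X.cls r p q y hy ↔ x - y ∈ X.B r p q :=
  Submodule.Quotient.eq _

theorem exists_cls_eq {r p q : ℤ} (x : X.E r p q) : ∃ y hy, X.cls r p q y hy = x := by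
  obtain ⟨y, rfl⟩ := Submodule.mkQ_surjective _ x
  exact ⟨y.1, y.2, rfl⟩

theorem IsFilteredComplex.d_cls (h : X.IsFilteredComplex) {r p q p' q' : ℤ} (hp : p' = p - r)
    (hq : q' = q + r - 1) {x : W} (hx : x ∈ X.Z r p q) :
    h.d hp hq (X.cls r p q x hx) = X.cls r p' q' (X.D x) (h.D_mem_Z hp hq hx) := rfl

/-- If the first term is concentrated in the row `q = 0`, this row computes the homology. -/
theorem IsFilteredComplex.exact_d_iff (h : X.IsFilteredComplex)
    (h1 : ∀ p q : ℤ, q ≠ 0 → X.Z 1 p q ≤ X.B 1 p q) (hF : ∀ p < 0, X.F p = ⊥)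
    (hC : ∀ d, X.C d ≤ X.F d) {p p₁ p₂ : ℤ} {q q₁ q₂ : ℤ} (hq0 : q = 0) (hq1 : q₁ = 0)
    (hp : p = p₁ - 1) (hq : q = q₁ + 1 - 1) (hp' : p₂ = p - 1) (hq' : q₂ = q + 1 - 1) :
    Function.Exact (h.d (r := 1) hp hq) (h.d (r := 1) hp' hq') ↔
      ∀ x ∈ X.C p, X.D x = 0 → ∃ y ∈ X.C (p + 1), X.D y = x := by
  constructor
  · intro hE x hx hD
    have hxZ : x ∈ X.Z 1 p q := (mem_Z (d := p) (by omega)).2 ⟨hx, hC p hx, hD ▸ zero_mem _⟩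
    obtain ⟨y, hy⟩ := (hE (X.cls 1 p q x hxZ)).1 (by
      rw [h.d_cls, cls_eq_zero_iff, hD]
      exact zero_mem _)
    obtain ⟨y, hyZ, rfl⟩ := exists_cls_eq y
    rw [h.d_cls, eq_comm, cls_eq_iff, h.mem_B_one (d := p) (by omega)] at hy
    obtain ⟨u, z, hu, hu', hz, -, hxy⟩ := hy
    have hyC := ((mem_Z (d := p + 1) (by omega)).1 hyZ).1
    have hDu : X.D u = 0 := by
      have := congrArg X.D hxy
      rwa [map_sub, map_add, h.D_D _ _ hyC, h.D_D _ _ hz, hD, sub_zero, add_zero, eq_comm] at this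
    obtain ⟨w, hw, -, rfl⟩ := h.exists_D_eq h1 hF (by omega) hu hu' hDu
    exact ⟨y + (w + z), add_mem hyC (add_mem hw hz), by
      rw [map_add, map_add, ← hxy, add_sub_cancel]⟩
  · intro hH x
    obtain ⟨x, hxZ, rfl⟩ := exists_cls_eq x
    obtain ⟨hx, hx', hDx⟩ := (mem_Z (d := p) (by omega)).1 hxZ
    rw [h.d_cls, cls_eq_zero_iff, h.mem_B_one (d := p - 1) (by omega)]
    constructor
    · rintro ⟨u, z, hu, hu', hz, hz', hxu⟩
      rw [sub_add_cancel] at hz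
      have hDu : X.D u = 0 := by
        have := congrArg X.D hxu
        rwa [map_add, h.D_D _ _ hx, h.D_D _ _ hz, add_zero, eq_comm] at this
      obtain ⟨w, hw, hw', rfl⟩ := h.exists_D_eq h1 hF (by omega) hu hu' hDu
      rw [sub_add_cancel] at hw
      obtain ⟨y, hy, hyx⟩ := hH (x - (w + z)) (sub_mem hx (add_mem hw hz)) (by
        rw [map_sub, map_add, hxu, sub_self])
      have hwz : w + z ∈ X.F (p - 1) :=
        add_mem (h.mono (by omega) hw') (h.mono (by omega) hz')
      have hyZ : y ∈ X.Z 1 p₁ q₁ := (mem_Z (d := p + 1) (by omega)).2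
        ⟨hy, h.mono (by omega) (hC _ hy), by
          rw [hyx]
          exact sub_mem (h.mono (by omega) hx') (h.mono (by omega) hwz)⟩
      refine ⟨X.cls 1 p₁ q₁ y hyZ, ?_⟩
      rw [h.d_cls, eq_comm, cls_eq_iff, hyx, sub_sub_cancel, h.mem_B_one (d := p) (by omega)]
      exact ⟨w + z, 0, add_mem hw hz, hwz, zero_mem _, zero_mem _, by rw [map_zero, add_zero]⟩
    · rintro ⟨y, hy⟩
      obtain ⟨y, hyZ, rfl⟩ := exists_cls_eq y
      have hyC := ((mem_Z (d := p + 1) (by omega)).1 hyZ).1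
      rw [h.d_cls, eq_comm, cls_eq_iff, h.mem_B_one (d := p) (by omega)] at hy
      obtain ⟨u, z, hu, hu', hz, -, hxy⟩ := hy
      have hDu : X.D x = X.D u := by
        have := congrArg X.D hxy
        rwa [map_sub, map_add, h.D_D _ _ hyC, h.D_D _ _ hz, sub_zero, add_zero] at this
      exact ⟨0, u, zero_mem _, zero_mem _, by rwa [sub_add_cancel], by rwa [hp'], by
        rw [zero_add, hDu]⟩

end FilteredData

section
variable {P : Operad.{u, v} k}
namespace RightModule
variable {M : RightModule P}

theorem cobarF_eq_bot (A : Finset ℕ) {p : ℤ} (hp : p < 0) : (M.cobar A).F p = ⊥ := by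
  refine (Submodule.eq_bot_iff _).2 fun f hf => ?_
  ext t
  exact hf t (by omega)

theorem cobarC_le_cobarF (A : Finset ℕ) (d : ℤ) : (M.cobar A).C d ≤ (M.cobar A).F d := by
  refine fun f hf t ht => hf.2 t fun h => ?_
  have h2 := h.2
  rw [Rake.deg] at h2
  push_cast at h2
  have : (0 : ℤ) ≤ ∑ i, ((t.2.2 i).deg : ℤ) := Finset.sum_nonneg fun i _ => by positivity
  omega

end RightModule
end

section
variable {P : Operad.{u, v} k}

/-! ### Homology in degree zero -/

namespace RightModule
variable {M : RightModule P}
open Rake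

theorem map_swap_pact (m : M.obj (Fin 1)) (p : P.obj (Fin 2)) :
    M.map (Equiv.swap 0 1 : Equiv.Perm (Fin (0 + 2))) (M.pact (a := 0) (b := 2) 0 m p) =
      M.pact (a := 0) (b := 2) 0 m (P.map (Equiv.swap 0 1) p) := by
  have h := M.act_map (0 : Fin 1) (Equiv.refl _) (Equiv.swap (0 : Fin 2) 1) m p
  rw [M.map_refl] at h
  rw [pact, pact, show (0 : Fin (0 + 1)) = Equiv.refl (Fin 1) 0 from rfl]
  erw [h]
  rw [← M.map_trans]
  erw [← M.map_trans]
  congr 1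
  congr 1
  ext x
  rcases x with ⟨j, hj⟩ | b
  · exact (hj (Subsingleton.elim (α := Fin 1) _ _)).elim
  · fin_cases b <;> rfl

theorem splice_zero (c : Fin 1 → PTree P) (d : Fin 2 → PTree P) :
    PTree.splice (a := 0) (b := 2) c 0 d = d := by
  funext s
  fin_cases s <;> rfl

theorem symElt_zero_single (x : Module.Dual k (M.obj (Fin 1))) (t : BTree P.dualData.E)
    (m : M.obj (Fin 1)) (c : Fin 1 → PTree P) :
    M.symElt (l := 0) (x, fun _ => t) (.single ⟨0, m, c⟩ 1) = x m * btreePair t (c 0) := by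
  rw [symElt_single]
  simp only [Nat.reduceAdd, Finset.univ_unique, Finset.sum_singleton, Finset.prod_singleton]
  rw [show (default : Equiv.Perm (Fin (0 + 1))) = Equiv.refl _ from rfl]
  erw [M.map_refl]
  simp

theorem symElt_one_single (ν : Module.Dual k (M.obj (Fin 2))) (t₀ t₁ : BTree P.dualData.E)
    (m : M.obj (Fin 2)) (c : Fin 2 → PTree P) :
    M.symElt (l := 1) (ν, ![t₀, t₁]) (.single ⟨1, m, c⟩ 1) =
      ν m * (btreePair t₀ (c 0) * btreePair t₁ (c 1)) -
        ν (M.map (Equiv.swap 0 1) m) * (btreePair t₁ (c 0) * btreePair t₀ (c 1)) := by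
  have hu : (Finset.univ : Finset (Equiv.Perm (Fin 2))) = {1, Equiv.swap 0 1} := by decide
  have h1 : M.map (1 : Equiv.Perm (Fin 2)) m = m := M.map_refl m
  rw [symElt_single]
  simp only [Nat.reduceAdd]
  rw [hu, Finset.sum_pair (by decide)]
  erw [h1]
  simp [Fin.prod_univ_two]
  ring

/-- The differential of `ν(t₀, t₁)`. -/
theorem D_symElt (hK : P.IsKoszul) {A : Finset ℕ} {ν : Module.Dual k (M.obj (Fin 2))}
    {t₀ t₁ : BTree P.dualData.E} (hA : t₀.labels + t₁.labels = A.val)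
    {g : (Module.Dual k (M.obj (Fin 1)) × P.dualData.E) →₀ k}
    (hg : ∀ m p, ν (M.pact (a := 0) (b := 2) 0 m p) = g.sum fun z c => c * (z.1 m * z.2 p)) :
    (M.cobar A).D (M.symElt (l := 1) (ν, ![t₀, t₁])) =
      symMap M 0 (g.mapDomain fun z => (z.1, fun _ => .node z.2 t₀ t₁)) := by
  have h1 : M.symElt (l := 1) (ν, ![t₀, t₁]) ∈ (M.cobar A).C 1 :=
    symElt_mem_C (l := 1) hK (by rw [Fin.sum_univ_two]; exact hA)
  have h2 := (cobar_isFilteredComplex M A).D_mem _ _ h1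
  rw [sub_self] at h2
  have h3 : symMap M 0 (g.mapDomain fun z => (z.1, fun _ => .node z.2 t₀ t₁)) =
      g.sum fun z c => c • M.symElt (l := 0) (z.1, fun _ => .node z.2 t₀ t₁) := by
    rw [symMap, Finsupp.linearCombination_mapDomain, Finsupp.linearCombination_apply]
    rfl
  have h4 : ∀ z ∈ g.support, M.symElt (l := 0) (z.1, fun _ => .node z.2 t₀ t₁) ∈
      (M.cobar A).C 0 := fun z _ =>
    symElt_mem_C (l := 0) hK (by rw [Fin.sum_univ_one]; exact hA)
  have h5 : symMap M 0 (g.mapDomain fun z => (z.1, fun _ => .node z.2 t₀ t₁)) ∈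
      (M.cobar A).C 0 := by
    rw [h3]
    exact Submodule.sum_mem _ fun z hz => Submodule.smul_mem _ _ (h4 z hz)
  ext t
  simp only [LinearMap.comp_apply, Finsupp.lsingle_apply]
  by_cases ht : t.labels = A.val ∧ (t.deg : ℤ) = 0
  · obtain ⟨l, m, c⟩ := t
    have hd : l + ∑ i, (c i).deg = 0 := by exact_mod_cast ht.2
    obtain rfl : l = 0 := by omega
    have hc : (c 0).deg = 0 := by rwa [Fin.sum_univ_one, zero_add] at hd
    rw [cobar_D_apply, deltaMap_single, delta, h3, Finsupp.sum, LinearMap.sum_apply]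
    simp only [LinearMap.smul_apply, symElt_zero_single, smul_eq_mul]
    rw [Fin.sum_univ_one, map_add, map_smul]
    have h6 : M.symElt (l := 1) (ν, ![t₀, t₁]) ((PTree.delta (c 0)).mapDomain fun s =>
        (⟨0, m, Function.update c 0 s⟩ : M.Rake)) = 0 := by
      classical
      refine apply_eq_zero_of_support fun t ht => ?_
      obtain ⟨s, -, rfl⟩ := Finset.mem_image.1 (Finsupp.mapDomain_support ht)
      exact symElt_single_of_ne _ zero_ne_one
    erw [h6]
    rw [smul_zero, add_zero]
    cases hs : c 0 with
    | leaf x =>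
      rw [contract, map_zero, eq_comm]
      refine Finset.sum_eq_zero fun z _ => ?_
      simp [btreePair]
    | node q p d =>
      rw [hs, PTree.deg] at hc
      obtain rfl : q = 0 := by omega
      rw [contract]
      have h7 := symElt_one_single (M := M) ν t₀ t₁ (M.pact (a := 0) (b := 2) 0 m p) d
      rw [map_swap_pact, hg, hg, Finsupp.sum, Finsupp.sum] at h7
      rw [splice_zero]
      refine (congrArg _ (congrArg (Finsupp.single _) (by simp))).trans (h7.trans ?_)
      rw [Finset.sum_mul, Finset.sum_mul, ← Finset.sum_sub_distrib]
      refine Finset.sum_congr rfl fun z _ => ?_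
      rw [btreePair]
      ring
  · rw [(mem_cobarC.1 h2).2 t ht, (mem_cobarC.1 h5).2 t ht]

theorem exists_dualRel (hM : M.FiniteType) (ν : Module.Dual k (M.obj (Fin 2))) :
    ∃ g ∈ M.dualRel, ∀ m p, ν (M.pact (a := 0) (b := 2) 0 m p) =
      g.sum fun z c => c * (z.1 m * z.2 p) := by
  have : FiniteDimensional k (M.obj (Fin 1)) := hM _
  let β := Module.finBasis k (M.obj (Fin 1))
  let F : M.obj (Fin 1) →ₗ[k] Module.Dual k (P.obj (Fin 2)) :=
    LinearMap.mk₂ k (fun m p => ν (M.pact (a := 0) (b := 2) 0 m p))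
      (fun m m' p => by simp [pact]) (fun c m p => by simp [pact])
      (fun m p p' => by simp [pact]) (fun c m p => by simp [pact])
  let g : (Module.Dual k (M.obj (Fin 1)) × P.dualData.E) →₀ k :=
    ∑ i, .single (β.coord i, F (β i)) 1
  have hsum : ∀ h : (Module.Dual k (M.obj (Fin 1)) × P.dualData.E) → k,
      (g.sum fun z c => c * h z) = ∑ i, h (β.coord i, F (β i)) := fun h => by
    have : (g.sum fun z c => c * h z) = Finsupp.linearCombination k h g := rfl
    rw [this, map_sum]
    simp
  have hg : ∀ m p, ν (M.pact (a := 0) (b := 2) 0 m p) = g.sum fun z c => c * (z.1 m * z.2 p) := by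
    intro m p
    rw [hsum fun z => z.1 m * z.2 p]
    conv_lhs => rw [← β.sum_repr m]
    show F (∑ i, β.repr m i • β i) p = _
    rw [map_sum, LinearMap.sum_apply]
    exact Finset.sum_congr rfl fun i _ => by rw [map_smul]; rfl
  refine ⟨g, fun ρ hρ => ?_, hg⟩
  have h1 : (g.sum fun x c => ρ.sum fun y d => c * d * (x.1 y.1 * x.2 y.2)) =
      ρ.sum fun y d => d * g.sum fun x c => c * (x.1 y.1 * x.2 y.2) := by
    simp only [Finsupp.sum, Finset.mul_sum]
    rw [Finset.sum_comm]
    exact Finset.sum_congr rfl fun _ _ => Finset.sum_congr rfl fun _ _ => by ring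
  rw [h1]
  simp only [← hg]
  have h2 : ν (ρ.sum fun z c => c • M.pact (a := 0) (b := 2) 0 z.1 z.2) = 0 := by
    rw [show (ρ.sum fun z c => c • M.pact (a := 0) (b := 2) 0 z.1 z.2) = 0 from hρ, map_zero]
  rw [Finsupp.sum, map_sum] at h2
  rw [← h2]
  exact Finset.sum_congr rfl fun z _ => by rw [map_smul, smul_eq_mul]

theorem exists_of_mem_dualRel {g : (Module.Dual k (M.obj (Fin 1)) × P.dualData.E) →₀ k}
    (hg : g ∈ M.dualRel) : ∃ ν : Module.Dual k (M.obj (Fin 2)),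
      ∀ m p, ν (M.pact (a := 0) (b := 2) 0 m p) = g.sum fun z c => c * (z.1 m * z.2 p) := by
  obtain ⟨ν, hν⟩ := exists_comp_eq_of_ker_le
    (Finsupp.linearCombination k fun z : M.obj (Fin 1) × P.quadData.E =>
      (M.pact (a := 0) (b := 2) 0 z.1 z.2 : M.obj (Fin 2)))
    (Finsupp.linearCombination k fun z : M.obj (Fin 1) × P.quadData.E =>
      g.sum fun x c => c * (x.1 z.1 * x.2 z.2)) (fun ρ hρ => by
        rw [← hg ρ hρ, Finsupp.linearCombination_apply]
        simp only [Finsupp.sum, smul_eq_mul, Finset.mul_sum]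
        rw [Finset.sum_comm]
        exact Finset.sum_congr rfl fun _ _ => Finset.sum_congr rfl fun _ _ => by ring)
  refine ⟨ν, fun m p => ?_⟩
  have := LinearMap.congr_fun hν (.single (m, p) 1)
  simpa using this

end RightModule
end

section
variable {P : Operad.{u, v} k}

/-! ### The canonical map to the Koszul dual module -/

namespace RightModule
variable {M : RightModule P}
open Rake

theorem mem_C_zero_Z {A : Finset ℕ} {f : Module.Dual k (M.Rake →₀ k)} (d : ℕ)
    (hf : f ∈ (M.cobar A).C d) : f ∈ (M.cobar A).Z (1 : ℤ) (d : ℤ) (0 : ℤ) :=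
  mem_Z_of_mem hf (cobarC_le_cobarF A d hf)

/-- Elements of `Z¹_{l,0}` are combinations of symbols, up to boundaries. -/
theorem exists_sub_symMap_mem_B {A : Finset ℕ} {l : ℕ}
    {hZ : ∀ z : {z : M.DualSym l // BTree.FamilyLinear A z.2},
      M.symElt z.1 ∈ (M.cobar A).Z (1 : ℤ) (l : ℤ) (0 : ℤ)}
    {Φ : (M.cobar A).E (1 : ℤ) (l : ℤ) (0 : ℤ) ≃ₗ[k] M.SusDualComp l A}
    (hΦ : ∀ z : {z : M.DualSym l // BTree.FamilyLinear A z.2},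
      Φ ((M.cobar A).cls (1 : ℤ) (l : ℤ) (0 : ℤ) (M.symElt z.1) (hZ z)) = M.susDualMk l A z)
    {f : Module.Dual k (M.Rake →₀ k)} (hf : f ∈ (M.cobar A).Z (1 : ℤ) (l : ℤ) (0 : ℤ)) :
    ∃ r : {z : M.DualSym l // BTree.FamilyLinear A z.2} →₀ k,
      Φ ((M.cobar A).cls _ _ _ f hf) = Submodule.Quotient.mk r ∧
        f - symMap M l (r.mapDomain Subtype.val) ∈ (M.cobar A).B (1 : ℤ) (l : ℤ) (0 : ℤ) := by
  obtain ⟨r, hr⟩ := Submodule.mkQ_surjective _ (Φ ((M.cobar A).cls _ _ _ f hf))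
  refine ⟨r, hr.symm, ?_⟩
  let s : ({z : M.DualSym l // BTree.FamilyLinear A z.2} →₀ k) →ₗ[k]
      (M.cobar A).Z (1 : ℤ) (l : ℤ) (0 : ℤ) :=
    Finsupp.linearCombination k fun z => ⟨M.symElt z.1, hZ z⟩
  have h1 : Φ.toLinearMap ∘ₗ Submodule.mkQ _ ∘ₗ s = Submodule.mkQ _ := by
    ext1 z
    ext1
    simp only [LinearMap.comp_apply, Finsupp.lsingle_apply, s, Finsupp.linearCombination_single,
      one_smul]
    exact hΦ z
  have h2 : ((M.cobar A).Z (1 : ℤ) (l : ℤ) (0 : ℤ)).subtype ∘ₗ s =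
      symMap M l ∘ₗ Finsupp.lmapDomain k k Subtype.val := by
    ext1 z
    ext1
    simp only [LinearMap.comp_apply, Finsupp.lsingle_apply, Finsupp.lmapDomain_apply,
      Finsupp.mapDomain_single, symMap_single, s, Finsupp.linearCombination_single, one_smul]
    rfl
  have h3 : (M.cobar A).cls _ _ _ f hf = Submodule.Quotient.mk (s r) := by
    refine Φ.injective ?_
    rw [← hr]
    exact (LinearMap.congr_fun h1 r).symm
  have h4 := (Submodule.Quotient.eq _).1 h3
  have h5 : (s r).1 = symMap M l (r.mapDomain Subtype.val) := LinearMap.congr_fun h2 r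
  rw [← h5]
  exact h4

theorem B_zero_le {A : Finset ℕ} :
    (M.cobar A).B (1 : ℤ) ((0 : ℕ) : ℤ) (0 : ℤ) ≤ ((M.cobar A).C 1).map (M.cobar A).D := by
  intro f hf
  obtain ⟨y, z, -, hy, hz, -, rfl⟩ :=
    ((cobar_isFilteredComplex M A).mem_B_one (d := 0) (by simp)).1 hf
  rw [cobarF_eq_bot A (by simp), Submodule.mem_bot] at hy
  exact ⟨z, hz, by rw [hy, zero_add]⟩

/-- Relations in the free module on `M(1)^*` are boundaries. -/
theorem symMap_zero_mem (hK : P.IsKoszul) {A : Finset ℕ} {r : M.DualSym 0 →₀ k}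
    (hr : r ∈ symRelSpan M 0) (hC : symMap M 0 r ∈ (M.cobar A).C ((0 : ℕ) : ℤ)) :
    symMap M 0 r ∈ ((M.cobar A).C 1).map (M.cobar A).D := by
  refine B_zero_le (mem_B_of_vanishing hK (mem_C_zero_Z 0 hC) fun m B x hB hx => ?_)
  exact symMap_apply_multi_eq_zero hK hr m
    (B := fun i => ⟨B i, Multiset.nodup_of_le (le_of_sum_val hB i) A.nodup⟩) hx

/-- The class modulo boundaries of `x(t)`, zero unless `t` is labelled by `A`. -/
def unaryClass (M : RightModule P) (A : Finset ℕ) :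
    ((Module.Dual k (M.obj (Fin 1)) × BTree P.dualData.E) →₀ k) →ₗ[k]
      Module.Dual k (M.Rake →₀ k) ⧸ ((M.cobar A).C 1).map (M.cobar A).D :=
  open Classical in Finsupp.linearCombination k fun z =>
    if z.2.labels = A.val then Submodule.Quotient.mk (M.symElt (l := 0) (z.1, fun _ => z.2)) else 0

theorem unaryClass_of_labels {A : Finset ℕ}
    {y : (Module.Dual k (M.obj (Fin 1)) × BTree P.dualData.E) →₀ k}
    (hy : ∀ z ∈ y.support, z.2.labels = A.val) :
    unaryClass M A y =
      Submodule.Quotient.mk (symMap M 0 (y.mapDomain fun z => (z.1, fun _ => z.2))) := by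
  classical
  rw [symMap, Finsupp.linearCombination_mapDomain, Finsupp.linearCombination_apply, unaryClass,
    Finsupp.linearCombination_apply, Finsupp.sum, Finsupp.sum, ← Submodule.mkQ_apply, map_sum]
  refine Finset.sum_congr rfl fun z hz => ?_
  rw [if_pos (hy z hz), map_smul]
  rfl

theorem unaryClass_of_ne {A : Finset ℕ}
    {y : (Module.Dual k (M.obj (Fin 1)) × BTree P.dualData.E) →₀ k}
    (hy : ∀ z ∈ y.support, z.2.labels ≠ A.val) : unaryClass M A y = 0 := by
  classical
  rw [unaryClass, Finsupp.linearCombination_apply, Finsupp.sum]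
  refine Finset.sum_eq_zero fun z hz => ?_
  rw [if_neg (hy z hz), smul_zero]

theorem symMap_zero_mem_C (hK : P.IsKoszul) {A : Finset ℕ}
    {y : (Module.Dual k (M.obj (Fin 1)) × BTree P.dualData.E) →₀ k}
    (hy : ∀ z ∈ y.support, z.2.labels = A.val) :
    symMap M 0 (y.mapDomain fun z => (z.1, fun _ => z.2)) ∈ (M.cobar A).C ((0 : ℕ) : ℤ) := by
  rw [symMap, Finsupp.linearCombination_mapDomain, Finsupp.linearCombination_apply, Finsupp.sum]
  refine Submodule.sum_mem _ fun z hz => Submodule.smul_mem _ _ (symElt_mem_C hK ?_)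
  rw [← hy z hz]
  exact Fin.sum_univ_one _

/-- A homogeneous combination of symbols `x(t)` which is a relation of the free module. -/
theorem unaryClass_eq_zero (hK : P.IsKoszul) {A : Finset ℕ}
    {y : (Module.Dual k (M.obj (Fin 1)) × BTree P.dualData.E) →₀ k} {B : Multiset ℕ}
    (hy : ∀ z ∈ y.support, z.2.labels = B)
    (hr : y.mapDomain (fun z => (z.1, fun _ => z.2)) ∈ symRelSpan M 0) :
    unaryClass M A y = 0 := by
  by_cases hB : B = A.val
  · subst hB
    rw [unaryClass_of_labels hy, Submodule.Quotient.mk_eq_zero]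
    exact symMap_zero_mem hK hr (symMap_zero_mem_C hK hy)
  · exact unaryClass_of_ne fun z hz => (hy z hz).trans_ne hB

theorem unaryClass_modRel (hK : P.IsKoszul) {A : Finset ℕ}
    {y : (Module.Dual k (M.obj (Fin 1)) × BTree P.dualData.E) →₀ k}
    (hy : P.dualData.ModRel M.dualRel y) : unaryClass M A y = 0 := by
  classical
  cases hy with
  | add x x' t =>
    refine unaryClass_eq_zero hK (B := t.labels) (fun z hz => ?_) ?_
    · have h1 := Finsupp.support_sub hz
      rcases Finset.mem_union.1 h1 with h1 | h1
      · rcases Finset.mem_union.1 (Finsupp.support_sub h1) with h1 | h1 <;>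
          rw [Finset.mem_singleton.1 (Finsupp.support_single_subset h1)]
      · rw [Finset.mem_singleton.1 (Finsupp.support_single_subset h1)]
    · rw [← Finsupp.lmapDomain_apply k k, map_sub, map_sub]
      simp only [Finsupp.lmapDomain_apply, Finsupp.mapDomain_single]
      exact Submodule.subset_span (QuadData.SymRel.add x x' fun _ => t)
  | smul a x t =>
    refine unaryClass_eq_zero hK (B := t.labels) (fun z hz => ?_) ?_
    · rcases Finset.mem_union.1 (Finsupp.support_sub hz) with h1 | h1 <;>
        rw [Finset.mem_singleton.1 (Finsupp.support_single_subset h1)]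
    · rw [← Finsupp.lmapDomain_apply k k, map_sub]
      simp only [Finsupp.lmapDomain_apply, Finsupp.mapDomain_single]
      exact Submodule.subset_span (QuadData.SymRel.smul a x fun _ => t)
  | tree x w hw =>
    obtain ⟨B, hB⟩ := hw.homogeneous
    refine unaryClass_eq_zero hK (B := B) (fun z hz => ?_) ?_
    · obtain ⟨t, ht, rfl⟩ := Finset.mem_image.1 (Finsupp.mapDomain_support hz)
      exact hB t ht
    · rw [← Finsupp.mapDomain_comp]
      have h1 := QuadData.SymRel.tree (D := P.dualData) (α := M.susDualAct 0) x
        (fun _ => .leaf 0) 0 w hw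
      have h2 : (fun t => ((x, Function.update (fun _ => .leaf 0) 0 t) : M.DualSym 0)) =
          (fun z : Module.Dual k (M.obj (Fin 1)) × BTree P.dualData.E =>
            ((z.1, fun _ => z.2) : M.DualSym 0)) ∘ fun t => (x, t) := by
        funext t
        refine Prod.ext rfl (funext fun i => ?_)
        rw [Subsingleton.elim (α := Fin 1) i 0]
        simp
      rw [h2] at h1
      exact Submodule.subset_span h1
  | rel g hg t₀ t₁ =>
    have hs : ∀ z ∈ (g.mapDomain fun z : Module.Dual k (M.obj (Fin 1)) × P.dualData.E =>
        (z.1, BTree.node z.2 t₀ t₁)).support, z.2.labels = t₀.labels + t₁.labels := fun z hz => by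
      obtain ⟨t, ht, rfl⟩ := Finset.mem_image.1 (Finsupp.mapDomain_support hz)
      rfl
    by_cases hB : t₀.labels + t₁.labels = A.val
    · obtain ⟨ν, hν⟩ := exists_of_mem_dualRel hg
      rw [unaryClass_of_labels fun z hz => (hs z hz).trans hB, Submodule.Quotient.mk_eq_zero,
        ← Finsupp.mapDomain_comp]
      refine ⟨M.symElt (l := 1) (ν, ![t₀, t₁]), ?_, D_symElt hK hB hν⟩
      exact symElt_mem_C (l := 1) hK (by rw [Fin.sum_univ_two]; exact hB)
    · exact unaryClass_of_ne fun z hz => (hs z hz).trans_ne hB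

/-- The symbol `x(t)` of a family consisting of one tree. -/
def unarySymbol (A : Finset ℕ) (z : {z : M.DualSym 0 // BTree.FamilyLinear A z.2}) :
    {z : Module.Dual k (M.obj (Fin 1)) × BTree P.dualData.E // z.2.Linear A} :=
  ⟨(z.1.1, z.1.2 0), by
    have h := (BTree.familyLinear_iff _ _).1 z.2
    rw [BTree.linear_iff, ← h]
    exact (Fin.sum_univ_one fun i => (z.1.2 i).labels).symm⟩

/-- The canonical projection `M(1)^* ∘ P^! → M^!`. -/
def toDualPiece (M : RightModule P) (A : Finset ℕ) : M.SusDualComp 0 A →ₗ[k] M.DualPiece A :=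
  Submodule.mapQ _ _ (Finsupp.lmapDomain k k (unarySymbol A)) (by
  intro r hr
  let e : M.DualSym 0 → Module.Dual k (M.obj (Fin 1)) × BTree P.dualData.E := fun z => (z.1, z.2 0)
  have h1 : Submodule.span k {x | P.dualData.SymRel (M.susDualAct 0) x} ≤
      (Submodule.span k {x | P.dualData.ModRel M.dualRel x}).comap
        (Finsupp.lmapDomain k k e) := by
    refine Submodule.span_le.2 fun x hx => ?_
    rw [SetLike.mem_coe, Submodule.mem_comap]
    cases hx with
    | add ν ν' c =>
      simp only [map_sub, Finsupp.lmapDomain_apply, Finsupp.mapDomain_single]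
      exact Submodule.subset_span (QuadData.ModRel.add ν ν' (c 0))
    | smul a ν c =>
      simp only [map_sub, Finsupp.lmapDomain_apply, Finsupp.mapDomain_single]
      exact Submodule.subset_span (QuadData.ModRel.smul a ν (c 0))
    | perm σ ν c =>
      have hσ : σ = Equiv.refl (Fin 1) := Subsingleton.elim (α := Equiv.Perm (Fin 1)) _ _
      subst hσ
      have h2 : M.susDualAct 0 (Equiv.refl (Fin 1)) ν = ν := by
        ext m
        have h3 : M.map (Equiv.refl (Fin 1)) m = m := M.map_refl m
        rw [susDualAct, LinearMap.smul_apply, LinearMap.comp_apply]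
        erw [h3]
        simp
      rw [h2, show c ∘ (Equiv.refl (Fin 1)).symm = c from rfl, sub_self, map_zero]
      exact zero_mem _
    | tree ν c i y hy =>
      rw [Finsupp.lmapDomain_apply, ← Finsupp.mapDomain_comp]
      have h2 : e ∘ (fun t => (ν, Function.update c i t)) = fun t => (ν, t) := by
        funext t
        refine Prod.ext rfl ?_
        show Function.update c i t 0 = t
        rw [Subsingleton.elim (α := Fin 1) i 0, Function.update_self]
      rw [h2]
      exact Submodule.subset_span (QuadData.ModRel.tree ν y hy)
  have h2 := h1 hr
  rw [Submodule.mem_comap, ← LinearMap.comp_apply, ← Finsupp.lmapDomain_comp] at h2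
  rw [Submodule.mem_comap, QuadData.modRelations, Submodule.mem_comap, ← LinearMap.comp_apply,
    ← Finsupp.lmapDomain_comp]
  exact h2)

end RightModule
end

section
variable {P : Operad.{u, v} k}

namespace RightModule
variable {M : RightModule P}
open Rake

theorem symElt_mem_Z_of_familyLinear (hK : P.IsKoszul) {A : Finset ℕ} {l : ℕ}
    (z : {z : M.DualSym l // BTree.FamilyLinear A z.2}) :
    M.symElt z.1 ∈ (M.cobar A).Z (1 : ℤ) (l : ℤ) (0 : ℤ) :=
  symElt_mem_Z hK ((BTree.familyLinear_iff _ _).1 z.2)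

/-- The map of degree zero chains to `M^!` always presents `M^!` as the zeroth homology. -/
theorem exists_cobar_to_dualPiece (hK : P.IsKoszul) (hP : P.FiniteType) (hM : M.FiniteType)
    (A : Finset ℕ) : ∃ π : (M.cobar A).C 0 →ₗ[k] M.DualPiece A,
      (∀ z : {z : Module.Dual k (M.obj (Fin 1)) × BTree P.dualData.E // z.2.Linear A},
        ∃ hz : M.symElt (l := 0) (z.1.1, fun _ => z.1.2) ∈ (M.cobar A).C 0,
          π ⟨_, hz⟩ = Submodule.Quotient.mk (Finsupp.single z 1)) ∧
      Function.Surjective π ∧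
      ∀ x : (M.cobar A).C 0, π x = 0 ↔ ∃ y ∈ (M.cobar A).C 1, (M.cobar A).D y = x := by
  obtain ⟨Φ, hΦ⟩ := exists_equiv_susDualComp hK hP hM A 0 (symElt_mem_Z_of_familyLinear hK)
  obtain ⟨Ψ, hΨ⟩ := exists_equiv_susDualComp hK hP hM A 1 (symElt_mem_Z_of_familyLinear hK)
  have hX := cobar_isFilteredComplex M A
  let ι : (M.cobar A).C 0 →ₗ[k] (M.cobar A).Z (1 : ℤ) ((0 : ℕ) : ℤ) (0 : ℤ) :=
    Submodule.inclusion fun f hf => mem_C_zero_Z 0 hf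
  let cl : (M.cobar A).C 0 →ₗ[k] (M.cobar A).E (1 : ℤ) ((0 : ℕ) : ℤ) (0 : ℤ) :=
    Submodule.mkQ _ ∘ₗ ι
  let π : (M.cobar A).C 0 →ₗ[k] M.DualPiece A := toDualPiece M A ∘ₗ Φ.toLinearMap ∘ₗ cl
  have hπr : ∀ (x : (M.cobar A).C 0) r, Φ (cl x) = Submodule.Quotient.mk r →
      π x = Submodule.Quotient.mk (r.mapDomain (unarySymbol A)) := fun x r h => by
    show toDualPiece M A (Φ (cl x)) = _
    rw [h]
    rfl
  have hlin : ∀ (z : {z : Module.Dual k (M.obj (Fin 1)) × BTree P.dualData.E // z.2.Linear A}),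
      BTree.FamilyLinear A (fun _ : Fin 1 => z.1.2) := fun z => by
    rw [BTree.familyLinear_iff, Fin.sum_univ_one]
    exact (BTree.linear_iff _ _).1 z.2
  have hmem : ∀ (z : {z : Module.Dual k (M.obj (Fin 1)) × BTree P.dualData.E // z.2.Linear A}),
      M.symElt (l := 0) (z.1.1, fun _ => z.1.2) ∈ (M.cobar A).C 0 := fun z =>
    symElt_mem_C (l := 0) hK ((BTree.familyLinear_iff _ _).1 (hlin z))
  have hπ : ∀ z, π ⟨_, hmem z⟩ = Submodule.Quotient.mk (Finsupp.single z 1) := fun z => by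
    rw [hπr _ (.single ⟨(z.1.1, fun _ => z.1.2), hlin z⟩ 1) (hΦ ⟨(z.1.1, fun _ => z.1.2), hlin z⟩),
      Finsupp.mapDomain_single]
    rfl
  have hB : ∀ x : (M.cobar A).C 0, x.1 ∈ (M.cobar A).B (1 : ℤ) ((0 : ℕ) : ℤ) (0 : ℤ) →
      π x = 0 := fun x hx => by
    have : cl x = 0 := (Submodule.Quotient.mk_eq_zero _).2 hx
    show toDualPiece M A (Φ (cl x)) = 0
    rw [this, map_zero, map_zero]
  have hDmem : ∀ y ∈ (M.cobar A).C 1, (M.cobar A).D y ∈ (M.cobar A).C 0 := fun y hy => by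
    have := hX.D_mem _ _ hy
    rwa [sub_self] at this
  refine ⟨π, fun z => ⟨hmem z, hπ z⟩, fun w => ?_, fun x => ⟨fun hx => ?_, ?_⟩⟩
  · obtain ⟨r, rfl⟩ := Submodule.mkQ_surjective _ w
    refine ⟨Finsupp.linearCombination k (fun z => (⟨_, hmem z⟩ : (M.cobar A).C 0)) r, ?_⟩
    have : π ∘ₗ Finsupp.linearCombination k (fun z => (⟨_, hmem z⟩ : (M.cobar A).C 0)) =
        Submodule.mkQ _ := by
      ext1 z
      ext1
      simp only [LinearMap.comp_apply, Finsupp.lsingle_apply, Finsupp.linearCombination_single,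
        one_smul]
      exact hπ z
    exact LinearMap.congr_fun this r
  · obtain ⟨r, hr, hrB⟩ := exists_sub_symMap_mem_B hΦ (mem_C_zero_Z 0 x.2)
    rw [hπr x r hr, Submodule.Quotient.mk_eq_zero, QuadData.modRelations,
      Submodule.mem_comap] at hx
    have h1 : Submodule.span k {x | P.dualData.ModRel M.dualRel x} ≤
        LinearMap.ker (unaryClass M A) :=
      Submodule.span_le.2 fun y hy => unaryClass_modRel hK hy
    have h2 := h1 hx
    rw [LinearMap.mem_ker, Finsupp.lmapDomain_apply, ← Finsupp.mapDomain_comp,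
      unaryClass_of_labels, ← Finsupp.mapDomain_comp, Submodule.Quotient.mk_eq_zero] at h2
    · have h3 : (fun z : Module.Dual k (M.obj (Fin 1)) × BTree P.dualData.E =>
          ((z.1, fun _ => z.2) : M.DualSym 0)) ∘ Subtype.val ∘ unarySymbol A = Subtype.val := by
        funext z
        refine Prod.ext rfl (funext fun i => ?_)
        rw [Subsingleton.elim (α := Fin 1) i 0]
        rfl
      rw [h3] at h2
      have h4 := add_mem (B_zero_le hrB) h2
      rw [sub_add_cancel] at h4
      exact h4
    · intro z hz
      classical
      obtain ⟨w, -, rfl⟩ := Finset.mem_image.1 (Finsupp.mapDomain_support hz)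
      exact (BTree.linear_iff _ _).1 (unarySymbol A w).2
  · rintro ⟨y, hy, hyx⟩
    obtain ⟨r, -, hrB⟩ := exists_sub_symMap_mem_B hΨ (mem_C_zero_Z 1 hy)
    have hC1 : ∀ z : {z : M.DualSym 1 // BTree.FamilyLinear A z.2},
        M.symElt z.1 ∈ (M.cobar A).C 1 := fun z =>
      symElt_mem_C (l := 1) hK ((BTree.familyLinear_iff _ _).1 z.2)
    let s : ({z : M.DualSym 1 // BTree.FamilyLinear A z.2} →₀ k) →ₗ[k] (M.cobar A).C 0 :=
      Finsupp.linearCombination k fun z => ⟨(M.cobar A).D (M.symElt z.1), hDmem _ (hC1 z)⟩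
    have hs : (s r).1 = (M.cobar A).D (symMap M 1 (r.mapDomain Subtype.val)) := by
      have : ((M.cobar A).C 0).subtype ∘ₗ s =
          (M.cobar A).D ∘ₗ symMap M 1 ∘ₗ Finsupp.lmapDomain k k Subtype.val := by
        ext1 z
        ext1
        simp only [LinearMap.comp_apply, Finsupp.lsingle_apply, Finsupp.lmapDomain_apply,
          Finsupp.mapDomain_single, symMap_single, s, Finsupp.linearCombination_single, one_smul]
        rfl
      exact LinearMap.congr_fun this r
    have h1 : π (x - s r) = 0 := by
      refine hB _ ?_
      obtain ⟨u, z, hu, hu', hz, -, huz⟩ := (hX.mem_B_one (d := 1) (by simp)).1 hrB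
      rw [Submodule.coe_sub, hs, ← hyx, ← map_sub, huz, map_add, hX.D_D _ _ hz, add_zero]
      refine (hX.mem_B_one (d := 0) (by simp)).2 ⟨0, u, zero_mem _, zero_mem _, ?_, ?_, ?_⟩
      · rwa [zero_add]
      · rwa [show (((1 : ℕ) : ℤ) - 1) = ((0 : ℕ) : ℤ) by simp] at hu'
      · rw [zero_add]
    have h2 : π ∘ₗ s = 0 := by
      ext1 z
      ext1
      simp only [LinearMap.comp_apply, Finsupp.lsingle_apply, s, Finsupp.linearCombination_single,
        one_smul, LinearMap.zero_apply]
      obtain ⟨⟨ν, c⟩, hc⟩ := z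
      have hc' := (BTree.familyLinear_iff _ _).1 hc
      rw [Fin.sum_univ_two] at hc'
      have hcc : c = ![c 0, c 1] := by
        funext i
        fin_cases i <;> rfl
      obtain ⟨g, hg, hν⟩ := exists_dualRel hM ν
      have h3 := D_symElt hK hc' hν
      rw [← hcc] at h3
      let T : Module.Dual k (M.obj (Fin 1)) × P.dualData.E →
          {z : Module.Dual k (M.obj (Fin 1)) × BTree P.dualData.E // z.2.Linear A} :=
        fun z => ⟨(z.1, .node z.2 (c 0) (c 1)), (BTree.linear_iff _ _).2 hc'⟩
      have h4 : (⟨(M.cobar A).D (M.symElt (l := 1) (ν, c)), hDmem _ (hC1 ⟨(ν, c), hc⟩)⟩ :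
          (M.cobar A).C 0) = ∑ z ∈ g.support, g z • ⟨_, hmem (T z)⟩ := by
        ext1
        refine h3.trans ?_
        rw [symMap, Finsupp.linearCombination_mapDomain, Finsupp.linearCombination_apply,
          Finsupp.sum, AddSubmonoidClass.coe_finsetSum]
        rfl
      rw [h4, map_sum]
      simp only [map_smul, hπ]
      have h5 : (∑ z ∈ g.support, g z • (Submodule.Quotient.mk (Finsupp.single (T z) 1) :
          M.DualPiece A)) = Submodule.Quotient.mk (g.mapDomain T) := by
        rw [Finsupp.mapDomain, Finsupp.sum, ← Submodule.mkQ_apply, map_sum]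
        refine Finset.sum_congr rfl fun z _ => ?_
        rw [← mul_one (g z), ← smul_eq_mul, ← Finsupp.smul_single, map_smul, smul_eq_mul, mul_one]
        rfl
      rw [h5, Submodule.Quotient.mk_eq_zero, QuadData.modRelations, Submodule.mem_comap,
        Finsupp.lmapDomain_apply, ← Finsupp.mapDomain_comp]
      exact Submodule.subset_span (QuadData.ModRel.rel g hg (c 0) (c 1))
    have h3 : π (s r) = 0 := LinearMap.congr_fun h2 r
    have h4 := π.map_sub x (s r)
    rw [h1, h3, sub_zero] at h4
    exact h4.symm

/-- `M` is Koszul if and only if its cobar construction is acyclic in positive degrees. -/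
theorem isKoszul_iff (hK : P.IsKoszul) (hP : P.FiniteType) (hM : M.FiniteType) :
    M.IsKoszul ↔ ∀ A : Finset ℕ, A.Nonempty → ∀ d : ℤ, 1 ≤ d → ∀ x ∈ (M.cobar A).C d,
      (M.cobar A).D x = 0 → ∃ y ∈ (M.cobar A).C (d + 1), (M.cobar A).D y = x :=
  ⟨fun h A hA d hd => (h A hA).2 d hd, fun h A hA =>
    ⟨exists_cobar_to_dualPiece hK hP hM A, fun d hd => h A hA d hd⟩⟩

end RightModule
end

end KoszulModules

end

open KoszulModules in
theorem proposition6p1 {k : Type u} [Field k] (P : Operad.{u, v} k) (hPfin : P.FiniteType)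
    (hPquad : P.IsQuadratic) (hPkoszul : P.IsKoszul)
    (M : RightModule P) (hMfin : M.FiniteType) :
    ∃ h : ∀ A : Finset ℕ, (M.cobar A).IsFilteredComplex,
      (∀ A : Finset ℕ, A.Nonempty →
        (∀ p q : ℤ, q ≠ 0 → Subsingleton ((M.cobar A).E 1 p q)) ∧
        (∀ p : ℕ,
          ∃ (hZ : ∀ z : {z : M.DualSym p // BTree.FamilyLinear A z.2},
              M.symElt z.1 ∈ (M.cobar A).Z (1 : ℤ) (p : ℤ) (0 : ℤ))
            (Φ : (M.cobar A).E (1 : ℤ) (p : ℤ) (0 : ℤ) ≃ₗ[k] M.SusDualComp p A),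
            ∀ z : {z : M.DualSym p // BTree.FamilyLinear A z.2},
              Φ ((M.cobar A).cls (1 : ℤ) (p : ℤ) (0 : ℤ) (M.symElt z.1) (hZ z)) =
                M.susDualMk p A z) ∧
        (∀ (r : ℤ), 2 ≤ r → ∀ (p q p' q' : ℤ) (hp : p' = p - r) (hq : q' = q + r - 1),
          (h A).d hp hq = 0)) ∧
      (M.IsQuadratic →
        (M.IsKoszul ↔
          ∀ A : Finset ℕ, A.Nonempty → ∀ p : ℤ, 1 ≤ p →
            Function.Exact
              ((h A).d (r := 1) (p := p + 1) (q := 0) (p' := p) (q' := 0) (by ring) (by ring))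
              ((h A).d (r := 1) (p := p) (q := 0) (p' := p - 1) (q' := 0) (by ring)
                (by ring)))) := by
  have hZB : ∀ (A : Finset ℕ) (p q : ℤ), q ≠ 0 → (M.cobar A).Z 1 p q ≤ (M.cobar A).B 1 p q :=
    fun A p q hq => RightModule.Z_le_B_of_ne_zero hPkoszul A p hq
  refine ⟨fun A => RightModule.cobar_isFilteredComplex M A, fun A _ => ⟨fun p q hq =>
    FilteredData.subsingleton_E (hZB A p q hq), fun p =>
      ⟨RightModule.symElt_mem_Z_of_familyLinear hPkoszul,
        RightModule.exists_equiv_susDualComp hPkoszul hPfin hMfin A p _⟩,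
    fun r hr p q p' q' hp hq => FilteredData.IsFilteredComplex.d_eq_zero _ (hZB A) hr hp hq⟩,
    fun _ => ?_⟩
  rw [RightModule.isKoszul_iff hPkoszul hPfin hMfin]
  refine forall₂_congr fun A _ => forall₂_congr fun p _ => ?_
  exact ((RightModule.cobar_isFilteredComplex M A).exact_d_iff (hZB A)
    (fun _ => RightModule.cobarF_eq_bot A) (RightModule.cobarC_le_cobarF A) rfl rfl
    (by ring) (by ring) (by ring) (by ring)).symm
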